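/- All logarithms are base $2$. Running times are worst-case numbers of unit-cost word-RAM instructions: integer arithmetic modulo $2^w$, integer division and remainder, bitwise operations, shifts, array access, jumps, and drawing a uniformly random element of $\{0,\dots,b\}$ for a word $b$. The word size $w$ is such that integers polynomially large in $k$ fit in a word. For an integer $k\ge 2$ put $B=\lceil k/\log k\rceil$, $t=2\lceil\log k\rceil+12$, $s=2t+\lceil\log k\rceil$ and $C=4(5\lceil\log k\rceil+24)^2B+1$. The subroutine TwoLevelEstimator computes the $\ell_1$ norm of a streamed integer vector $(f_i)_{i\in[n]}$, under the promise that this norm is at most $k$, as follows. *Pre-processing (before the stream).* Find a prime $p$ with $C\le p\le 2C$ and a generator $g$ of $\mathbb F_p^*$. Fill the tables $T_1[i]=g^i \bmod p$ ($0\le i\le p-2$) and $T_2[x]=\mathrm{dlog}_g(x)\in\{0,\dots,p-2\}$ ($1\le x\le p-1$). Choose two hash functions $h_1:[n]\to[B]$ and $h_2:[n]\to[p-1]$. They are given by a uniformly random polynomial of degree $<t$ over $\mathbb F_{\ell_1}$ and one of degree $<2$ over $\mathbb F_{\ell_2}$, for given primes $\ell_1,\ell_2$ that fit in a word. Set counters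 $X_z^j$ ($j\in[B]$, $z\in[2s]$) to $0$. *Stream.* An update $f_i\leftarrow f_i+v$ adds $v\,h_2(i)^z$ to $X_z^{h_1(i)}$ modulo $p$ for each $z\in[2s]$. *Post-processing (after the stream).* For each $j\in[B]$ attempt to recover a vector $f_j=((f_j)_x)_{x\in\mathbb F_p^*}$ over $\mathbb F_p$ with at most $s$ non-zero entries such that $\sum_x (f_j)_x x^z=X_z^j$ for all $z\in[2s]$. Output $\sum_j\sum_x|\sigma((f_j)_x)|$, where $\sigma(\alpha)\in(-p/2,p/2]$ is the integer representing $\alpha$. **Theorem.** There are fixed word-RAM programs (independent of $k$, $w$, $n$, $\ell_1$, $\ell_2$) for the pre-processing and the post-processing, a constant $a$, and functions $T_{\rm pre},T_{\rm post}:\mathbb N\to\mathbb N$ with $$T_{\rm pre}(k)=O(k\log k),\qquad T_{\rm post}(k)=O(k\log k\cdot\log\log k\cdot\log\log\log k)\qquad(k\to\infty),$$ such that the following holds for all $k\ge 2$, all word sizes $w$ with $2^w\ge k^a$, all primes $\ell_1,\ell_2<2^w$, and all outcomes of the random draws. 1. Given $k,\ell_1,\ell_2$ (so the time to find $\ell_1,\ell_2$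 is not counted), the pre-processing program completes the pre-processing described above within $T_{\rm pre}(k)$ steps. This includes finding $p$ and $g$, filling $T_1$ and $T_2$, drawing the coefficients of the two polynomials, and setting the counters to zero. It works whatever words memory holds initially. 2. Started from the memory left by the pre-processing, with the counters replaced by arbitrary residues modulo $p$, the post-processing program stops within $T_{\rm post}(k)$ steps. If vectors $f_j$ as in the post-processing exist for all $j\in[B]$ and $\sum_j\sum_x|\sigma((f_j)_x)|\le k$ (the promise, carried over to the recovered vectors), then it outputs $\sum_j\sum_x|\sigma((f_j)_x)|$. -/

import Mathlib

open Real Filter Asymptotics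

/-! ### A word RAM with unit-cost instructions -/

/-- Instructions of the word RAM.  `d a b` are register names, `A` is the name of an array (a program
is a fixed finite text, so it uses a fixed finite number of registers and arrays). -/
inductive Instr where
  | const (d c : ℕ)
  | add (d a b : ℕ)
  | sub (d a b : ℕ)
  | mul (d a b : ℕ)
  | div (d a b : ℕ)
  | mod (d a b : ℕ)
  | band (d a b : ℕ)
  | bor (d a b : ℕ)
  | bxor (d a b : ℕ)
  | shl (d a b : ℕ)
  | shr (d a b : ℕ)
  | load (d A i : ℕ)
  | store (A i a : ℕ)
  | jump (l : ℕ)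
  | jumpLt (a b l : ℕ)
  | rand (d a : ℕ)
  | halt

abbrev Program := List Instr

/-- The source of randomness: `ω i b` is the outcome of the `i`-th random draw if this draw asks for
a uniformly random element of `{0, …, b}`; the draws are independent. -/
abbrev Coins := ℕ → (b : ℕ) → Fin (b + 1)

/-- Machine configurations: program counter, registers, arrays (name, index), and the number of
random draws made so far. -/
structure State where
  pc : ℕ
  reg : ℕ → ℕ
  mem : ℕ → ℕ → ℕ
  draws : ℕ

/-- All registers and memory cells hold `w`-bit words. -/
def State.Fits (w : ℕ) (c : State) : Prop :=
  (∀ r, c.reg r < 2 ^ w) ∧ ∀ A i, c.mem A i < 2 ^ w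

/-- Write `v` to register `d` and go on to the next instruction. -/
def State.put (c : State) (d v : ℕ) : State :=
  { c with pc := c.pc + 1, reg := Function.update c.reg d v }

/-- Execution of one instruction with word size `w`: arithmetic is modulo `2 ^ w`, `div` and `mod`
are integer division and remainder, then come the bitwise operations and shifts, `rand d a` draws from `{0, …, R[a]}`. -/
def Instr.exec (w : ℕ) (ω : Coins) (c : State) : Instr → State
  | const d v => c.put d (v % 2 ^ w)
  | add d a b => c.put d ((c.reg a + c.reg b) % 2 ^ w)
  | sub d a b => c.put d ((c.reg a + 2 ^ w - c.reg b) % 2 ^ w)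
  | mul d a b => c.put d ((c.reg a * c.reg b) % 2 ^ w)
  | div d a b => c.put d (c.reg a / c.reg b)
  | mod d a b => c.put d (c.reg a % c.reg b)
  | band d a b => c.put d (c.reg a &&& c.reg b)
  | bor d a b => c.put d (c.reg a ||| c.reg b)
  | bxor d a b => c.put d (c.reg a ^^^ c.reg b)
  | shl d a b => c.put d ((c.reg a <<< c.reg b) % 2 ^ w)
  | shr d a b => c.put d (c.reg a >>> c.reg b)
  | load d A i => c.put d (c.mem A (c.reg i))
  | store A i a =>
      { c with
        pc := c.pc + 1
        mem := Function.update c.mem A (Function.update (c.mem A) (c.reg i) (c.reg a)) }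
  | jump l => { c with pc := l }
  | jumpLt a b l => { c with pc := if c.reg a < c.reg b then l else c.pc + 1 }
  | rand d a => { c.put d (ω c.draws (c.reg a) : ℕ) with draws := c.draws + 1 }
  | halt => c

/-- The machine has stopped: at a `halt`, or outside the program text. -/
def Halted (P : Program) (c : State) : Prop :=
  P[c.pc]? = none ∨ P[c.pc]? = some Instr.halt

/-- One time step (a stopped machine does not move). -/
def step (w : ℕ) (ω : Coins) (P : Program) (c : State) : State :=
  match P[c.pc]? with
  | none => c
  | some I => I.exec w ω c

/-- Started in `c`, the program `P` stops after at most `T` steps, in configuration `c'`. -/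
def HaltsWithin (w : ℕ) (ω : Coins) (P : Program) (T : ℕ) (c c' : State) : Prop :=
  ∃ n ≤ T, (step w ω P)^[n] c = c' ∧ Halted P c'

/-! ### The parameters of TwoLevelEstimator -/

namespace TLE

/-- `⌈log k⌉`. -/
noncomputable def logCeil (k : ℕ) : ℕ := ⌈logb 2 (k : ℝ)⌉₊

/-- The number `⌈k / log k⌉` of buckets. -/
noncomputable def buckets (k : ℕ) : ℕ := ⌈(k : ℝ) / logb 2 (k : ℝ)⌉₊

/-- The independence `t` of the family of `h₁`. -/
noncomputable def indep (k : ℕ) : ℕ := 2 * logCeil k + 12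

/-- The sparsity `s`. -/
noncomputable def sparsity (k : ℕ) : ℕ := 2 * indep k + logCeil k

/-- The lower bound `C` on the prime `p`. -/
noncomputable def primeBound (k : ℕ) : ℕ :=
  4 * (5 * logCeil k + 24) ^ 2 * buckets k + 1

/-! ### Memory layout: the arrays holding the data of the subroutine -/

/-- `k, ℓ₁, ℓ₂, p, g`, in this order. -/
abbrev arrPar : ℕ := 0
/-- The `t` coefficients of the polynomial over `𝔽_ℓ₁` that defines `h₁`. -/
abbrev arrH1 : ℕ := 1
/-- The `2` coefficients of the polynomial over `𝔽_ℓ₂` that defines `h₂`. -/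
abbrev arrH2 : ℕ := 2
/-- The table `T₁`. -/
abbrev arrT1 : ℕ := 3
/-- The table `T₂`. -/
abbrev arrT2 : ℕ := 4
/-- The counters; see `counterIdx`. -/
abbrev arrX : ℕ := 5

/-- Position of the counter `X_z^j` in the array of counters, for the bucket `j` (numbered from `0`)
and `z ∈ {1, …, 2s}`. -/
noncomputable def counterIdx (k j z : ℕ) : ℕ := j * (2 * sparsity k) + (z - 1)

/-- The start of the pre-processing: the input is `k` and the primes `ℓ₁, ℓ₂` used for the hash
functions `h₁, h₂`.  All other cells and all registers contain arbitrary words. -/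
structure PreStart (w k l₁ l₂ : ℕ) (c : State) : Prop where
  fits : c.Fits w
  pc : c.pc = 0
  draws : c.draws = 0
  k : c.mem arrPar 0 = k
  l₁ : c.mem arrPar 1 = l₁
  l₂ : c.mem arrPar 2 = l₂

/-- What the pre-processing has to leave in memory: the prime `p`, a generator `g` of `𝔽_p^*`, the
tables `T₁[i] = g ^ i mod p` (`0 ≤ i ≤ p - 2`) and `T₂[x] = dlog x` (`1 ≤ x ≤ p - 1`), the hash
functions, and `2s` counters, initialized to `0`, for each bucket.

The hash functions are given by a uniformly random polynomial of degree `< t` over `𝔽_ℓ₁` and one of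
degree `< 2` over `𝔽_ℓ₂`, whose coefficients are `t + 2` successive random draws. -/
structure PreDone (ω : Coins) (k l₁ l₂ p g : ℕ) (c : State) : Prop where
  par_k : c.mem arrPar 0 = k
  par_l₁ : c.mem arrPar 1 = l₁
  par_l₂ : c.mem arrPar 2 = l₂
  par_p : c.mem arrPar 3 = p
  par_g : c.mem arrPar 4 = g
  prime : p.Prime
  lower : primeBound k ≤ p
  upper : p ≤ 2 * primeBound k
  g_lt : g < p
  generator : ∃ u : (ZMod p)ˣ, (u : ZMod p) = (g : ZMod p) ∧ ∀ x, x ∈ Subgroup.zpowers u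
  table₁ : ∀ i < p - 1, c.mem arrT1 i = g ^ i % p
  table₂ : ∀ x ∈ Finset.Icc 1 (p - 1), c.mem arrT2 x < p - 1 ∧ g ^ c.mem arrT2 x % p = x
  hash₁ : ∀ e < indep k, c.mem arrH1 e = (ω e (l₁ - 1) : ℕ)
  hash₂ : ∀ e < 2, c.mem arrH2 e = (ω (indep k + e) (l₂ - 1) : ℕ)
  counters : ∀ j < buckets k, ∀ z ∈ Finset.Icc 1 (2 * sparsity k),
    c.mem arrX (counterIdx k j z) = 0

/-- The start `c` of the post-processing, when the pre-processing ended in `c₁`: the stream has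
changed the counters, which hold arbitrary residues modulo `p`, and nothing else in memory.  The
registers contain arbitrary words. -/
structure PostStart (w k p : ℕ) (c₁ c : State) : Prop where
  fits : c.Fits w
  pc : c.pc = 0
  counters : ∀ j < buckets k, ∀ z ∈ Finset.Icc 1 (2 * sparsity k),
    c.mem arrX (counterIdx k j z) < p
  others : ∀ A i, ¬ (A = arrX ∧ i < buckets k * (2 * sparsity k)) → c.mem A i = c₁.mem A i

/-- `f j` is, for each bucket `j`, an `s`-sparse vector `(f j x)`, `x ∈ 𝔽_p^* = {1, …, p - 1}`, with
`∑ x, f j x * x ^ z = X_z^j` for `z = 1, …, 2s`. -/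
def SparseSolution (k p : ℕ) (c : State) (f : ℕ → ℕ → ZMod p) : Prop :=
  ∀ j < buckets k,
    ((Finset.Icc 1 (p - 1)).filter fun x => f j x ≠ 0).card ≤ sparsity k ∧
    ∀ z ∈ Finset.Icc 1 (2 * sparsity k),
      ∑ x ∈ Finset.Icc 1 (p - 1), f j x * (x : ZMod p) ^ z
        = (c.mem arrX (counterIdx k j z) : ZMod p)

/-- The output `∑ j, ∑ x, |σ (f j x)|`, where `σ α` is the representative of `α` in
`(-p/2, p/2]`.  If the streamed vector has `ℓ¹` norm at most `k`, which is the promise under which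
the subroutine is run, then this is at most `k` for the vectors `f j` whose entry at `x` is the total
frequency, modulo `p`, of the items hashed to the bucket `j` and to `x`. -/
noncomputable def output (k p : ℕ) (f : ℕ → ℕ → ZMod p) : ℕ :=
  ∑ j ∈ Finset.range (buckets k), ∑ x ∈ Finset.Icc 1 (p - 1), (f j x).valMinAbs.natAbs

end TLE

/-! Only the ℓ₁ norm is asked for, so the recovered vectors are never written out and no polynomial
is factored. Suppose a bucket holds the power sums of a vector v with support I, |I| ≤ s. Modulo
X^(2s) their generating function S is Ω/Λ, where Λ = ∏ (1 - xX) over I and Ω has degree below |I|.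
The extended Euclidean algorithm for X^(2s) and S, stopped halfway, therefore returns Λ and Ω up to
a common scalar (`EuclidInv.pade`, `EuclidInv.sparse`). At the root 1/x of Λ one has Ω + v_x Λ' = 0.
So the x with v_x = c belong to the common roots of Λ and Ω + cΛ', and the Euclidean algorithm for
this pair, run to the end, has as final cofactor Λ with exactly these roots removed
(`EuclidInv.peel`). Removing c = 1, -1, 2, -2, ... and adding the current degree before each pair ±r
gives the sum over r ≥ 1 of #{x : |σ(v_x)| ≥ r}, which is the norm (`level_succ`, `wp_drain`).

Inverses modulo p come from the tables, so decoding costs O(s²) for each of O(k / log k) buckets. A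
round at degree d costs O(sd) and adds d to the running total, and the program gives up once the
total exceeds k; hence all rounds together cost O(s(k + s)). Both bounds are O(k log k), so the
iterated logarithms allowed for the post-processing are slack. Giving up early also bounds the time
for counters that come from no sparse vector.

The pre-processing has to be linear in C = Θ(k log k). Three points matter. (1) Euler's sieve
crosses out every composite once and yields least prime factors (`wp_sieve`). (2) The bucket number
B involves a real logarithm. It is replaced by bounds Bm ≤ B ≤ Bp computed from ⌊64 log k⌋, so the
prime has to be found in a slightly shortened Bertrand interval. Erdős's proof has room for this
when k is large (`exists_prime_lt_and_add_le_two_mul`, `bucketBounds_approx`); the finitely many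
remaining bucket numbers are constants of the program. (3) For the generator, keep an element g with
tabulated powers. An element y not yet marked is no power of g, so in a cyclic group ord y does not
divide ord g, and either y itself or a combination of g and y has at least twice the order of g
(`orderOf_combine`). Tabulating costs as much as the order, and a geometric series gives O(p)
(`wp_generator`).

The programs are written in a small while language with a clock. `Cmd.Exec.steps` shows that
compiled code takes exactly the time on the clock, provided that nothing overflows; the
specifications `wp_...` establish correctness, time and absence of overflow together. -/

set_option linter.unusedSimpArgs false

set_option linter.unnecessarySeqFocus false

/-! ### A structured while language on top of the word RAM -/

namespace WordRAM

/-- Binary operations of the expression language. -/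
inductive Op where
  | add | sub | mul | div | mod

/-- The exact (not wrapped) result of an operation. -/
def Op.fn : Op → ℕ → ℕ → ℕ
  | add, a, b => a + b
  | sub, a, b => a - b
  | mul, a, b => a * b
  | div, a, b => a / b
  | mod, a, b => a % b

/-- The machine result of the operation is the exact one. -/
def Op.Ok (W : ℕ) : Op → ℕ → ℕ → Prop
  | add, a, b => a + b < W
  -- Subtraction of naturals truncates while the machine wraps around; they agree when b ≤ a.
  | sub, a, b => b ≤ a
  | mul, a, b => a * b < W
  | div, _, _ => True
  | mod, _, _ => True

def Op.instr : Op → ℕ → ℕ → ℕ → Instr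
  | add => .add
  | sub => .sub
  | mul => .mul
  | div => .div
  | mod => .mod

/-- Expressions: literals, variables, operations, and array access. -/
inductive Expr where
  | lit (n : ℕ)
  | var (r : ℕ)
  | bin (o : Op) (a b : Expr)
  | ld (A : ℕ) (i : Expr)

instance : Add Expr := ⟨.bin .add⟩
instance : Sub Expr := ⟨.bin .sub⟩
instance : Mul Expr := ⟨.bin .mul⟩
instance : Div Expr := ⟨.bin .div⟩
instance : Mod Expr := ⟨.bin .mod⟩
instance (n : ℕ) : OfNat Expr n := ⟨.lit n⟩

/-- The abstract machine state: variables, arrays, number of draws, and a clock. -/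
structure Env where
  var : ℕ → ℕ
  mem : ℕ → ℕ → ℕ
  draws : ℕ
  time : ℕ

def Env.set (σ : Env) (d v : ℕ) : Env := { σ with var := Function.update σ.var d v }

def Env.st (σ : Env) (A i v : ℕ) : Env :=
  { σ with mem := Function.update σ.mem A (Function.update (σ.mem A) i v) }

def Env.tick (σ : Env) (n : ℕ) : Env := { σ with time := σ.time + n }

def Env.drew (σ : Env) : Env := { σ with draws := σ.draws + 1 }

namespace Env
variable (σ : Env) (d v A i n r B j : ℕ)

@[simp] theorem set_var : (σ.set d v).var r = if r = d then v else σ.var r := by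
  simp [set, Function.update_apply]
@[simp] theorem set_mem : (σ.set d v).mem = σ.mem := rfl
@[simp] theorem set_draws : (σ.set d v).draws = σ.draws := rfl
@[simp] theorem set_time : (σ.set d v).time = σ.time := rfl
@[simp] theorem st_draws : (σ.st A i v).draws = σ.draws := rfl
@[simp] theorem st_var : (σ.st A i v).var = σ.var := rfl
@[simp] theorem st_mem :
    (σ.st A i v).mem B j = if B = A ∧ j = i then v else σ.mem B j := by
  by_cases h : B = A
  · subst h; simp [st, Function.update_apply]
  · simp [st, Function.update_apply, h]
@[simp] theorem st_time : (σ.st A i v).time = σ.time := rfl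
@[simp] theorem tick_var : (σ.tick n).var = σ.var := rfl
@[simp] theorem tick_mem : (σ.tick n).mem = σ.mem := rfl
@[simp] theorem tick_draws : (σ.tick n).draws = σ.draws := rfl
@[simp] theorem tick_time : (σ.tick n).time = σ.time + n := rfl
@[simp] theorem drew_var : σ.drew.var = σ.var := rfl
@[simp] theorem drew_mem : σ.drew.mem = σ.mem := rfl
@[simp] theorem drew_draws : σ.drew.draws = σ.draws + 1 := rfl
@[simp] theorem drew_time : σ.drew.time = σ.time := rfl

end Env

namespace Expr

def val (σ : Env) : Expr → ℕ
  | lit n => n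
  | var r => σ.var r
  | bin o a b => o.fn (a.val σ) (b.val σ)
  | ld A i => σ.mem A (i.val σ)

/-- No overflow happens in the evaluation. -/
def Safe (W : ℕ) (σ : Env) : Expr → Prop
  | lit n => n < W
  | var _ => True
  | bin o a b => a.Safe W σ ∧ b.Safe W σ ∧ o.Ok W (a.val σ) (b.val σ)
  | ld _ i => i.Safe W σ

/-- Number of instructions of the code. -/
def cost : Expr → ℕ
  | lit _ => 1
  | var _ => 1
  | bin _ a b => a.cost + b.cost + 1
  | ld _ i => i.cost + 1

/-- Code that evaluates an expression to the register `2 * t + 1`, using odd registers only. -/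
def code : Expr → ℕ → List Instr
  | lit n, t => [.const (2 * t + 1) n]
  -- There is no move instruction; the bitwise or of a register with itself is a copy.
  | var r, t => [.bor (2 * t + 1) (2 * r) (2 * r)]
  | bin o a b, t =>
      a.code t ++ b.code (t + 1) ++ [o.instr (2 * t + 1) (2 * t + 1) (2 * (t + 1) + 1)]
  | ld A i, t => i.code t ++ [.load (2 * t + 1) A (2 * t + 1)]

theorem length_code (e : Expr) (t : ℕ) : (e.code t).length = e.cost := by
  induction e generalizing t <;> simp_all [code, cost] <;> omega

variable (W : ℕ) (σ : Env)

@[simp] theorem val_ofNat (n : ℕ) : val σ (no_index (OfNat.ofNat n)) = OfNat.ofNat n := rfl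
@[simp] theorem val_lit (n : ℕ) : val σ (lit n) = n := rfl
@[simp] theorem val_var (r : ℕ) : val σ (var r) = σ.var r := rfl
@[simp] theorem val_add (a b : Expr) : val σ (a + b) = a.val σ + b.val σ := rfl
@[simp] theorem val_sub (a b : Expr) : val σ (a - b) = a.val σ - b.val σ := rfl
@[simp] theorem val_mul (a b : Expr) : val σ (a * b) = a.val σ * b.val σ := rfl
@[simp] theorem val_div (a b : Expr) : val σ (a / b) = a.val σ / b.val σ := rfl
@[simp] theorem val_mod (a b : Expr) : val σ (a % b) = a.val σ % b.val σ := rfl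
@[simp] theorem val_ld (A : ℕ) (i : Expr) : val σ (ld A i) = σ.mem A (i.val σ) := rfl

@[simp] theorem safe_ofNat (n : ℕ) : Safe W σ (no_index (OfNat.ofNat n)) ↔ OfNat.ofNat n < W := Iff.rfl
@[simp] theorem safe_lit (n : ℕ) : Safe W σ (lit n) ↔ n < W := Iff.rfl
@[simp] theorem safe_var (r : ℕ) : Safe W σ (var r) ↔ True := Iff.rfl
@[simp] theorem safe_add (a b : Expr) : Safe W σ (a + b) ↔
    a.Safe W σ ∧ b.Safe W σ ∧ a.val σ + b.val σ < W := Iff.rfl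
@[simp] theorem safe_sub (a b : Expr) : Safe W σ (a - b) ↔
    a.Safe W σ ∧ b.Safe W σ ∧ b.val σ ≤ a.val σ := Iff.rfl
@[simp] theorem safe_mul (a b : Expr) : Safe W σ (a * b) ↔
    a.Safe W σ ∧ b.Safe W σ ∧ a.val σ * b.val σ < W := Iff.rfl
@[simp] theorem safe_div (a b : Expr) : Safe W σ (a / b) ↔ a.Safe W σ ∧ b.Safe W σ :=
  ⟨fun h => ⟨h.1, h.2.1⟩, fun h => ⟨h.1, h.2, trivial⟩⟩
@[simp] theorem safe_mod (a b : Expr) : Safe W σ (a % b) ↔ a.Safe W σ ∧ b.Safe W σ :=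
  ⟨fun h => ⟨h.1, h.2.1⟩, fun h => ⟨h.1, h.2, trivial⟩⟩
@[simp] theorem safe_ld (A : ℕ) (i : Expr) : Safe W σ (ld A i) ↔ i.Safe W σ := Iff.rfl

@[simp] theorem cost_ofNat (n : ℕ) : cost (no_index (OfNat.ofNat n)) = 1 := rfl
@[simp] theorem cost_lit (n : ℕ) : cost (lit n) = 1 := rfl
@[simp] theorem cost_var (r : ℕ) : cost (var r) = 1 := rfl
@[simp] theorem cost_add (a b : Expr) : cost (a + b) = a.cost + b.cost + 1 := rfl
@[simp] theorem cost_sub (a b : Expr) : cost (a - b) = a.cost + b.cost + 1 := rfl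
@[simp] theorem cost_mul (a b : Expr) : cost (a * b) = a.cost + b.cost + 1 := rfl
@[simp] theorem cost_div (a b : Expr) : cost (a / b) = a.cost + b.cost + 1 := rfl
@[simp] theorem cost_mod (a b : Expr) : cost (a % b) = a.cost + b.cost + 1 := rfl
@[simp] theorem cost_ld (A : ℕ) (i : Expr) : cost (ld A i) = i.cost + 1 := rfl

end Expr

/-- Structured programs. -/
inductive Cmd where
  | skip
  | assign (d : ℕ) (e : Expr)
  | store (A : ℕ) (i e : Expr)
  | rand (d : ℕ) (e : Expr)
  | seq (c₁ c₂ : Cmd)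
  | ite (a b : Expr) (c₁ c₂ : Cmd)
  | while (a b : Expr) (c : Cmd)

infix:60 " ::= " => Cmd.assign
infixr:55 " ;; " => Cmd.seq

namespace Cmd

/-- Big-step semantics; `ite a b` and `while a b` test `a < b`. -/
inductive Exec (W : ℕ) (ω : Coins) : Cmd → Env → Env → Prop where
  | skip (σ) : Exec W ω skip σ σ
  | assign (d e σ) : e.Safe W σ → Exec W ω (assign d e) σ ((σ.set d (e.val σ)).tick (e.cost + 1))
  | store (A i e σ) : i.Safe W σ → e.Safe W σ →
      Exec W ω (store A i e) σ ((σ.st A (i.val σ) (e.val σ)).tick (i.cost + e.cost + 1))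
  | rand (d e σ) : e.Safe W σ →
      Exec W ω (rand d e) σ (((σ.set d (ω σ.draws (e.val σ))).drew).tick (e.cost + 1))
  | seq {c₁ c₂ σ₁ σ₂ σ₃} : Exec W ω c₁ σ₁ σ₂ → Exec W ω c₂ σ₂ σ₃ → Exec W ω (seq c₁ c₂) σ₁ σ₃
  | iteT {a b c₁ c₂ σ σ'} : a.Safe W σ → b.Safe W σ → a.val σ < b.val σ →
      Exec W ω c₁ (σ.tick (a.cost + b.cost + 1)) σ' → Exec W ω (ite a b c₁ c₂) σ σ'
  -- The code of the else branch comes first, so it ends with a jump over the other branch: one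
  -- extra tick.
  | iteF {a b c₁ c₂ σ σ'} : a.Safe W σ → b.Safe W σ → ¬ a.val σ < b.val σ →
      Exec W ω c₂ (σ.tick (a.cost + b.cost + 1)) σ' → Exec W ω (ite a b c₁ c₂) σ (σ'.tick 1)
  | whileT {a b c σ σ₁ σ₂} : a.Safe W σ → b.Safe W σ → a.val σ < b.val σ →
      Exec W ω c (σ.tick (a.cost + b.cost + 1)) σ₁ →
      Exec W ω (.while a b c) (σ₁.tick 1) σ₂ → Exec W ω (.while a b c) σ σ₂
  -- Leaving the loop takes two instructions: the conditional jump that fails and the jump behind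
  -- the body.
  | whileF {a b c σ} : a.Safe W σ → b.Safe W σ → ¬ a.val σ < b.val σ →
      Exec W ω (.while a b c) σ (σ.tick (a.cost + b.cost + 2))

/-- Number of instructions of the compiled code. -/
def len : Cmd → ℕ
  | skip => 0
  | assign _ e => e.cost + 1
  | store _ i e => i.cost + e.cost + 1
  | rand _ e => e.cost + 1
  | seq c₁ c₂ => c₁.len + c₂.len
  | ite a b c₁ c₂ => a.cost + b.cost + 1 + c₂.len + 1 + c₁.len
  | .while a b c => a.cost + b.cost + 2 + c.len + 1

/-- Code placed at the address `off`. -/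
def compile : Cmd → ℕ → List Instr
  | skip, _ => []
  | assign d e, _ => e.code 0 ++ [.bor (2 * d) 1 1]
  | store A i e, _ => i.code 0 ++ e.code 1 ++ [.store A 1 3]
  | rand d e, _ => e.code 0 ++ [.rand (2 * d) 1]
  | seq c₁ c₂, off => c₁.compile off ++ c₂.compile (off + c₁.len)
  | ite a b c₁ c₂, off =>
      a.code 0 ++ b.code 1 ++
        [.jumpLt 1 3 (off + (a.cost + b.cost + 1 + c₂.len + 1))] ++
        c₂.compile (off + (a.cost + b.cost + 1)) ++
        [.jump (off + (a.cost + b.cost + 1 + c₂.len + 1 + c₁.len))] ++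
        c₁.compile (off + (a.cost + b.cost + 1 + c₂.len + 1))
  | .while a b c, off =>
      a.code 0 ++ b.code 1 ++
        [.jumpLt 1 3 (off + (a.cost + b.cost + 2)),
         .jump (off + (a.cost + b.cost + 2 + c.len + 1))] ++
        c.compile (off + (a.cost + b.cost + 2)) ++ [.jump off]

theorem length_compile (c : Cmd) (off : ℕ) : (c.compile off).length = c.len := by
  induction c generalizing off <;> simp_all [compile, len, Expr.length_code] <;> omega

end Cmd

/-! ### Correctness of the compilation -/

/-- The list `L` of instructions stands in `P` from the address `off` on. -/
def CodeAt (P : Program) (off : ℕ) (L : List Instr) : Prop :=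
  ∃ pre suf, P = pre ++ L ++ suf ∧ pre.length = off

theorem codeAt_append {P : Program} {off : ℕ} {L M : List Instr} (h : CodeAt P off (L ++ M)) :
    CodeAt P off L ∧ CodeAt P (off + L.length) M := by
  obtain ⟨pre, suf, rfl, rfl⟩ := h
  exact ⟨⟨pre, M ++ suf, by simp, rfl⟩, ⟨pre ++ L, suf, by simp, by simp⟩⟩

theorem CodeAt.get {P : Program} {off : ℕ} {I : Instr} {L : List Instr}
    (h : CodeAt P off (I :: L)) : P[off]? = some I := by
  obtain ⟨pre, suf, rfl, rfl⟩ := h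
  simp

theorem CodeAt.cast {P : Program} {a b : ℕ} {L M : List Instr} (h : CodeAt P a L) (hab : a = b)
    (hLM : L = M) : CodeAt P b M := by
  subst hab hLM; exact h

theorem exec_fits {w : ℕ} {ω : Coins} {c : State} (h : c.Fits w) (I : Instr) :
    (I.exec w ω c).Fits w := by
  have hp : 0 < 2 ^ w := by positivity
  have key : ∀ d v, v < 2 ^ w → (c.put d v).Fits w := fun d v hv =>
    ⟨fun r => by
      simp only [State.put, Function.update_apply]; split_ifs
      exacts [hv, h.1 r], h.2⟩
  cases I with
  | const d v => exact key _ _ (Nat.mod_lt _ hp)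
  | add d a b => exact key _ _ (Nat.mod_lt _ hp)
  | sub d a b => exact key _ _ (Nat.mod_lt _ hp)
  | mul d a b => exact key _ _ (Nat.mod_lt _ hp)
  | div d a b => exact key _ _ ((Nat.div_le_self _ _).trans_lt (h.1 _))
  | mod d a b => exact key _ _ ((Nat.mod_le _ _).trans_lt (h.1 _))
  | band d a b => exact key _ _ (Nat.and_lt_two_pow _ (h.1 _))
  | bor d a b => exact key _ _ (Nat.or_lt_two_pow (h.1 _) (h.1 _))
  | bxor d a b => exact key _ _ (Nat.xor_lt_two_pow (h.1 _) (h.1 _))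
  | shl d a b => exact key _ _ (Nat.mod_lt _ hp)
  | shr d a b => exact key _ _ ((Nat.shiftRight_le _ _).trans_lt (h.1 _))
  | load d A i => exact key _ _ (h.2 _ _)
  | store A i a =>
    refine ⟨h.1, fun A' i' => ?_⟩
    simp only [Instr.exec, Function.update_apply]
    split_ifs with h1
    · simp only [Function.update_apply]
      split_ifs
      exacts [h.1 _, h.2 _ _]
    · exact h.2 _ _
  | jump l => exact h
  | jumpLt a b l => exact h
  | rand d a =>
    have := key d _ (((Nat.lt_succ_iff.1 (ω c.draws (c.reg a)).2)).trans_lt (h.1 a))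
    exact ⟨this.1, this.2⟩
  | halt => exact h

/-- The machine state `c` represents `σ`: variables sit in the even registers. -/
structure Sim (w : ℕ) (σ : Env) (c : State) : Prop where
  reg : ∀ r, c.reg (2 * r) = σ.var r
  mem : c.mem = σ.mem
  draws : c.draws = σ.draws
  fits : c.Fits w

theorem Sim.move {w : ℕ} {σ : Env} {c : State} (h : Sim w σ c) (n l : ℕ) :
    Sim w (σ.tick n) ⟨l, c.reg, c.mem, c.draws⟩ :=
  ⟨h.reg, h.mem, h.draws, h.fits⟩

/-- Running from `c` for `n` steps leads to `c'`. -/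
def Steps (w : ℕ) (ω : Coins) (P : Program) (n : ℕ) (c c' : State) : Prop :=
  (step w ω P)^[n] c = c'

theorem Steps.trans {w : ℕ} {ω : Coins} {P : Program} {m n : ℕ} {c c' c'' : State}
    (h : Steps w ω P m c c') (h' : Steps w ω P n c' c'') : Steps w ω P (m + n) c c'' := by
  subst h h'
  simp [Steps, add_comm m n, Function.iterate_add_apply]

theorem steps_one {w : ℕ} {ω : Coins} {P : Program} {c : State} {I : Instr} {L : List Instr}
    (h : CodeAt P c.pc (I :: L)) : Steps w ω P 1 c (I.exec w ω c) := by
  simp [Steps, step, h.get]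

theorem Op.exec_instr {w : ℕ} {ω : Coins} {c : State} {o : Op} {d a b : ℕ} (hf : c.Fits w)
    (h : o.Ok (2 ^ w) (c.reg a) (c.reg b)) :
    (o.instr d a b).exec w ω c = c.put d (o.fn (c.reg a) (c.reg b)) := by
  cases o with
  | add => simp [instr, Instr.exec, fn, Nat.mod_eq_of_lt (show _ < _ from h)]
  | sub =>
    have h' : c.reg b ≤ c.reg a := h
    have : c.reg a + 2 ^ w - c.reg b = (c.reg a - c.reg b) + 2 ^ w := Nat.sub_add_comm h'
    have h2 : c.reg a - c.reg b < 2 ^ w := (Nat.sub_le _ _).trans_lt (hf.1 _)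
    simp [instr, Instr.exec, fn, this, Nat.mod_eq_of_lt h2]
  | mul => simp [instr, Instr.exec, fn, Nat.mod_eq_of_lt (show _ < _ from h)]
  | div => rfl
  | mod => rfl

/-- The odd registers form an evaluation stack with top 2t + 1. That the lower ones survive is what
lets a left operand wait while the right operand is evaluated one level higher. -/
theorem Expr.steps_code {w : ℕ} {ω : Coins} {P : Program} {σ : Env} (e : Expr) (t : ℕ) (c : State)
    (hc : Sim w σ c) (hs : e.Safe (2 ^ w) σ) (hP : CodeAt P c.pc (e.code t)) :
    ∃ c', Steps w ω P e.cost c c' ∧ Sim w σ c' ∧ c'.pc = c.pc + e.cost ∧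
      c'.reg (2 * t + 1) = e.val σ ∧ ∀ r, r < t → c'.reg (2 * r + 1) = c.reg (2 * r + 1) := by
  have put : ∀ (c : State) (v : ℕ), Sim w σ c → (c.put (2 * t + 1) v).Fits w →
      Sim w σ (c.put (2 * t + 1) v) := fun c v h hf =>
    ⟨fun r => by
      have : 2 * r ≠ 2 * t + 1 := by omega
      simp [State.put, Function.update_apply, this, h.reg], h.mem, h.draws, hf⟩
  have old : ∀ (c : State) (v r : ℕ), r < t →
      (c.put (2 * t + 1) v).reg (2 * r + 1) = c.reg (2 * r + 1) := fun c v r hr => by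
    have : 2 * r + 1 ≠ 2 * t + 1 := by omega
    simp [State.put, Function.update_apply, hr.ne]
  induction e generalizing t c with
  | lit n =>
    have hn : n % 2 ^ w = n := Nat.mod_eq_of_lt hs
    have e1 := steps_one (w := w) (ω := ω) hP
    have hf := exec_fits (ω := ω) hc.fits (.const (2 * t + 1) n)
    simp only [Instr.exec, hn] at e1 hf
    exact ⟨_, e1, put _ _ hc hf, rfl, by simp [State.put, val], fun r hr => old _ _ _ hr⟩
  | var r =>
    have e1 := steps_one (w := w) (ω := ω) hP
    have hf := exec_fits (ω := ω) hc.fits (.bor (2 * t + 1) (2 * r) (2 * r))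
    simp only [Instr.exec, Nat.or_self, hc.reg] at e1 hf
    exact ⟨_, e1, put _ _ hc hf, rfl, by simp [State.put, val], fun r hr => old _ _ _ hr⟩
  | ld A i ih =>
    obtain ⟨h1, h2⟩ := codeAt_append hP
    obtain ⟨c1, s1, m1, p1, v1, o1⟩ := ih t c hc hs h1 put old
    rw [length_code, ← p1] at h2
    have e1 := s1.trans (steps_one (w := w) (ω := ω) h2)
    have hf := exec_fits (ω := ω) m1.fits (.load (2 * t + 1) A (2 * t + 1))
    simp only [Instr.exec, v1, m1.mem] at e1 hf
    refine ⟨_, e1, put _ _ m1 hf, ?_, by simp [State.put, val], fun r hr => ?_⟩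
    · simp [State.put, p1, cost, add_assoc]
    · rw [old _ _ _ hr, o1 r hr]
  | bin o a b iha ihb =>
    obtain ⟨h1, h3⟩ := codeAt_append hP
    obtain ⟨h1, h2⟩ := codeAt_append h1
    obtain ⟨c1, s1, m1, p1, v1, o1⟩ := iha t c hc hs.1 h1 put old
    rw [length_code, ← p1] at h2
    obtain ⟨c2, s2, m2, p2, v2, o2⟩ := ihb (t + 1) c1 m1 hs.2.1 h2
      (fun c v h hf => ⟨fun r => by
        have : 2 * r ≠ 2 * (t + 1) + 1 := by omega
        simp [State.put, Function.update_apply, this, h.reg], h.mem, h.draws, hf⟩)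
      (fun c v r hr => by
        have : r ≠ t + 1 := by omega
        simp [State.put, Function.update_apply, this])
    rw [List.length_append, length_code, length_code, ← add_assoc, ← p1, ← p2] at h3
    have v1' : c2.reg (2 * t + 1) = a.val σ := by rw [o2 t (by omega), v1]
    have ok : o.Ok (2 ^ w) (c2.reg (2 * t + 1)) (c2.reg (2 * (t + 1) + 1)) := by
      rw [v1', v2]; exact hs.2.2
    have e1 := (s1.trans s2).trans (steps_one (w := w) (ω := ω) h3)
    have hf := exec_fits (ω := ω) m2.fits (o.instr (2 * t + 1) (2 * t + 1) (2 * (t + 1) + 1))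
    rw [Op.exec_instr m2.fits ok, v1', v2] at e1 hf
    refine ⟨_, e1, put _ _ m2 hf, ?_, by simp [State.put, val], fun r hr => ?_⟩
    · simp [State.put, p1, p2, cost, add_assoc]
    · rw [old _ _ _ hr, o2 r (by omega), o1 r hr]

theorem steps_pair {w : ℕ} {ω : Coins} {P : Program} {σ : Env} {a b : Expr} {c : State}
    {L : List Instr} (hc : Sim w σ c) (ha : a.Safe (2 ^ w) σ) (hb : b.Safe (2 ^ w) σ)
    (hP : CodeAt P c.pc (a.code 0 ++ b.code 1 ++ L)) :
    ∃ c', Steps w ω P (a.cost + b.cost) c c' ∧ Sim w σ c' ∧ c'.pc = c.pc + (a.cost + b.cost) ∧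
      c'.reg 1 = a.val σ ∧ c'.reg 3 = b.val σ ∧ CodeAt P c'.pc L := by
  obtain ⟨h1, h3⟩ := codeAt_append hP
  obtain ⟨h1, h2⟩ := codeAt_append h1
  obtain ⟨c1, s1, m1, p1, v1, -⟩ := Expr.steps_code (ω := ω) a 0 c hc ha h1
  rw [Expr.length_code, ← p1] at h2
  obtain ⟨c2, s2, m2, p2, v2, o2⟩ := Expr.steps_code (ω := ω) b 1 c1 m1 hb h2
  rw [List.length_append, Expr.length_code, Expr.length_code, ← add_assoc, ← p1, ← p2] at h3
  exact ⟨c2, s1.trans s2, m2, by omega, (o2 0 (by omega)).trans v1, v2, h3⟩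

/-- The clock of the big-step semantics counts machine steps exactly, so every later bound on `time`
is a bound on the running time of the compiled program. -/
theorem Cmd.Exec.steps {w : ℕ} {ω : Coins} {P : Program} {C : Cmd} {σ σ' : Env}
    (h : C.Exec (2 ^ w) ω σ σ') (c : State) (hc : Sim w σ c) (hP : CodeAt P c.pc (C.compile c.pc)) :
    ∃ n c', σ'.time = σ.time + n ∧ Steps w ω P n c c' ∧ Sim w σ' c' ∧ c'.pc = c.pc + C.len := by
  induction h generalizing c with
  | skip σ => exact ⟨0, c, rfl, rfl, hc, rfl⟩
  | assign d e σ hs =>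
    obtain ⟨h1, h2⟩ := codeAt_append hP
    obtain ⟨c1, s1, m1, p1, v1, -⟩ := Expr.steps_code (ω := ω) e 0 c hc hs h1
    rw [Expr.length_code, ← p1] at h2
    have e1 := s1.trans (steps_one (w := w) (ω := ω) h2)
    have hf := exec_fits (ω := ω) m1.fits (.bor (2 * d) 1 1)
    simp only [mul_zero, zero_add] at v1
    simp only [Instr.exec, Nat.or_self, v1] at e1 hf
    refine ⟨_, _, rfl, e1, ⟨fun r => ?_, m1.mem, m1.draws, hf⟩, ?_⟩
    · by_cases hr : r = d <;> simp [State.put, hr, Function.update_apply, m1.reg]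
    · simp [State.put, p1, Cmd.len, add_assoc]
  | rand d e σ hs =>
    obtain ⟨h1, h2⟩ := codeAt_append hP
    obtain ⟨c1, s1, m1, p1, v1, -⟩ := Expr.steps_code (ω := ω) e 0 c hc hs h1
    rw [Expr.length_code, ← p1] at h2
    have e1 := s1.trans (steps_one (w := w) (ω := ω) h2)
    have hf := exec_fits (ω := ω) m1.fits (.rand (2 * d) 1)
    simp only [mul_zero, zero_add] at v1
    simp only [Instr.exec, v1, m1.draws] at e1 hf
    refine ⟨_, _, rfl, e1, ⟨fun r => ?_, m1.mem, ?_, hf⟩, ?_⟩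
    · by_cases hr : r = d
      · simpa [State.put, hr] using congrArg (fun x => (ω σ.draws x : ℕ)) v1
      · simp [State.put, hr, m1.reg]
    · simp
    · simp [State.put, p1, Cmd.len, add_assoc]
  | store A i e σ hi he =>
    obtain ⟨c1, s1, m1, p1, v1, v2, h2⟩ := steps_pair (ω := ω) hc hi he hP
    have e1 := s1.trans (steps_one (w := w) (ω := ω) h2)
    have hf := exec_fits (ω := ω) m1.fits (.store A 1 3)
    simp only [Instr.exec, v1, v2] at e1 hf
    refine ⟨_, _, rfl, e1, ⟨m1.reg, ?_, m1.draws, hf⟩, ?_⟩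
    · simp [Env.st, m1.mem]
    · simp [p1, Cmd.len, add_assoc]
  | @seq c₁ c₂ σ₁ σ₂ σ₃ _ _ ih1 ih2 =>
    obtain ⟨h1, h2⟩ := codeAt_append hP
    obtain ⟨n, c1, t1, s1, m1, p1⟩ := ih1 c hc h1
    rw [Cmd.length_compile, ← p1] at h2
    obtain ⟨n', c2, t2, s2, m2, p2⟩ := ih2 c1 m1 h2
    exact ⟨n + n', c2, by omega, s1.trans s2, m2, by simp [Cmd.len]; omega⟩
  | @iteT a b c₁ c₂ σ σ' ha hb hlt _ ih =>
    simp only [Cmd.compile, List.append_assoc] at hP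
    rw [← List.append_assoc] at hP
    obtain ⟨c1, s1, m1, p1, v1, v2, h2⟩ := steps_pair (ω := ω) hc ha hb hP
    have e1 := s1.trans (steps_one (w := w) (ω := ω) h2)
    obtain ⟨-, h3⟩ := codeAt_append h2
    obtain ⟨-, h3⟩ := codeAt_append h3
    obtain ⟨-, h3⟩ := codeAt_append h3
    simp only [Instr.exec, v1, v2, hlt, if_true] at e1
    simp only [List.length_singleton, Cmd.length_compile, p1] at h3
    obtain ⟨n, c3, t3, s3, m3, p3⟩ := ih _ (m1.move _ _)
      (h3.cast (b := c.pc + (a.cost + b.cost + 1 + c₂.len + 1)) (by ring) rfl)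
    refine ⟨_, c3, ?_, e1.trans s3, m3, ?_⟩
    · simp only [t3, Env.tick_time]; ring
    · simp only [p3, Cmd.len]; ring
  | @iteF a b c₁ c₂ σ σ' ha hb hlt _ ih =>
    simp only [Cmd.compile, List.append_assoc] at hP
    rw [← List.append_assoc] at hP
    obtain ⟨c1, s1, m1, p1, v1, v2, h2⟩ := steps_pair (ω := ω) hc ha hb hP
    have e1 := s1.trans (steps_one (w := w) (ω := ω) h2)
    obtain ⟨-, h3⟩ := codeAt_append h2
    obtain ⟨h3, h4⟩ := codeAt_append h3
    obtain ⟨h4, -⟩ := codeAt_append h4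
    simp only [Instr.exec, v1, v2, hlt, if_false] at e1
    simp only [List.length_singleton, Cmd.length_compile] at h3 h4
    obtain ⟨n, c3, t3, s3, m3, p3⟩ := ih _ (m1.move _ _)
      (h3.cast (b := c1.pc + 1) rfl (by simp only [p1, add_assoc]))
    have e3 := steps_one (w := w) (ω := ω) (c := c3) (P := P) (h4.cast p3.symm rfl)
    refine ⟨_, _, ?_, (e1.trans s3).trans e3, m3.move _ _, ?_⟩
    · simp only [t3, Env.tick_time]; ring
    · rfl
  | @whileF a b c' σ ha hb hlt =>
    simp only [Cmd.compile, List.append_assoc] at hP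
    rw [← List.append_assoc] at hP
    obtain ⟨c1, s1, m1, p1, v1, v2, h2⟩ := steps_pair (ω := ω) hc ha hb hP
    have e1 := s1.trans (steps_one (w := w) (ω := ω) h2)
    simp only [Instr.exec, v1, v2, hlt, if_false] at e1
    obtain ⟨-, h3⟩ := codeAt_append (L := [_]) (M := _ :: _) h2
    have e2 := e1.trans (steps_one (w := w) (ω := ω) (P := P) h3)
    refine ⟨_, _, ?_, e2, m1.move _ _, rfl⟩
    simp only [Env.tick_time, add_assoc]
  | @whileT a b c' σ σ₁ σ₂ ha hb hlt _ _ ih1 ih2 =>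
    have hP0 := hP
    simp only [Cmd.compile, List.append_assoc] at hP
    rw [← List.append_assoc] at hP
    obtain ⟨c1, s1, m1, p1, v1, v2, h2⟩ := steps_pair (ω := ω) hc ha hb hP
    have e1 := s1.trans (steps_one (w := w) (ω := ω) h2)
    simp only [Instr.exec, v1, v2, hlt, if_true] at e1
    obtain ⟨-, h3⟩ := codeAt_append h2
    obtain ⟨h3, h4⟩ := codeAt_append h3
    simp only [List.length_cons, List.length_nil, Cmd.length_compile, p1] at h3 h4
    obtain ⟨n, c3, t3, s3, m3, p3⟩ := ih1 _ (m1.move _ _)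
      (h3.cast (b := c.pc + (a.cost + b.cost + 2)) (by ring) rfl)
    have e3 := steps_one (w := w) (ω := ω) (c := c3) (P := P)
      (h4.cast (by rw [p3]; ring) rfl)
    obtain ⟨n', c4, t4, s4, m4, p4⟩ := ih2 _ (m3.move _ _) hP0
    refine ⟨_, c4, ?_, ((e1.trans s3).trans e3).trans s4, m4, p4⟩
    simp only [t4, t3, Env.tick_time]; ring

/-- A program made from a command. -/
def Cmd.program (C : Cmd) : Program := C.compile 0

/-- The abstract state represented by a machine state, with the clock at zero. -/
def State.env (c : State) : Env := ⟨fun r => c.reg (2 * r), c.mem, c.draws, 0⟩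

theorem Cmd.Exec.haltsWithin {w : ℕ} {ω : Coins} {C : Cmd} {σ' : Env} {c : State}
    (hf : c.Fits w) (hpc : c.pc = 0) (h : C.Exec (2 ^ w) ω (State.env c) σ') {T : ℕ}
    (hT : σ'.time ≤ T) :
    ∃ c', HaltsWithin w ω C.program T c c' ∧ Sim w σ' c' := by
  obtain ⟨n, c', ht, hs, hm, hp⟩ := h.steps (P := C.program) c ⟨fun _ => rfl, rfl, rfl, hf⟩
    ⟨[], [], by simp [Cmd.program, hpc], by simp [hpc]⟩
  refine ⟨c', ⟨n, ?_, hs, Or.inl ?_⟩, hm⟩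
  · simp only [State.env, zero_add] at ht; omega
  · rw [hp, hpc, List.getElem?_eq_none_iff, Cmd.program, Cmd.length_compile]; omega

/-! ### Weakest preconditions -/

namespace Cmd
variable {W : ℕ} {ω : Coins}

/-- `C`, started in `σ`, terminates without overflow in an environment that satisfies `Q`. -/
def Wp (W : ℕ) (ω : Coins) (C : Cmd) (Q : Env → Prop) (σ : Env) : Prop :=
  ∃ σ', C.Exec W ω σ σ' ∧ Q σ'

theorem Wp.mono {C : Cmd} {Q Q' : Env → Prop} {σ : Env} (h : C.Wp W ω Q σ)
    (hQ : ∀ σ', Q σ' → Q' σ') : C.Wp W ω Q' σ :=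
  let ⟨σ', h1, h2⟩ := h
  ⟨σ', h1, hQ _ h2⟩

@[simp] theorem wp_skip {Q : Env → Prop} {σ : Env} : skip.Wp W ω Q σ ↔ Q σ :=
  ⟨fun ⟨_, h, hQ⟩ => by cases h; exact hQ, fun h => ⟨_, .skip _, h⟩⟩

@[simp] theorem wp_assign {d : ℕ} {e : Expr} {Q : Env → Prop} {σ : Env} :
    (d ::= e).Wp W ω Q σ ↔ e.Safe W σ ∧ Q ((σ.set d (e.val σ)).tick (e.cost + 1)) :=
  ⟨fun ⟨_, h, hQ⟩ => by cases h; exact ⟨‹_›, hQ⟩, fun h => ⟨_, .assign _ _ _ h.1, h.2⟩⟩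

@[simp] theorem wp_store {A : ℕ} {i e : Expr} {Q : Env → Prop} {σ : Env} :
    (store A i e).Wp W ω Q σ ↔ i.Safe W σ ∧ e.Safe W σ ∧
      Q ((σ.st A (i.val σ) (e.val σ)).tick (i.cost + e.cost + 1)) :=
  ⟨fun ⟨_, h, hQ⟩ => by cases h; exact ⟨‹_›, ‹_›, hQ⟩,
    fun h => ⟨_, .store _ _ _ _ h.1 h.2.1, h.2.2⟩⟩

@[simp] theorem wp_rand {d : ℕ} {e : Expr} {Q : Env → Prop} {σ : Env} :
    (rand d e).Wp W ω Q σ ↔ e.Safe W σ ∧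
      Q (((σ.set d (ω σ.draws (e.val σ))).drew).tick (e.cost + 1)) :=
  ⟨fun ⟨_, h, hQ⟩ => by cases h; exact ⟨‹_›, hQ⟩, fun h => ⟨_, .rand _ _ _ h.1, h.2⟩⟩

@[simp] theorem wp_seq {c₁ c₂ : Cmd} {Q : Env → Prop} {σ : Env} :
    (c₁ ;; c₂).Wp W ω Q σ ↔ c₁.Wp W ω (c₂.Wp W ω Q) σ :=
  ⟨fun ⟨_, h, hQ⟩ => by cases h with | seq h1 h2 => exact ⟨_, h1, _, h2, hQ⟩,
    fun ⟨_, h1, _, h2, hQ⟩ => ⟨_, .seq h1 h2, hQ⟩⟩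

@[simp] theorem wp_ite {a b : Expr} {c₁ c₂ : Cmd} {Q : Env → Prop} {σ : Env} :
    (ite a b c₁ c₂).Wp W ω Q σ ↔ a.Safe W σ ∧ b.Safe W σ ∧
      (a.val σ < b.val σ → c₁.Wp W ω Q (σ.tick (a.cost + b.cost + 1))) ∧
      (b.val σ ≤ a.val σ → c₂.Wp W ω (fun σ' => Q (σ'.tick 1)) (σ.tick (a.cost + b.cost + 1))) := by
  constructor
  · rintro ⟨_, h, hQ⟩
    cases h with
    | iteT h1 h2 h3 h4 => exact ⟨h1, h2, fun _ => ⟨_, h4, hQ⟩, fun h => absurd h3 h.not_gt⟩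
    | iteF h1 h2 h3 h4 => exact ⟨h1, h2, fun h => absurd h h3, fun _ => ⟨_, h4, hQ⟩⟩
  · rintro ⟨h1, h2, h3, h4⟩
    by_cases h : a.val σ < b.val σ
    · obtain ⟨σ', h5, h6⟩ := h3 h
      exact ⟨_, .iteT h1 h2 h h5, h6⟩
    · obtain ⟨σ', h5, h6⟩ := h4 (not_lt.1 h)
      exact ⟨_, .iteF h1 h2 h h5, h6⟩

/-- Loop rule with an invariant and a decreasing measure. -/
theorem wp_while {a b : Expr} {C : Cmd} {Q : Env → Prop} {σ : Env} (I : Env → Prop)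
    (m : Env → ℕ) (h0 : I σ)
    (hI : ∀ σ, I σ → a.Safe W σ ∧ b.Safe W σ ∧
      (a.val σ < b.val σ → C.Wp W ω (fun σ' => I (σ'.tick 1) ∧ m (σ'.tick 1) < m σ)
        (σ.tick (a.cost + b.cost + 1))) ∧
      (b.val σ ≤ a.val σ → Q (σ.tick (a.cost + b.cost + 2)))) :
    (Cmd.while a b C).Wp W ω Q σ := by
  induction hm : m σ using Nat.strong_induction_on generalizing σ with
  | _ n ih =>
    obtain ⟨h1, h2, h3, h4⟩ := hI σ h0
    by_cases h : a.val σ < b.val σ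
    · obtain ⟨σ', h5, h6, h7⟩ := h3 h
      obtain ⟨σ'', h8, h9⟩ := ih _ (hm ▸ h7) h6 rfl
      exact ⟨_, .whileT h1 h2 h h5 h8, h9⟩
    · exact ⟨_, .whileF h1 h2 h, h4 (not_lt.1 h)⟩

/-- Loop rule for a loop with exactly `N - n` iterations. -/
theorem wp_while_count {a b : Expr} {C : Cmd} {Q : Env → Prop} {σ : Env} (I : ℕ → Env → Prop)
    (n N : ℕ) (hn : n ≤ N) (h0 : I n σ)
    (hI : ∀ i σ, n ≤ i → i < N → I i σ → a.Safe W σ ∧ b.Safe W σ ∧ a.val σ < b.val σ ∧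
      C.Wp W ω (fun σ' => I (i + 1) (σ'.tick 1)) (σ.tick (a.cost + b.cost + 1)))
    (hQ : ∀ σ, I N σ → a.Safe W σ ∧ b.Safe W σ ∧ b.val σ ≤ a.val σ ∧
      Q (σ.tick (a.cost + b.cost + 2))) :
    (Cmd.while a b C).Wp W ω Q σ := by
  induction hk : N - n generalizing σ n with
  | zero =>
    obtain rfl : n = N := by omega
    obtain ⟨h1, h2, h3, h4⟩ := hQ σ h0
    exact ⟨_, .whileF h1 h2 h3.not_gt, h4⟩
  | succ k ih =>
    obtain ⟨h1, h2, h3, σ', h4, h5⟩ := hI n σ le_rfl (by omega) h0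
    obtain ⟨σ'', h6, h7⟩ := ih (n + 1) (by omega) h5 (fun i σ hi => hI i σ (by omega)) (by omega)
    exact ⟨_, .whileT h1 h2 h3 h4 h6, h7⟩

/-- `σ'` agrees with `σ` outside the given variables and arrays. -/
structure Frame (vs as : List ℕ) (σ σ' : Env) : Prop where
  var : ∀ r, r ∉ vs → σ'.var r = σ.var r
  mem : ∀ A, A ∉ as → σ'.mem A = σ.mem A

end Cmd

end WordRAM

/-! ### Frames, and adding a multiple of an array -/

namespace WordRAM
open Cmd

namespace Cmd.Frame
variable {vs as : List ℕ} {σ₀ σ σ₁ : Env}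

theorem refl (vs as : List ℕ) (σ : Env) : Frame vs as σ σ := ⟨fun _ _ => rfl, fun _ _ => rfl⟩

theorem trans (h : Frame vs as σ₀ σ) (h' : Frame vs as σ σ₁) : Frame vs as σ₀ σ₁ :=
  ⟨fun r hr => (h'.1 r hr).trans (h.1 r hr), fun A hA => (h'.2 A hA).trans (h.2 A hA)⟩

theorem weaken {vs' as' : List ℕ} (h : Frame vs as σ₀ σ) (hv : vs ⊆ vs') (ha : as ⊆ as') :
    Frame vs' as' σ₀ σ :=
  ⟨fun r hr => h.1 r fun h => hr (hv h), fun A hA => h.2 A fun h => hA (ha h)⟩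

@[simp] theorem tick_left {n : ℕ} : Frame vs as (σ₀.tick n) σ ↔ Frame vs as σ₀ σ :=
  ⟨fun h => ⟨h.1, h.2⟩, fun h => ⟨h.1, h.2⟩⟩

@[simp] theorem tick_right {n : ℕ} : Frame vs as σ₀ (σ.tick n) ↔ Frame vs as σ₀ σ :=
  ⟨fun h => ⟨h.1, h.2⟩, fun h => ⟨h.1, h.2⟩⟩

@[simp] theorem set {d v : ℕ} (hd : d ∈ vs) :
    Frame vs as σ₀ (σ.set d v) ↔ Frame vs as σ₀ σ := by
  have : ∀ r, r ∉ vs → (σ.set d v).var r = σ.var r := fun r hr => by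
    have : r ≠ d := fun h => hr (h ▸ hd)
    simp [this]
  exact ⟨fun h => ⟨fun r hr => (this r hr).symm.trans (h.1 r hr), h.2⟩,
    fun h => ⟨fun r hr => (this r hr).trans (h.1 r hr), h.2⟩⟩

@[simp] theorem st {A i v : ℕ} (hA : A ∈ as) :
    Frame vs as σ₀ (σ.st A i v) ↔ Frame vs as σ₀ σ := by
  have : ∀ B, B ∉ as → (σ.st A i v).mem B = σ.mem B := fun B hB => by
    have : B ≠ A := fun h => hB (h ▸ hA)
    funext j
    simp [this]
  exact ⟨fun h => ⟨h.1, fun r hr => (this r hr).symm.trans (h.2 r hr)⟩,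
    fun h => ⟨h.1, fun r hr => (this r hr).trans (h.2 r hr)⟩⟩

@[simp] theorem drew : Frame vs as σ₀ σ.drew ↔ Frame vs as σ₀ σ :=
  ⟨fun h => ⟨h.1, h.2⟩, fun h => ⟨h.1, h.2⟩⟩

end Cmd.Frame

/-- `A[2 (i + δ) + b] += c * A[2 i + (1 - b)]` modulo `p`, for all `i` with `i + δ < bound`;
here `p`, `b`, `δ`, `c` are the variables 2, 10, 15, 16. -/
def axpy (A : ℕ) (bound : ℕ) : Cmd :=
  17 ::= 0 ;;
  .while (.var 17 + .var 15) (.var bound)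
    (.store A (2 * (.var 17 + .var 15) + .var 10)
        ((.ld A (2 * (.var 17 + .var 15) + .var 10) +
          .var 16 * .ld A (2 * .var 17 + (1 - .var 10))) % .var 2) ;;
      17 ::= .var 17 + 1)

/-- The two polynomials of a pair occupy the cells of opposite parity of one array. The update in
place therefore never reads a cell that it has written, and exchanging the pair is just a flip of b.
The cost depends on the overlap n - δ only. -/
theorem wp_axpy {W : ℕ} {ω : Coins} {A bound : ℕ} {σ : Env} (hbd : bound ≠ 17)
    (p n b δ c : ℕ) (hW : p * p + p < W) (hn : 2 * n + δ + 1 < W) (hb : b ≤ 1)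
    (vp : σ.var 2 = p) (vn : σ.var bound = n) (vb : σ.var 10 = b) (vδ : σ.var 15 = δ)
    (vc : σ.var 16 = c) (hc : c < p)
    (hA : ∀ i, i + δ < n → σ.mem A (2 * (i + δ) + b) < p)
    (hA' : ∀ i, i + δ < n → σ.mem A (2 * i + (1 - b)) < p) :
    (axpy A bound).Wp W ω (fun σ' => Frame [17] [A] σ σ' ∧
      (∀ i, σ'.mem A (2 * i + b) = if δ ≤ i ∧ i < n then
        (σ.mem A (2 * i + b) + c * σ.mem A (2 * (i - δ) + (1 - b))) % p else
          σ.mem A (2 * i + b)) ∧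
      (∀ i, σ'.mem A (2 * i + (1 - b)) = σ.mem A (2 * i + (1 - b))) ∧
      σ'.time ≤ σ.time + 50 * (n - δ) + 20) σ := by
  have par : ∀ i j, 2 * i + (1 - b) ≠ 2 * j + b := by intro i j; omega
  have inj : ∀ i j, 2 * i + b = 2 * j + b ↔ i = j := by intro i j; omega
  simp only [axpy, wp_seq, wp_assign]
  refine ⟨by simp; omega, wp_while_count (fun m σ' => Frame [17] [A] σ σ' ∧ σ'.var 17 = m ∧
      (∀ i, σ'.mem A (2 * i + b) = if δ ≤ i ∧ i < m + δ then
        (σ.mem A (2 * i + b) + c * σ.mem A (2 * (i - δ) + (1 - b))) % p else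
          σ.mem A (2 * i + b)) ∧
      (∀ i, σ'.mem A (2 * i + (1 - b)) = σ.mem A (2 * i + (1 - b))) ∧
      σ'.time ≤ σ.time + 50 * m + 2) 0 (n - δ) (Nat.zero_le _) ?_ ?_ ?_⟩
  · refine ⟨?_, ?_, ?_, ?_, ?_⟩
    · simp [Frame.refl]
    · simp
    · intro i
      have : ¬ (δ ≤ i ∧ i < 0 + δ) := by omega
      simp [this]
    · simp
    · simp
  · rintro i σ' - hi ⟨hF, h17, hm, hm', ht⟩
    have e2 : σ'.var 2 = p := by rw [hF.var 2 (by simp), vp]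
    have e10 : σ'.var 10 = b := by rw [hF.var 10 (by simp), vb]
    have e15 : σ'.var 15 = δ := by rw [hF.var 15 (by simp), vδ]
    have e16 : σ'.var 16 = c := by rw [hF.var 16 (by simp), vc]
    have en : σ'.var bound = n := by rw [hF.var bound (by simp [hbd]), vn]
    have hA1 := hA i (by omega)
    have hA2 := hA' i (by omega)
    have hmul : c * σ.mem A (2 * i + (1 - b)) ≤ (p - 1) * p :=
      Nat.mul_le_mul (by omega) hA2.le
    have hmul2 : (p - 1) * p + p = p * p := by
      obtain ⟨q, rfl⟩ : ∃ q, p = q + 1 := ⟨p - 1, by omega⟩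
      simp; ring
    have hold : σ'.mem A (2 * (i + δ) + b) = σ.mem A (2 * (i + δ) + b) := by
      rw [hm, if_neg (by omega)]
    refine ⟨?_, ?_, ?_, ?_⟩
    · simp [h17, e15]; omega
    · simp
    · simp [h17, e15, en]; omega
    · simp only [wp_seq, wp_store, wp_assign]
      refine ⟨?_, ?_, ?_, ?_, ?_, ?_, ?_, ?_⟩
      · simp [h17, e15, e10]; omega
      · simp [h17, e15, e10, e16, e2, hold, hm']
        omega
      · simp [h17]; omega
      · simp [hF]
      · simp [h17]
      · intro j
        simp only [Env.tick_mem, Env.set_mem, Env.st_mem, true_and, Expr.val_add, Expr.val_mul,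
          Expr.val_ofNat, Expr.val_var, Expr.val_mod, Expr.val_ld, Env.tick_var, h17, e15, e10,
          e16, e2, inj, Expr.val_sub, hold, hm']
        by_cases hj : j = i + δ
        · subst hj
          simp
        · rw [if_neg hj, hm]
          refine if_congr ?_ rfl rfl
          omega
      · intro j
        simp [h17, e15, e10, par, hm']
      · simp [Env.tick_time]
        omega
  · rintro σ' ⟨hF, h17, hm, hm', ht⟩
    have e15 : σ'.var 15 = δ := by rw [hF.var 15 (by simp), vδ]
    have en : σ'.var bound = n := by rw [hF.var bound (by simp [hbd]), vn]
    refine ⟨?_, ?_, ?_, ?_, ?_, ?_, ?_⟩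
    · simp [h17, e15]; omega
    · simp
    · simp [h17, e15, en]; omega
    · simpa using hF
    · intro j
      simp only [Env.tick_mem]
      rw [hm]
      refine if_congr ?_ rfl rfl
      omega
    · simpa using hm'
    · simp; omega

end WordRAM

/-! ### Polynomials in arrays, and the invariant of the Euclidean algorithm -/

namespace WordRAM
open Cmd Polynomial

/-- The cells `0, …, n - 1` of `m` hold the coefficients of `P`, and `P` has degree `< n`. -/
structure Rep {p : ℕ} (n : ℕ) (m : ℕ → ℕ) (P : (ZMod p)[X]) : Prop where
  lt : ∀ i < n, m i < p
  coeff : ∀ i < n, P.coeff i = (m i : ZMod p)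
  deg : ∀ i, n ≤ i → P.coeff i = 0

theorem Rep.congr {p n : ℕ} {m m' : ℕ → ℕ} {P : (ZMod p)[X]} (h : Rep n m P)
    (hm : ∀ i < n, m' i = m i) : Rep n m' P :=
  ⟨fun i hi => hm i hi ▸ h.lt i hi, fun i hi => (hm i hi).symm ▸ h.coeff i hi, h.deg⟩

theorem Rep.natDegree_lt {p n : ℕ} {m : ℕ → ℕ} {P : (ZMod p)[X]} (h : Rep n m P) (hP : P ≠ 0) :
    P.natDegree < n := by
  by_contra hn
  exact hP (leadingCoeff_eq_zero.1 (h.deg _ (not_lt.1 hn)))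

theorem Rep.exists {p : ℕ} (n : ℕ) (m : ℕ → ℕ) (h : ∀ i < n, m i < p) :
    ∃ P : (ZMod p)[X], Rep n m P := by
  refine ⟨∑ i ∈ Finset.range n, C (m i : ZMod p) * X ^ i, h, fun i hi => ?_, fun i hi => ?_⟩
  · simp [coeff_C_mul, coeff_X_pow, hi]
  · simp [coeff_C_mul, coeff_X_pow, hi.not_gt]

/-- Dropping a vanishing leading coefficient. -/
theorem Rep.pop {p n : ℕ} {m : ℕ → ℕ} {P : (ZMod p)[X]} (h : Rep (n + 1) m P)
    (h0 : P.coeff n = 0) :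
    Rep n m P := by
  refine ⟨fun i hi => h.lt i (by omega), fun i hi => h.coeff i (by omega), fun i hi => ?_⟩
  rcases hi.eq_or_lt with rfl | hi
  · exact h0
  · exact h.deg i hi

/-- The invariant of the Euclidean algorithm for `(M, Y)` with cofactors, run until the second
remainder has degree `< θ`; the remainders `Rᵢ` have degrees `< nᵢ`. -/
structure EuclidInv {F : Type*} [CommRing F] (θ N : ℕ) (M Y R₀ R₁ T₀ T₁ : F[X]) (n₀ n₁ : ℕ) :
    Prop where
  dvd₀ : M ∣ R₀ - T₀ * Y
  dvd₁ : M ∣ R₁ - T₁ * Y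
  det : R₀ * T₁ - R₁ * T₀ = M ∨ R₀ * T₁ - R₁ * T₀ = -M
  -- The classical crosswise bounds deg T₀ + deg R₁ ≤ N and deg T₁ + deg R₀ ≤ N, with the lengths
  -- n₀, n₁ in place of degrees.
  deg₀ : ∀ i, N + 1 < i + n₁ → T₀.coeff i = 0
  deg₁ : ∀ i, N + 1 < i + n₀ → T₁.coeff i = 0
  -- Once n₁ ≤ θ this gives n₀ > θ, and for N = 2θ the bound `deg₁` then says deg T₁ ≤ θ.
  large : θ < n₀ ∨ θ < n₁
  -- The shorter remainder has length at most N + 1, so an elimination costs O(N + 1) even if Y is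
  -- much longer than M.
  small : n₀ ≤ N + 1 ∨ n₁ ≤ N + 1

namespace EuclidInv
variable {F : Type*} [CommRing F] {θ N : ℕ} {M Y R₀ R₁ T₀ T₁ : F[X]} {n₀ n₁ : ℕ}

theorem swap (h : EuclidInv θ N M Y R₀ R₁ T₀ T₁ n₀ n₁) :
    EuclidInv θ N M Y R₁ R₀ T₁ T₀ n₁ n₀ := by
  refine ⟨h.dvd₁, h.dvd₀, ?_, h.deg₁, h.deg₀, h.large.symm, h.small.symm⟩
  rcases h.det with h | h
  · right; rw [← h]; ring
  · left; rw [← neg_eq_iff_eq_neg.2 h]; ring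

theorem pop (h : EuclidInv θ N M Y R₀ R₁ T₀ T₁ n₀ (n₁ + 1)) (hn : n₁ + 1 ≤ n₀) :
    EuclidInv θ N M Y R₀ R₁ T₀ T₁ n₀ n₁ :=
  ⟨h.dvd₀, h.dvd₁, h.det, fun i hi => h.deg₀ i (by omega), h.deg₁,
    by have := h.large; omega, by have := h.small; omega⟩

/-- A row operation leaves the determinant unchanged. Before it deg T₁ ≤ N - n₀, and the shift by n₀
+ 1 - n₁ raises this to N + 1 - n₁, just what `deg₀` allows. -/
theorem step (h : EuclidInv θ N M Y R₀ R₁ T₀ T₁ (n₀ + 1) n₁) (hn : n₁ ≤ n₀ + 1) (hθ : θ < n₁)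
    (c : F) :
    EuclidInv θ N M Y (R₀ + C c * X ^ (n₀ + 1 - n₁) * R₁) R₁ (T₀ + C c * X ^ (n₀ + 1 - n₁) * T₁) T₁
      n₀ n₁ := by
  refine ⟨?_, h.dvd₁, ?_, fun i hi => ?_, fun i hi => h.deg₁ i (by omega), Or.inr hθ,
    by have := h.small; omega⟩
  · have := dvd_add h.dvd₀ (h.dvd₁.mul_left (C c * X ^ (n₀ + 1 - n₁)))
    convert this using 1
    ring
  · rcases h.det with h | h
    · left; rw [← h]; ring
    · right; rw [← h]; ring
  · rw [coeff_add, h.deg₀ i hi, mul_assoc, coeff_C_mul, coeff_X_pow_mul', zero_add]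
    split_ifs with h1
    · rw [h.deg₁ _ (by omega), mul_zero]
    · rw [mul_zero]

end EuclidInv

/-- Addition of a shifted multiple, on the level of coefficients. -/
theorem Rep.axpy {p n δ c : ℕ} {m m₁ m' : ℕ → ℕ} {P Q : (ZMod p)[X]} (hp : 0 < p) (h : Rep n m P)
    (hQ : ∀ i, i + δ < n → Q.coeff i = (m₁ i : ZMod p)) (hQ' : ∀ i, n ≤ i + δ → Q.coeff i = 0)
    (hm : ∀ i < n, m' i = if δ ≤ i ∧ i < n then (m i + c * m₁ (i - δ)) % p else m i) :
    Rep n m' (P + C (c : ZMod p) * X ^ δ * Q) := by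
  refine ⟨fun i hi => ?_, fun i hi => ?_, fun i hi => ?_⟩
  · rw [hm i hi]
    split_ifs
    exacts [Nat.mod_lt _ hp, h.lt i hi]
  · rw [hm i hi, coeff_add, h.coeff i hi, mul_assoc, coeff_C_mul, coeff_X_pow_mul']
    by_cases h1 : δ ≤ i
    · rw [if_pos h1, if_pos ⟨h1, hi⟩, hQ _ (by omega)]
      simp
    · rw [if_neg h1, if_neg (by tauto), mul_zero, add_zero]
  · rw [coeff_add, h.deg i hi, mul_assoc, coeff_C_mul, coeff_X_pow_mul']
    split_ifs with h1
    · rw [hQ' _ (by omega)]; simp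
    · simp

end WordRAM

/-! ### The extended Euclidean algorithm -/

namespace WordRAM
open Cmd Polynomial

/-- The tables 3 and 4 yield inverses modulo `p`. -/
def InvTables (p : ℕ) (σ : Env) : Prop :=
  -- Here 1/x = g^(p - 1 - dlog x); the remainder modulo p - 1 covers dlog x = 0, where the index
  -- would leave the table.
  ∀ x, 0 < x → x < p → σ.mem 4 x ≤ p - 1 ∧ σ.mem 3 ((p - 1 - σ.mem 4 x) % (p - 1)) < p ∧
    (σ.mem 3 ((p - 1 - σ.mem 4 x) % (p - 1)) : ZMod p) * x = 1

theorem InvTables.frame {p : ℕ} {vs as : List ℕ} {σ σ' : Env} (h : InvTables p σ)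
    (hF : Frame vs as σ σ') (h3 : 3 ∉ as) (h4 : 4 ∉ as) : InvTables p σ' := by
  intro x hx hp
  rw [hF.mem 3 h3, hF.mem 4 h4]
  exact h x hx hp

@[simp] theorem invTables_set {p d v : ℕ} {σ : Env} :
    InvTables p (σ.set d v) ↔ InvTables p σ := Iff.rfl

@[simp] theorem invTables_tick {p n : ℕ} {σ : Env} :
    InvTables p (σ.tick n) ↔ InvTables p σ := Iff.rfl

/-- Sets the cofactors to `T₀ = 0` and `T₁ = 1`. -/
def initCofactors : Cmd :=
  10 ::= 0 ;;
  17 ::= 0 ;;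
  .while (.var 17) (.var 14)
    (.store 11 (2 * .var 17) 0 ;; .store 11 (2 * .var 17 + 1) 0 ;; 17 ::= .var 17 + 1) ;;
  .store 11 1 1

/-- One elimination step: subtract a multiple of the second pair from the first pair. -/
def eliminate : Cmd :=
  15 ::= .var 11 - .var 12 ;;
  16 ::= ((.var 2 - .ld 10 (2 * (.var 11 - 1) + .var 10)) *
      .ld 3 ((.var 2 - 1 - .ld 4 (.var 18)) % (.var 2 - 1))) % .var 2 ;;
  axpy 10 11 ;;
  axpy 11 14 ;;
  11 ::= .var 11 - 1

/-- One round of the Euclidean algorithm. -/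
def euclidRound : Cmd :=
  .ite (.var 11) (.var 12)
    (10 ::= 1 - .var 10 ;; 18 ::= .var 11 ;; 11 ::= .var 12 ;; 12 ::= .var 18)
    (18 ::= .ld 10 (2 * (.var 12 - 1) + (1 - .var 10)) ;;
      .ite 0 (.var 18) eliminate (12 ::= .var 12 - 1))

/-- The extended Euclidean algorithm (with one cofactor), stopped when the second remainder has
degree less than the variable 13.  The remainders are interleaved in the array 10, the cofactors in
the array 11; the variable 10 is the parity of the cells of the first pair. -/
def euclid : Cmd :=
  initCofactors ;; .while (.var 13) (.var 12) euclidRound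

theorem wp_initCofactors {W : ℕ} {ω : Coins} {σ : Env} {p N : ℕ} (hp : 1 < p) (hN : 2 * N + 4 < W)
    (vN : σ.var 14 = N + 1) :
    initCofactors.Wp W ω (fun σ' => Frame [10, 17] [11] σ σ' ∧ σ'.var 10 = 0 ∧
      Rep (p := p) (N + 1) (fun i => σ'.mem 11 (2 * i + 0)) 0 ∧
      Rep (p := p) (N + 1) (fun i => σ'.mem 11 (2 * i + (1 - 0))) 1 ∧
      σ'.time ≤ σ.time + 30 * N + 50) σ := by
  simp only [initCofactors, wp_seq, wp_assign]
  refine ⟨by simp; omega, by simp; omega, wp_while_count (fun m σ' => Frame [10, 17] [11] σ σ' ∧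
      σ'.var 17 = m ∧ σ'.var 10 = 0 ∧ (∀ i < m, σ'.mem 11 (2 * i) = 0) ∧
      (∀ i < m, σ'.mem 11 (2 * i + 1) = 0) ∧ σ'.time ≤ σ.time + 30 * m + 10)
      0 (N + 1) (Nat.zero_le _) ?_ ?_ ?_⟩
  · simp [Frame.refl]
  · rintro i σ' - hi ⟨hF, h17, h10, h0, h1, ht⟩
    have e14 : σ'.var 14 = N + 1 := by rw [hF.var 14 (by simp), vN]
    refine ⟨by simp, by simp, by simp [h17, e14, hi], ?_⟩
    simp only [wp_seq, wp_store, wp_assign]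
    refine ⟨by simp [h17]; omega, by simp; omega, by simp [h17]; omega, by simp; omega,
      by simp [h17]; omega, by simp [hF], by simp [h17], by simp [h10],
      fun j hj => ?_, fun j hj => ?_, by simp; omega⟩
    · have : 2 * j ≠ 2 * i + 1 := by omega
      by_cases hji : j = i
      · simp [h17, this, hji]
      · simp [h17, this, hji, h0 j (by omega)]
    · have : 2 * j + 1 ≠ 2 * i := by omega
      by_cases hji : j = i
      · simp [h17, this, hji]
      · simp [h17, this, hji, h1 j (by omega)]
  · rintro σ' ⟨hF, h17, h10, h0, h1, ht⟩
    have e14 : σ'.var 14 = N + 1 := by rw [hF.var 14 (by simp), vN]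
    refine ⟨by simp, by simp, by simp [h17, e14], ?_⟩
    simp only [wp_store]
    refine ⟨by simp; omega, by simp; omega, by  simp [hF], by simp [h10],
      ⟨fun i hi => ?_, fun i hi => ?_, fun i hi => by simp⟩,
      ⟨fun i hi => ?_, fun i hi => ?_, fun i hi => ?_⟩, by simp; omega⟩
    · have : 2 * i ≠ 1 := by omega
      simp [this, h0 i hi]; omega
    · have : 2 * i ≠ 1 := by omega
      simp [this, h0 i hi]
    · by_cases h : i = 0
      · simp [h, hp]
      · simp [h, h1 i hi]; omega
    · by_cases h : i = 0
      · simp [h]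
      · simp [h, h1 i hi, coeff_one]
    · simp [coeff_one]; omega

/-- What `euclid` keeps true. -/
structure EuclidState {p : ℕ} (θ N K : ℕ) (M Y : (ZMod p)[X]) (b n₀ n₁ : ℕ) (R₀ R₁ T₀ T₁ : (ZMod p)[X])
    (σ : Env) : Prop where
  b_le : b ≤ 1
  var10 : σ.var 10 = b
  var11 : σ.var 11 = n₀
  var12 : σ.var 12 = n₁
  rep0 : Rep n₀ (fun i => σ.mem 10 (2 * i + b)) R₀
  rep1 : Rep n₁ (fun i => σ.mem 10 (2 * i + (1 - b))) R₁
  cof0 : Rep (N + 1) (fun i => σ.mem 11 (2 * i + b)) T₀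
  cof1 : Rep (N + 1) (fun i => σ.mem 11 (2 * i + (1 - b))) T₁
  inv : EuclidInv θ N M Y R₀ R₁ T₀ T₁ n₀ n₁
  le₀ : n₀ ≤ K
  le₁ : n₁ ≤ K

/-- With x and y the leading coefficients of the two remainders, the multiplier computed in
`eliminate` cancels the leading term. -/
theorem natCast_sub_mul_inv {p x y z : ℕ} (hx : x ≤ p) (hz : (z : ZMod p) * y = 1) :
    (x : ZMod p) + (((p - x) * z % p : ℕ) : ZMod p) * y = 0 := by
  rw [ZMod.natCast_mod, Nat.cast_mul, Nat.cast_sub hx, ZMod.natCast_self, mul_assoc, hz]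
  ring

theorem wp_eliminate {W : ℕ} {ω : Coins} {σ : Env} {p θ N K b n₀ n₁ : ℕ}
    {M Y R₀ R₁ T₀ T₁ : (ZMod p)[X]} (hp : 1 < p) (hW : p * p + p < W)
    (hK : 3 * K + 2 * N + 4 < W) (vp : σ.var 2 = p) (vN : σ.var 14 = N + 1) (ht : InvTables p σ)
    (h : EuclidState θ N K M Y b (n₀ + 1) n₁ R₀ R₁ T₀ T₁ σ) (hθ : θ < n₁) (hn : n₁ ≤ n₀ + 1)
    (v18 : σ.var 18 = σ.mem 10 (2 * (n₁ - 1) + (1 - b))) (h18 : 0 < σ.var 18) :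
    eliminate.Wp W ω (fun σ' => Frame [11, 15, 16, 17] [10, 11] σ σ' ∧
      (∃ R₀' T₀', EuclidState θ N K M Y b n₀ n₁ R₀' R₁ T₀' T₁ σ') ∧
      σ'.time ≤ σ.time + 100 * (N + 1) + 100) σ := by
  obtain ⟨hb, v10, v11, v12, r0, r1, c0, c1, hI, l0, l1⟩ := h
  have hx : σ.mem 10 (2 * n₀ + b) < p := r0.lt n₀ (by omega)
  have hy : σ.var 18 < p := v18 ▸ r1.lt (n₁ - 1) (by omega)
  obtain ⟨t1, t2, t3⟩ := ht _ h18 hy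
  have en0 : n₀ + 1 - 1 = n₀ := rfl
  set δ := n₀ + 1 - n₁ with hδ
  set c := (p - σ.mem 10 (2 * n₀ + b)) * σ.mem 3 ((p - 1 - σ.mem 4 (σ.var 18)) % (p - 1)) % p
    with hc
  have hcp : c < p := Nat.mod_lt _ (by omega)
  have hmul : (p - σ.mem 10 (2 * n₀ + b)) * σ.mem 3 ((p - 1 - σ.mem 4 (σ.var 18)) % (p - 1))
      ≤ p * p := Nat.mul_le_mul (Nat.sub_le _ _) t2.le
  have hb' : 1 - (1 - b) = b := by omega
  simp only [eliminate, wp_seq, wp_assign]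
  refine ⟨by simp [v11, v12, hn], ?_, ?_⟩
  · simp [v11, v10, vp]
    omega
  have ax := fun (σ : Env) A bd hbd n hn e1 e2 e3 e4 e5 => wp_axpy (W := W) (ω := ω) (A := A)
    (bound := bd) (σ := σ) hbd p n b δ c hW hn hb e1 e2 e3 e4 e5 hcp
  refine (ax _ 10 11 (by simp) (n₀ + 1) (by omega) (by simp [vp]) (by simp [v11]) (by simp [v10])
    (by simp [v11, v12, hδ]) (by simp [v11, v10, vp, hc]) (fun i hi => ?_) (fun i hi => ?_)).mono ?_
  · simpa using r0.lt (i + δ) (by omega)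
  · simpa using r1.lt i (by omega)
  rintro σ₁ ⟨F1, a1, a2, t1'⟩
  have F1' : Frame [15, 16, 17] [10] σ σ₁ := by
    refine Frame.trans ?_ (F1.weaken (by simp) (by simp))
    simp [Frame.refl]
  simp only [Env.tick_mem, Env.set_mem] at a1 a2
  rw [wp_seq]
  refine (ax σ₁ 11 14 (by simp) (N + 1) (by omega) (by simp [F1'.var, vp]) (by simp [F1'.var, vN])
    (by simp [F1'.var, v10]) (by simp [F1.var, v11, v12, hδ])
    (by simp [F1.var, v11, v10, vp, hc]) (fun i hi => ?_) (fun i hi => ?_)).mono ?_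
  · simpa [F1.mem] using c0.lt (i + δ) (by omega)
  · simpa [F1.mem] using c1.lt i (by omega)
  rintro σ₂ ⟨F2, a3, a4, t2'⟩
  have F2' : Frame [15, 16, 17] [10, 11] σ σ₂ :=
    (F1'.weaken (by simp) (by simp)).trans (F2.weaken (by simp) (by simp))
  rw [F1'.mem 11 (by simp)] at a3 a4
  have a1' := fun i => (congrFun (F2.mem 10 (by simp)) (2 * i + b)).trans (a1 i)
  have a2' := fun i => (congrFun (F2.mem 10 (by simp)) (2 * i + (1 - b))).trans (a2 i)
  rw [wp_assign]
  refine ⟨by simp [F2'.var, v11]; omega, ?_, ⟨R₀ + C (c : ZMod p) * X ^ δ * R₁,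
    T₀ + C (c : ZMod p) * X ^ δ * T₁, hb, by simp [F2'.var, v10], by simp [F2'.var, v11],
    by simp [F2'.var, v12], ?_, ?_, ?_, ?_, hI.step hn hθ c, by omega, l1⟩, ?_⟩
  · simp only [Env.tick_var, Frame.tick_right]
    rw [Frame.set (by simp)]
    exact F2'.weaken (by simp) (by simp)
  · refine Rep.pop (Rep.axpy (by omega) r0 (m₁ := fun i => σ.mem 10 (2 * i + (1 - b)))
      (fun i hi => r1.coeff i (by omega)) (fun i hi => r1.deg i (by omega)) fun i hi => ?_) ?_
    · simpa using a1' i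
    · rw [coeff_add, mul_assoc, coeff_C_mul, coeff_X_pow_mul', if_pos (by omega),
        show n₀ - δ = n₁ - 1 by omega, r0.coeff _ (by omega), r1.coeff _ (by omega), ← v18]
      exact natCast_sub_mul_inv hx.le t3
  · exact r1.congr fun i _ => by simpa using a2' i
  · refine Rep.axpy (by omega) c0 (m₁ := fun i => σ.mem 11 (2 * i + (1 - b)))
      (fun i hi => c1.coeff i (by omega)) (fun i hi => hI.deg₁ i (by omega)) fun i hi => ?_
    simpa using a3 i
  · exact c1.congr fun i _ => by simpa using a4 i
  -- The first `axpy` makes n₁ iterations, and n₁ ≤ N + 1 because it is the shorter length; the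
  -- second makes at most N + 1.
  · have := hI.small
    simp at t1' t2' ⊢
    omega

/-- The time that `euclid` has left is bounded in terms of this potential. -/
def euclidPotential (n₀ n₁ : ℕ) : ℕ := 2 * (n₀ + n₁) + if n₀ < n₁ then 1 else 0

/-- An exchange happens only when n₀ < n₁ and uses up the extra 1 of the potential. Any other round
shortens a remainder by one cell, which gains 2 and gives back at most 1. -/
theorem wp_euclidRound {W : ℕ} {ω : Coins} {σ : Env} {p θ N K b n₀ n₁ : ℕ}
    {M Y R₀ R₁ T₀ T₁ : (ZMod p)[X]} (hp : 1 < p) (hW : p * p + p < W)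
    (hK : 3 * K + 2 * N + 4 < W) (vp : σ.var 2 = p) (vN : σ.var 14 = N + 1) (ht : InvTables p σ)
    (h : EuclidState θ N K M Y b n₀ n₁ R₀ R₁ T₀ T₁ σ) (hθ : θ < n₁) :
    euclidRound.Wp W ω (fun σ' => Frame [10, 11, 12, 15, 16, 17, 18] [10, 11] σ σ' ∧
      (∃ b' n₀' n₁' R₀' R₁' T₀' T₁', EuclidState θ N K M Y b' n₀' n₁' R₀' R₁' T₀' T₁' σ' ∧
        euclidPotential n₀' n₁' < euclidPotential n₀ n₁) ∧
      σ'.time ≤ σ.time + 100 * (N + 1) + 150) σ := by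
  obtain ⟨hb, v10, v11, v12, r0, r1, c0, c1, hI, l0, l1⟩ := id h
  have hb' : 1 - (1 - b) = b := by omega
  simp only [euclidRound, wp_seq, wp_assign, wp_ite]
  refine ⟨by simp, by simp, fun hlt => ?_, fun hle => ?_⟩
  · simp only [Expr.val_var, v11, v12] at hlt
    refine ⟨by simp [v10, hb]; omega, by simp, by simp, by simp, by simp [Frame.refl],
      ⟨1 - b, n₁, n₀, R₁, R₀, T₁, T₀, ⟨by omega, by simp [v10], by simp [v12],
      by simp [v11], r1.congr (by simp), r0.congr (by simp [hb']), c1.congr (by simp),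
      c0.congr (by simp [hb']), hI.swap, l1, l0⟩, ?_⟩, ?_⟩
    · simp only [euclidPotential, hlt, if_true, hlt.not_gt, if_false]
      omega
    · simp; omega
  · simp only [Expr.val_var, v11, v12] at hle
    refine ⟨by simp [v10, v12, hb]; omega, by simp; omega, by simp, fun h0 => ?_, fun h0 => ?_⟩
    · obtain ⟨m, rfl⟩ : ∃ m, n₀ = m + 1 := ⟨n₀ - 1, by omega⟩
      refine (wp_eliminate (θ := θ) (N := N) (K := K) (b := b) (n₀ := m) (n₁ := n₁) (M := M)
        (Y := Y) (R₀ := R₀) (R₁ := R₁) (T₀ := T₀) (T₁ := T₁) hp hW hK (by simp [vp])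
        (by simp [vN]) (by exact ht) (by exact ⟨hb, by simp [v10], by simp [v11], by simp [v12], r0,
        r1, c0, c1, hI, l0, l1⟩) hθ hle (by simp [v12, v10]) (by exact h0)).mono ?_
      rintro σ' ⟨F, ⟨R₀', T₀', hE⟩, hT⟩
      refine ⟨?_, ⟨b, m, n₁, R₀', R₁, T₀', T₁, ?_, ?_⟩, ?_⟩
      · rw [Frame.tick_right]
        refine Frame.trans ?_ (F.weaken (by simp) (by simp))
        simp [Frame.refl]
      · exact ⟨hE.b_le, hE.var10, hE.var11, hE.var12, hE.rep0, hE.rep1, hE.cof0, hE.cof1,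
          hE.inv, hE.le₀, hE.le₁⟩
      · simp only [euclidPotential]
        split_ifs <;> omega
      · simp at hT ⊢
        omega
    · obtain ⟨m, rfl⟩ : ∃ m, n₁ = m + 1 := ⟨n₁ - 1, by omega⟩
      simp [v12, v10] at h0
      refine ⟨by simp [v12]; omega, by simp [Frame.refl], ⟨b, n₀, m, R₀, R₁, T₀, T₁,
        ⟨hb, by simp [v10], by simp [v11], by simp [v12], r0, ?_, c0, c1, hI.pop hle, l0,
          by omega⟩, ?_⟩, by simp; omega⟩
      · refine Rep.pop (Rep.congr r1 (by simp)) ?_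
        rw [r1.coeff _ (by omega), h0]
        simp
      · simp only [euclidPotential]
        split_ifs <;> omega

/-- Working cell by cell avoids division with remainder: at most 2(N + 1 + n₁) + 1 rounds of cost
O(N + 1). The start is R₀ = M, R₁ = Y, T₀ = 0, T₁ = 1, and Y may be longer than M. -/
theorem wp_euclid {W : ℕ} {ω : Coins} {σ : Env} {p θ N K n₁ : ℕ} {M Y : (ZMod p)[X]}
    (hp : 1 < p) (hW : p * p + p < W) (hK : 3 * K + 2 * N + 4 < W) (vp : σ.var 2 = p)
    (vN : σ.var 14 = N + 1) (vθ : σ.var 13 = θ) (v11 : σ.var 11 = N + 1) (v12 : σ.var 12 = n₁)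
    (ht : InvTables p σ) (hM : Rep (N + 1) (fun i => σ.mem 10 (2 * i)) M)
    (hY : Rep n₁ (fun i => σ.mem 10 (2 * i + 1)) Y) (hθ : θ ≤ N) (hNK : N + 1 ≤ K)
    (hn : n₁ ≤ K) :
    euclid.Wp W ω (fun σ' => Frame [10, 11, 12, 15, 16, 17, 18] [10, 11] σ σ' ∧
      (∃ b m₀ m₁ R₀ R₁ T₀ T₁, EuclidState θ N K M Y b m₀ m₁ R₀ R₁ T₀ T₁ σ' ∧ m₁ ≤ θ) ∧
      σ'.time ≤ σ.time + (2 * (N + 1 + n₁) + 2) * (100 * (N + 1) + 200)) σ := by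
  simp only [euclid, wp_seq]
  refine (wp_initCofactors (p := p) hp (by omega) vN).mono ?_
  rintro σ₁ ⟨F1, h10, c0, c1, t1⟩
  have F1' : Frame [10, 11, 12, 15, 16, 17, 18] [10, 11] σ σ₁ := F1.weaken (by simp) (by simp)
  refine wp_while (fun σ' => Frame [10, 11, 12, 15, 16, 17, 18] [10, 11] σ σ' ∧
    ∃ b m₀ m₁ R₀ R₁ T₀ T₁, EuclidState θ N K M Y b m₀ m₁ R₀ R₁ T₀ T₁ σ' ∧
      σ'.time + euclidPotential m₀ m₁ * (100 * (N + 1) + 160) ≤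
        σ₁.time + euclidPotential (N + 1) n₁ * (100 * (N + 1) + 160))
    (fun σ' => euclidPotential (σ'.var 11) (σ'.var 12)) ?_ ?_
  · refine ⟨F1', 0, N + 1, n₁, M, Y, 0, 1, ⟨by simp, h10, by simp [F1.var, v11],
      by simp [F1.var, v12], hM.congr (by simp [F1.mem]), hY.congr (by simp [F1.mem]), c0, c1,
      ⟨by simp, by simp, by simp, by simp, fun i hi => ?_, Or.inl (by omega), Or.inl le_rfl⟩,
      hNK, hn⟩, le_rfl⟩
    rw [coeff_one, if_neg (by omega)]
  · rintro σ₂ ⟨F2, b, m₀, m₁, R₀, R₁, T₀, T₁, hE, hT⟩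
    have e13 : σ₂.var 13 = θ := by simp [F2.var, vθ]
    refine ⟨by simp, by simp, fun hlt => ?_, fun hle => ?_⟩
    · simp only [Expr.val_var, e13, hE.var12] at hlt
      have hE' := hE
      refine (wp_euclidRound (θ := θ) (N := N) (K := K) (b := b) (n₀ := m₀) (n₁ := m₁) (M := M)
        (Y := Y) (R₀ := R₀) (R₁ := R₁) (T₀ := T₀) (T₁ := T₁) hp hW hK (by simp [F2.var, vp])
        (by simp [F2.var, vN]) (by exact ht.frame (Frame.tick_right.2 F2) (by simp) (by simp))
        (by exact ⟨hE.b_le, hE.var10, hE.var11, hE.var12, hE.rep0, hE.rep1, hE.cof0, hE.cof1,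
          hE.inv, hE.le₀, hE.le₁⟩) hlt).mono ?_
      rintro σ₃ ⟨F3, ⟨b', n₀', n₁', R₀', R₁', T₀', T₁', hE3, hlt3⟩, hT3⟩
      rw [Frame.tick_left] at F3
      refine ⟨⟨by simpa using F2.trans F3, b', n₀', n₁', R₀', R₁', T₀', T₁',
        ⟨hE3.b_le, hE3.var10, hE3.var11, hE3.var12, hE3.rep0, hE3.rep1, hE3.cof0, hE3.cof1,
          hE3.inv, hE3.le₀, hE3.le₁⟩, ?_⟩, ?_⟩
      · have := Nat.mul_le_mul_right (100 * (N + 1) + 160) (Nat.succ_le_of_lt hlt3)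
        rw [Nat.succ_mul] at this
        simp at hT3 ⊢
        omega
      · simpa [hE3.var11, hE3.var12, hE.var11, hE.var12] using hlt3
    · simp only [Expr.val_var, e13, hE.var12] at hle
      refine ⟨by simpa using F2, ⟨b, m₀, m₁, R₀, R₁, T₀, T₁,
        ⟨hE.b_le, hE.var10, hE.var11, hE.var12, hE.rep0, hE.rep1, hE.cof0, hE.cof1,
          hE.inv, hE.le₀, hE.le₁⟩, hle⟩, ?_⟩
      have h1 : euclidPotential (N + 1) n₁ ≤ 2 * (N + 1 + n₁) + 1 := by
        simp only [euclidPotential]; split_ifs <;> omega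
      have h2 := Nat.mul_le_mul_right (100 * (N + 1) + 160) h1
      simp at t1 hT ⊢
      nlinarith

end WordRAM

/-! ### Padé approximants and sparse interpolation -/

namespace WordRAM
open Polynomial

/-! ### What the Euclidean invariant says about rational approximation and about common roots -/

section Pade
variable {F : Type*} [Field F]

theorem coeff_mul_eq_zero_of_le {P Q : F[X]} {a b n : ℕ} (hP : ∀ i, a < i → P.coeff i = 0)
    (hQ : ∀ i, b ≤ i → Q.coeff i = 0) (hn : a + b ≤ n) : (P * Q).coeff n = 0 := by
  rw [coeff_mul]
  refine Finset.sum_eq_zero fun x hx => ?_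
  rw [Finset.HasAntidiagonal.mem_antidiagonal] at hx
  by_cases h : a < x.1
  · rw [hP _ h, zero_mul]
  · rw [hQ _ (by omega), mul_zero]

/-- The Euclidean algorithm for `X ^ (2 θ)` and `S` finds the fraction `Ω / Λ` with
`Λ * S ≡ Ω` modulo `X ^ (2 θ)`. -/
theorem EuclidInv.pade {θ : ℕ} {S R₀ R₁ T₀ T₁ Λ Ω : F[X]} {n₀ n₁ : ℕ}
    (h : EuclidInv θ (2 * θ) (X ^ (2 * θ)) S R₀ R₁ T₀ T₁ n₀ n₁) (hn : n₁ ≤ θ)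
    (hR : ∀ i, n₁ ≤ i → R₁.coeff i = 0) (hΛ : ∀ i, θ < i → Λ.coeff i = 0)
    (hΩ : ∀ i, θ ≤ i → Ω.coeff i = 0) (hS : X ^ (2 * θ) ∣ Λ * S - Ω) (hco : IsCoprime Λ Ω)
    (hΛ0 : Λ ≠ 0) :
    ∃ c : F, c ≠ 0 ∧ T₁ = C c * Λ ∧ R₁ = C c * Ω := by
  have hT : ∀ i, θ < i → T₁.coeff i = 0 := fun i hi => h.deg₁ i (by have := h.large; omega)
  -- Both products have degree below 2θ, while their difference is divisible by X^(2θ).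
  have hD : Λ * R₁ - T₁ * Ω = 0 := by
    have hd : X ^ (2 * θ) ∣ Λ * R₁ - T₁ * Ω := by
      have := dvd_add (h.dvd₁.mul_left Λ) (hS.mul_left T₁)
      convert this using 1
      ring
    ext i
    rcases lt_or_ge i (2 * θ) with hi | hi
    · rw [X_pow_dvd_iff.1 hd i hi, coeff_zero]
    · rw [coeff_sub, coeff_mul_eq_zero_of_le hΛ (fun i hi => hR i (by omega)) (by omega),
        coeff_mul_eq_zero_of_le hT hΩ (by omega), sub_zero, coeff_zero]
  rw [sub_eq_zero] at hD
  obtain ⟨c, rfl⟩ : Λ ∣ T₁ := hco.dvd_of_dvd_mul_right ⟨R₁, hD.symm⟩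
  obtain rfl : R₁ = c * Ω := mul_left_cancel₀ hΛ0 (by rw [hD]; ring)
  -- The determinant is now c (ΛR₀ - ΩT₀) = ±X^(2θ). As X^(2θ) already divides the bracket, c is a
  -- unit.
  obtain ⟨e, he⟩ : X ^ (2 * θ) ∣ Λ * R₀ - Ω * T₀ := by
    have := dvd_sub (h.dvd₀.mul_left Λ) (hS.mul_left (-T₀))
    convert this using 1
    ring
  have hX : (X : F[X]) ^ (2 * θ) ≠ 0 := pow_ne_zero _ X_ne_zero
  have hu : IsUnit c := by
    rcases h.det with hd | hd
    · refine IsUnit.of_mul_eq_one e (mul_left_cancel₀ hX ?_)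
      linear_combination hd - c * he
    · refine IsUnit.of_mul_eq_one (-e) (mul_left_cancel₀ hX ?_)
      linear_combination c * he - hd
  obtain ⟨r, hr, rfl⟩ := Polynomial.isUnit_iff.1 hu
  exact ⟨r, hr.ne_zero, by ring, rfl⟩

/-- The final cofactor of the Euclidean algorithm for a separable split polynomial `M` and `Y`
vanishes exactly at those roots of `M` at which `Y` does not. -/
theorem EuclidInv.peel [DecidableEq F] {N : ℕ} {c : F} {J : Finset F} {Y R₀ T₀ T₁ : F[X]}
    {n₀ n₁ : ℕ}
    (hc : c ≠ 0)
    (h : EuclidInv 0 N (C c * ∏ y ∈ J, (X - C y)) Y R₀ 0 T₀ T₁ n₀ n₁) :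
    ∃ c' : F, c' ≠ 0 ∧ T₁ = C c' * ∏ y ∈ J.filter (fun y => Y.eval y ≠ 0), (X - C y) := by
  have root : ∀ y ∈ J, ∀ Q : F[X], (C c * ∏ y ∈ J, (X - C y)) ∣ Q → Q.eval y = 0 := by
    rintro y hy _ ⟨Q, rfl⟩
    rw [eval_mul, eval_mul, eval_prod, Finset.prod_eq_zero hy (by simp)]
    simp
  have cop : ∀ s : Set F, s.Pairwise (Function.onFun IsCoprime fun y => X - C y) :=
    fun s a _ b _ hab => (pairwise_coprime_X_sub_C (Function.injective_id (α := F))) hab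
  -- Since R₁ = 0, M divides T₁Y, so T₁ vanishes at the roots where Y does not; R₀ ≡ T₀Y vanishes at
  -- the others. The determinant gives R₀T₁ = ±M, which leaves no room for further factors.
  obtain ⟨A, hA⟩ : ∏ y ∈ J.filter (fun y => Y.eval y ≠ 0), (X - C y) ∣ T₁ := by
    refine Finset.prod_dvd_of_coprime (cop _) fun y hy => ?_
    rw [Finset.mem_filter] at hy
    have := root y hy.1 _ h.dvd₁
    rw [zero_sub, eval_neg, eval_mul, neg_eq_zero, mul_eq_zero] at this
    exact dvd_iff_isRoot.2 (this.resolve_right hy.2)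
  obtain ⟨A', hA'⟩ : ∏ y ∈ J.filter (fun y => ¬ Y.eval y ≠ 0), (X - C y) ∣ R₀ := by
    refine Finset.prod_dvd_of_coprime (cop _) fun y hy => ?_
    rw [Finset.mem_filter, not_not] at hy
    have := root y hy.1 _ h.dvd₀
    rw [eval_sub, eval_mul, hy.2, mul_zero, sub_zero] at this
    exact dvd_iff_isRoot.2 this
  have hsplit := Finset.prod_filter_mul_prod_filter_not J (fun y => Y.eval y ≠ 0)
    (fun y => (X - C y : F[X]))
  have hne : ∏ y ∈ J, (X - C y : F[X]) ≠ 0 :=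
    Finset.prod_ne_zero_iff.2 fun y _ => X_sub_C_ne_zero y
  obtain ⟨u, hu, hd⟩ : ∃ u : F, u ≠ 0 ∧ R₀ * T₁ = C u * ∏ y ∈ J, (X - C y) := by
    rcases h.det with hd | hd
    · exact ⟨c, hc, by rw [← hd]; ring⟩
    · refine ⟨-c, neg_ne_zero.2 hc, ?_⟩
      rw [C_neg, neg_mul, ← hd]; ring
  have hAA : A * A' = C u := by
    refine mul_left_cancel₀ hne ?_
    rw [hA, hA'] at hd
    calc _ = (∏ y ∈ J.filter (fun y => Y.eval y ≠ 0), (X - C y)) *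
            (∏ y ∈ J.filter (fun y => ¬ Y.eval y ≠ 0), (X - C y)) * (A * A') := by rw [hsplit]
      _ = C u * ∏ y ∈ J, (X - C y) := by rw [← hd]; ring
      _ = _ := mul_comm _ _
  have hAu : IsUnit A := isUnit_of_mul_isUnit_left (y := A')
    (hAA ▸ Polynomial.isUnit_C.2 (isUnit_iff_ne_zero.2 hu))
  obtain ⟨r, hr, rfl⟩ := Polynomial.isUnit_iff.1 hAu
  exact ⟨r, hr.ne_zero, by rw [hA, mul_comm]⟩

end Pade

/-! ### Locator and evaluator polynomials of a sparse vector -/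

section Sparse
variable {F : Type*} [Field F]

/-- The error locator polynomial of a sparse vector. -/
noncomputable def locator (I : Finset F) : F[X] := ∏ x ∈ I, (1 - C x * X)

/-- The numerator of the generating function of the power sums of a sparse vector. -/
noncomputable def evaluator [DecidableEq F] (I : Finset F) (v : F → F) : F[X] :=
  ∑ x ∈ I, C (v x * x) * locator (I.erase x)

theorem natDegree_locator_le (I : Finset F) : (locator I).natDegree ≤ I.card := by
  refine (Polynomial.natDegree_prod_le _ _).trans ?_
  refine (Finset.sum_le_card_nsmul _ _ 1 fun x _ => ?_).trans (by simp)
  refine (natDegree_sub_le _ _).trans ?_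
  simp only [natDegree_one, zero_le, sup_of_le_right]
  exact (natDegree_C_mul_le x X).trans natDegree_X_le

theorem locator_ne_zero (I : Finset F) : locator I ≠ 0 := by
  refine Finset.prod_ne_zero_iff.2 fun x _ h => ?_
  have := congrArg (Polynomial.eval 0) h
  simp at this

variable [DecidableEq F]

theorem locator_erase {I : Finset F} {x : F} (hx : x ∈ I) :
    locator I = (1 - C x * X) * locator (I.erase x) :=
  (Finset.mul_prod_erase I _ hx).symm

theorem eval_locator_erase_ne_zero {I : Finset F} {x : F} (hx : x ≠ 0) :
    (locator (I.erase x)).eval x⁻¹ ≠ 0 := by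
  rw [locator, eval_prod]
  refine Finset.prod_ne_zero_iff.2 fun l hl h => (Finset.mem_erase.1 hl).1 ?_
  simp only [eval_sub, eval_one, eval_mul, eval_C, eval_X, sub_eq_zero] at h
  field_simp at h
  exact h.symm

theorem eval_locator {I : Finset F} {x : F} (hI : x ∈ I) (hx : x ≠ 0) :
    (locator I).eval x⁻¹ = 0 := by
  rw [locator_erase hI]
  simp [hx]

/-- With `eval_evaluator` this is Forney's formula Ω(1/x) = -v_x Λ'(1/x): the ratio of two
polynomials encodes the values. -/
theorem eval_derivative_locator {I : Finset F} {x : F} (hI : x ∈ I) (hx : x ≠ 0) :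
    (derivative (locator I)).eval x⁻¹ = -x * (locator (I.erase x)).eval x⁻¹ := by
  rw [locator_erase hI, derivative_mul]
  simp [hx]

theorem eval_evaluator {I : Finset F} {v : F → F} {x : F} (hI : x ∈ I) (hx : x ≠ 0) :
    (evaluator I v).eval x⁻¹ = v x * x * (locator (I.erase x)).eval x⁻¹ := by
  rw [evaluator, eval_finsetSum, Finset.sum_eq_single_of_mem x hI]
  · simp
  · intro y hy hxy
    rw [eval_mul, eval_locator (Finset.mem_erase.2 ⟨hxy.symm, hI⟩) hx, mul_zero]

/-- At a root 1/x of the locator only the summand of x survives in the evaluator, and it is non-zero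
because v x ≠ 0. -/
theorem isCoprime_locator {I : Finset F} {v : F → F} (h0 : 0 ∉ I) (hv : ∀ x ∈ I, v x ≠ 0) :
    IsCoprime (locator I) (evaluator I v) := by
  refine IsCoprime.prod_left fun x hx => ?_
  have hx0 : x ≠ 0 := fun h => h0 (h ▸ hx)
  have e : (1 - C x * X : F[X]) = C (-x) * (X - C x⁻¹) := by
    rw [mul_sub, ← C_mul, neg_mul, mul_inv_cancel₀ hx0]
    simp
    ring
  rw [e]
  refine (isCoprime_mul_unit_left_left (isUnit_C.2 (isUnit_iff_ne_zero.2 (neg_ne_zero.2 hx0)))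
    _ _).2 ?_
  refine ((irreducible_X_sub_C x⁻¹).coprime_iff_not_dvd).2 fun h => ?_
  have h := dvd_iff_isRoot.1 h
  rw [IsRoot.def, eval_evaluator hx hx0] at h
  exact mul_ne_zero (mul_ne_zero (hv x hx) hx0) (eval_locator_erase_ne_zero hx0) h

theorem locator_eq {I : Finset F} (h0 : 0 ∉ I) : ∃ c : F, c ≠ 0 ∧
    locator I = C c * ∏ y ∈ I.image (·⁻¹), (X - C y) := by
  refine ⟨∏ x ∈ I, (-x), Finset.prod_ne_zero_iff.2 fun x hx => neg_ne_zero.2 fun h =>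
    h0 (h ▸ hx), ?_⟩
  rw [Finset.prod_image (fun x _ y _ h => inv_injective h), map_prod, ← Finset.prod_mul_distrib]
  refine Finset.prod_congr rfl fun x hx => ?_
  have hx0 : x ≠ 0 := fun h => h0 (h ▸ hx)
  rw [mul_sub, ← C_mul, neg_mul, mul_inv_cancel₀ hx0]
  simp
  ring

/-- Each x contributes the truncated geometric series of v_x x / (1 - xX), and multiplying by 1 - xX
leaves only v_x x (1 - (xX)^N). -/
theorem locator_mul_sub_evaluator {I : Finset F} {v : F → F} {N : ℕ} {S : F[X]}
    (hS : ∀ i, S.coeff i = if i < N then ∑ x ∈ I, v x * x ^ (i + 1) else 0) :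
    X ^ N ∣ locator I * S - evaluator I v := by
  have eS : S = ∑ x ∈ I, C (v x * x) * ∑ i ∈ Finset.range N, (C x * X) ^ i := by
    ext i
    rw [hS, finsetSum_coeff]
    simp only [coeff_C_mul, mul_pow, ← C_pow, finsetSum_coeff, coeff_X_pow, mul_ite, mul_one,
      mul_zero, Finset.sum_ite_eq, Finset.mem_range]
    split_ifs
    · exact Finset.sum_congr rfl fun x _ => by ring
    · simp
  have : locator I * S - evaluator I v =
      X ^ N * ∑ x ∈ I, - (C (v x * x) * C (x ^ N) * locator (I.erase x)) := by
    rw [eS, evaluator, Finset.mul_sum, Finset.mul_sum, ← Finset.sum_sub_distrib]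
    refine Finset.sum_congr rfl fun x hx => ?_
    have := mul_neg_geom_sum (C x * X : F[X]) N
    rw [locator_erase hx, mul_pow, ← C_pow] at *
    linear_combination (C (v x * x) * locator (I.erase x)) * this
  exact ⟨_, this⟩

theorem coeff_evaluator {I : Finset F} {v : F → F} {i : ℕ} (hi : I.card ≤ i) :
    (evaluator I v).coeff i = 0 := by
  rw [evaluator, finsetSum_coeff]
  refine Finset.sum_eq_zero fun x hx => ?_
  rw [coeff_C_mul, coeff_eq_zero_of_natDegree_lt, mul_zero]
  refine (natDegree_locator_le _).trans_lt ?_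
  exact (Finset.card_lt_card (Finset.erase_ssubset hx)).trans_le hi

/-- Decoding: what the Euclidean algorithm finds when the power sums are those of a sparse vector. -/
theorem EuclidInv.sparse {θ : ℕ} {S R₀ R₁ T₀ T₁ : F[X]} {n₀ n₁ : ℕ} {I : Finset F} {v : F → F}
    (h : EuclidInv θ (2 * θ) (X ^ (2 * θ)) S R₀ R₁ T₀ T₁ n₀ n₁) (hn : n₁ ≤ θ)
    (hR : ∀ i, n₁ ≤ i → R₁.coeff i = 0) (h0 : 0 ∉ I) (hv : ∀ x ∈ I, v x ≠ 0) (hI : I.card ≤ θ)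
    (hS : ∀ i, S.coeff i = if i < 2 * θ then ∑ x ∈ I, v x * x ^ (i + 1) else 0) :
    ∃ c : F, c ≠ 0 ∧ T₁ = C c * ∏ y ∈ I.image (·⁻¹), (X - C y) ∧
      ∀ x ∈ I, (derivative T₁).eval x⁻¹ ≠ 0 ∧
        R₁.eval x⁻¹ + v x * (derivative T₁).eval x⁻¹ = 0 := by
  obtain ⟨c, hc, rfl, rfl⟩ := h.pade hn hR (Λ := locator I) (Ω := evaluator I v)
    (fun i hi => coeff_eq_zero_of_natDegree_lt
      ((natDegree_locator_le I).trans_lt (hI.trans_lt hi)))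
    (fun i hi => coeff_evaluator (hI.trans hi))
    (locator_mul_sub_evaluator hS) (isCoprime_locator h0 hv) (locator_ne_zero I)
  obtain ⟨d, hd, e⟩ := locator_eq h0
  refine ⟨c * d, mul_ne_zero hc hd, ?_, fun x hx => ?_⟩
  · rw [C_mul, mul_assoc, ← e]
  · have hx0 : x ≠ 0 := fun h => h0 (h ▸ hx)
    rw [derivative_C_mul, eval_C_mul, eval_C_mul, eval_derivative_locator hx hx0,
      eval_evaluator hx hx0]
    exact ⟨mul_ne_zero hc (mul_ne_zero (neg_ne_zero.2 hx0) (eval_locator_erase_ne_zero hx0)),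
      by ring⟩

end Sparse

end WordRAM

/-! ### Filling arrays, and removing multiple evaluation points -/

namespace WordRAM
open Cmd Polynomial

/-- For `i = 0, 1, …` below `bd` (with the variable 20 as `i`), store `e` at the index `idx` of the
array `A`. -/
def fill (A : ℕ) (bd idx e : Expr) : Cmd :=
  20 ::= 0 ;; .while (.var 20) bd (.store A idx e ;; 20 ::= .var 20 + 1)

theorem wp_fill {W : ℕ} {ω : Coins} {A : ℕ} {bd idx e : Expr} {σ : Env} (n : ℕ) (f g : ℕ → ℕ)
    (hW : n + 1 < W) (hf : ∀ i < n, ∀ j < n, f i = f j → i = j)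
    (hbd : ∀ i ≤ n, ∀ σ', Frame [20] [A] σ σ' → σ'.var 20 = i → bd.Safe W σ' ∧ bd.val σ' = n)
    (hst : ∀ i < n, ∀ σ', Frame [20] [A] σ σ' → σ'.var 20 = i → idx.Safe W σ' ∧
      idx.val σ' = f i ∧ e.Safe W σ' ∧ e.val σ' = g i) :
    (fill A bd idx e).Wp W ω (fun σ' => Frame [20] [A] σ σ' ∧ (∀ i < n, σ'.mem A (f i) = g i) ∧
      (∀ j, (∀ i < n, f i ≠ j) → σ'.mem A j = σ.mem A j) ∧ σ'.draws = σ.draws ∧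
      σ'.time ≤ σ.time + (n + 1) * (bd.cost + idx.cost + e.cost + 10)) σ := by
  simp only [fill, wp_seq, wp_assign]
  refine ⟨by simp; omega, wp_while_count (fun m σ' => Frame [20] [A] σ σ' ∧ σ'.var 20 = m ∧
    (∀ i < m, σ'.mem A (f i) = g i) ∧
      (∀ j, (∀ i < m, f i ≠ j) → σ'.mem A j = σ.mem A j) ∧ σ'.draws = σ.draws ∧
      σ'.time ≤ σ.time + 2 + m * (bd.cost + idx.cost + e.cost + 10)) 0 n (Nat.zero_le _) ?_ ?_ ?_⟩
  · simp [Frame.refl]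
  · rintro i σ' - hi ⟨hF, h20, h1, h2, hd, ht⟩
    obtain ⟨b1, b2⟩ := hbd i hi.le σ' hF h20
    obtain ⟨c1, c2, c3, c4⟩ := hst i hi (σ'.tick ((Expr.var 20).cost + bd.cost + 1))
      (by simpa using hF) (by simpa using h20)
    simp only [Expr.cost_var] at c1 c2 c3 c4
    refine ⟨by simp, b1, by simp [h20, b2, hi], ?_⟩
    simp only [wp_seq, wp_store, wp_assign]
    refine ⟨c1, c3, by simp [h20]; omega, by simp [hF], by simp [h20], fun j hj => ?_,
      fun j hj => ?_, by simp [hd], ?_⟩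
    · rcases Nat.lt_succ_iff_lt_or_eq.1 hj with hj | rfl
      · have : f j ≠ f i := fun h => by have := hf j (by omega) i hi h; omega
        simp [c2, c4, this, h1 j hj]
      · simp [c2, c4]
    · have : j ≠ f i := fun h => hj i (by omega) h.symm
      simp [c2, c4, this, h2 j (fun i hi => hj i (by omega))]
    · simp [add_mul] at ht ⊢
      omega
  · rintro σ' ⟨hF, h20, h1, h2, hd, ht⟩
    obtain ⟨b1, b2⟩ := hbd n le_rfl σ' hF h20
    refine ⟨by simp, b1, by simp [h20, b2], by simp [hF], by simpa using h1, by simpa using h2,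
      by simp [hd], ?_⟩
    simp [add_mul] at ht ⊢
    omega

/-- Lower the variable 6 to the degree of the polynomial in the array 12. -/
def trim : Cmd := .while (.ld 12 (.var 6)) 1 (6 ::= .var 6 - 1)

theorem wp_trim {W : ℕ} {ω : Coins} {σ : Env} {p n : ℕ} {P : (ZMod p)[X]} (hW : 1 < W)
    (hP : P ≠ 0) (h : Rep (n + 1) (σ.mem 12) P) (v6 : σ.var 6 = n) :
    trim.Wp W ω (fun σ' => Frame [6] [] σ σ' ∧ σ'.var 6 = P.natDegree ∧
      Rep (P.natDegree + 1) (σ'.mem 12) P ∧ σ'.time ≤ σ.time + 20 * n + 20) σ := by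
  refine wp_while (fun σ' => Frame [6] [] σ σ' ∧ σ'.var 6 ≤ n ∧ Rep (σ'.var 6 + 1) (σ'.mem 12) P ∧
    σ'.time + 20 * σ'.var 6 ≤ σ.time + 20 * n) (fun σ' => σ'.var 6) ?_ ?_
  · exact ⟨Frame.refl _ _ _, v6.le, v6 ▸ h, by simp [v6]⟩
  · rintro σ' ⟨hF, h6, hR, ht⟩
    have hd := hR.natDegree_lt hP
    refine ⟨by simp, by simpa using hW, fun hlt => ?_, fun hle => ?_⟩
    · simp only [Expr.val_ld, Expr.val_var, Expr.val_ofNat, Nat.lt_one_iff] at hlt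
      have hc : P.coeff (σ'.var 6) = 0 := by rw [hR.coeff _ (by omega), hlt]; simp
      have hne : σ'.var 6 ≠ P.natDegree := by
        rintro h
        rw [h] at hc
        exact hP (leadingCoeff_eq_zero.1 hc)
      rw [wp_assign]
      have e : σ'.var 6 - 1 + 1 = σ'.var 6 := by omega
      refine ⟨by simp; omega, ⟨by simp [hF], by simp; omega, ?_, ?_⟩, by simp; omega⟩
      · simp only [Env.tick_var, Env.tick_mem, Env.set_mem, Env.set_var, if_true, Expr.val_sub,
          Expr.val_var, Expr.val_ofNat, e]
        exact hR.pop hc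
      · simp; omega
    · simp only [Expr.val_ld, Expr.val_var, Expr.val_ofNat] at hle
      have hlt := hR.lt _ (Nat.lt_succ_self (σ'.var 6))
      have hc : P.coeff (σ'.var 6) ≠ 0 := by
        rw [hR.coeff _ (by omega)]
        intro h0
        rw [ZMod.natCast_eq_zero_iff] at h0
        have := Nat.le_of_dvd (by omega) h0
        omega
      have h6 : σ'.var 6 = P.natDegree := le_antisymm (le_natDegree_of_ne_zero hc) (by omega)
      refine ⟨by simp [hF], by simp [h6], ?_, by simp; omega⟩
      have := h6 ▸ hR
      exact this

/-- Remove from the polynomial in the array 12 its common factor with the linear combination of the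
polynomials in the arrays 13 and 14 given by the variable 8. -/
def peel : Cmd :=
  fill 10 (.var 3) (2 * .var 20 + 1)
    ((.ld 13 (.var 20) + .var 8 * .ld 14 (.var 20)) % .var 2) ;;
  fill 10 (.var 6 + 1) (2 * .var 20) (.ld 12 (.var 20)) ;;
  11 ::= .var 6 + 1 ;;
  12 ::= .var 3 ;;
  13 ::= 0 ;;
  14 ::= .var 6 + 1 ;;
  euclid ;;
  fill 12 (.var 6 + 1) (.var 20) (.ld 11 (2 * .var 20 + (1 - .var 10))) ;;
  trim

/-- The variables that `peel` changes. -/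
abbrev peelVars : List ℕ := [6, 10, 11, 12, 13, 14, 15, 16, 17, 18, 20]

/-- The cost is proportional to s times the current degree d and not to s². This is what allows
charging a round to the d units that it adds to the norm. -/
theorem wp_peel {W : ℕ} {ω : Coins} {σ : Env} {p s d v : ℕ} {Λ Ω V : (ZMod p)[X]}
    (hp : 1 < p) (hW : p * p + p < W) (hs : 5 * s + 5 * d + 20 < W) (v2 : σ.var 2 = p)
    (v3 : σ.var 3 = s) (v6 : σ.var 6 = d) (v8 : σ.var 8 = v) (hv : v < p) (ht : InvTables p σ)
    (hΛ : Λ ≠ 0) (hd : Λ.natDegree = d) (hds : d ≤ s) (rΛ : Rep (d + 1) (σ.mem 12) Λ)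
    (rΩ : Rep s (σ.mem 13) Ω) (rV : Rep s (σ.mem 14) V) :
    peel.Wp W ω (fun σ' => Frame peelVars [10, 11, 12] σ σ' ∧
      (∃ R₀ T₀ T₁ n₀, EuclidInv 0 d Λ (Ω + C (v : ZMod p) * V) R₀ 0 T₀ T₁ n₀ 0 ∧ T₁ ≠ 0 ∧
        T₁.natDegree ≤ d ∧ σ'.var 6 = T₁.natDegree ∧ Rep (T₁.natDegree + 1) (σ'.mem 12) T₁) ∧
      σ'.time ≤ σ.time + 2000 * ((s + 1) * (d + 1))) σ := by
  have hvW : ∀ i < s, v * σ.mem 14 i ≤ (p - 1) * p := fun i hi =>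
    Nat.mul_le_mul (by omega) (rV.lt i hi).le
  have hmul2 : (p - 1) * p + p = p * p := by
    obtain ⟨q, rfl⟩ : ∃ q, p = q + 1 := ⟨p - 1, by omega⟩
    simp; ring
  rw [peel, wp_seq]
  refine (wp_fill s (fun i => 2 * i + 1) (fun i => (σ.mem 13 i + v * σ.mem 14 i) % p) (by omega)
    (fun i _ j _ h => by omega) (fun i hi σ' hF h20 => ?_) (fun i hi σ' hF h20 => ?_)).mono ?_
  · simp [hF.var, v3]
  · have := hvW i hi
    have := rΩ.lt i hi
    simp [hF.var, hF.mem, h20, v8, v2]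
    omega
  rintro σ₁ ⟨F1, a1, -, -, t1⟩
  rw [wp_seq]
  refine (wp_fill (d + 1) (fun i => 2 * i) (fun i => σ.mem 12 i) (by omega)
    (fun i _ j _ h => by omega) (fun i hi σ' hF h20 => ?_) (fun i hi σ' hF h20 => ?_)).mono ?_
  · simp [hF.var, F1.var, v6]
    omega
  · simp [hF.var, hF.mem, F1.mem, h20]; omega
  rintro σ₂ ⟨F2, a2, a3, -, t2⟩
  have F2' : Frame [20] [10] σ σ₂ := F1.trans F2
  simp only [wp_seq, wp_assign]
  refine ⟨by simp [F2'.var, v6]; omega, by simp, by simp; omega, by simp [F2'.var, v6]; omega, ?_⟩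
  refine (wp_euclid (p := p) (θ := 0) (N := d) (K := s + d + 1) (n₁ := s) (M := Λ)
    (Y := Ω + C (v : ZMod p) * V) hp hW (by omega) (by simp [F2'.var, v2]) (by simp [F2'.var, v6])
    (by simp) (by simp [F2'.var, v6]) (by simp [F2'.var, v3])
    (by exact ht.frame (vs := 11 :: 12 :: 13 :: 14 :: [20]) (as := [10])
          (by simp; exact F2'.weaken (by simp) (by simp)) (by simp) (by simp))
    (rΛ.congr fun i hi => by simpa using a2 i hi) ?_ (by omega) (by omega) (by omega)).mono ?_
  · refine ⟨fun i hi => ?_, fun i hi => ?_, fun i hi => ?_⟩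
    · simp only [Env.tick_mem, Env.set_mem]
      rw [a3 _ (by omega), a1 i hi]
      exact Nat.mod_lt _ (by omega)
    · simp only [Env.tick_mem, Env.set_mem]
      rw [a3 _ (by omega), a1 i hi, coeff_add, coeff_C_mul, rΩ.coeff i hi, rV.coeff i hi]
      simp
    · rw [coeff_add, coeff_C_mul, rΩ.deg i hi, rV.deg i hi]
      simp
  rintro σ₃ ⟨F3, ⟨b, m₀, m₁, R₀, R₁, T₀, T₁, hE, hm⟩, t3⟩
  have F3' : Frame [10, 11, 12, 13, 14, 15, 16, 17, 18, 20] [10, 11] σ σ₃ := by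
    refine Frame.trans (σ := σ₂) (F2'.weaken (by simp) (by simp)) ?_
    refine Frame.trans ?_ (F3.weaken (by simp) (by simp))
    simp [Frame.refl]
  obtain rfl : m₁ = 0 := by omega
  obtain rfl : R₁ = 0 := by ext i; rw [hE.rep1.deg i (Nat.zero_le _), coeff_zero]
  have hT : T₁ ≠ 0 := by
    rintro rfl
    rcases hE.inv.det with h | h <;> simp at h
    exacts [hΛ h.symm, hΛ h]
  have hTd : T₁.natDegree ≤ d := by
    have := hE.cof1.natDegree_lt hT
    omega
  have hb := hE.b_le
  rw [wp_seq]
  refine (wp_fill (d + 1) (fun i => i) (fun i => σ₃.mem 11 (2 * i + (1 - b))) (by omega)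
    (fun i _ j _ h => by omega) (fun i hi σ' hF h20 => ?_) (fun i hi σ' hF h20 => ?_)).mono ?_
  · simp [hF.var, F3'.var, v6]; omega
  · simp [hF.var, hF.mem, h20, hE.var10]; omega
  rintro σ₄ ⟨F4, a4, -, -, t4⟩
  refine (wp_trim (p := p) (n := d) (P := T₁) (by omega) hT (hE.cof1.congr fun i hi => a4 i hi)
    (by simp [F4.var, F3'.var, v6])).mono ?_
  rintro σ₅ ⟨F5, h6, hR, t5⟩
  refine ⟨?_, ⟨R₀, T₀, T₁, m₀, hE.inv, hT, hTd, h6, hR⟩, ?_⟩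
  · refine Frame.trans (F3'.weaken (by simp [peelVars]) (by simp)) ?_
    exact Frame.trans (F4.weaken (by simp [peelVars]) (by simp))
      (F5.weaken (by simp [peelVars]) (by simp))
  · have h1 : (2 * (d + 1 + s) + 2) * (100 * (d + 1) + 200) ≤ (4 * (s + 1)) * (300 * (d + 1)) :=
      Nat.mul_le_mul (by omega) (by omega)
    have h2 : (4 * (s + 1)) * (300 * (d + 1)) = 1200 * ((s + 1) * (d + 1)) := by ring
    have h3 : s + 1 ≤ (s + 1) * (d + 1) := Nat.le_mul_of_pos_right _ (by omega)
    have h4 : d + 1 ≤ (s + 1) * (d + 1) := Nat.le_mul_of_pos_left _ (by omega)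
    simp at t1 t2 t3 t4 t5
    omega

end WordRAM

/-! ### Summing absolute values level by level -/

namespace WordRAM
open Cmd Polynomial

theorem natAbs_valMinAbs_eq_iff {p : ℕ} [NeZero p] {r : ℕ} (hr : 2 * r < p) (a : ZMod p) :
    a.valMinAbs.natAbs = r ↔ a = r ∨ a = -r := by
  constructor
  · rintro rfl
    rcases Int.natAbs_eq a.valMinAbs with h | h
    · left
      rw [← Int.cast_natCast, ← h, ZMod.coe_valMinAbs]
    · right
      rw [← Int.cast_natCast, ← Int.cast_neg, ← h, ZMod.coe_valMinAbs]
  · rintro (rfl | rfl)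
    · rw [ZMod.valMinAbs_natCast_of_le_half (by omega)]; simp
    · rw [ZMod.natAbs_valMinAbs_neg, ZMod.valMinAbs_natCast_of_le_half (by omega)]; simp

/-- `Ω / V` takes the value `- val y` at each point `y` of `J`. -/
def Interpolates {p : ℕ} (Ω V : (ZMod p)[X]) (J : Finset (ZMod p)) (val : ZMod p → ZMod p) : Prop :=
  ∀ y ∈ J, V.eval y ≠ 0 ∧ Ω.eval y + val y * V.eval y = 0

/-- On J the combination Ω + cV takes the value (c - val y) V(y), and V(y) ≠ 0. -/
theorem Interpolates.eval_eq_zero_iff {p : ℕ} [Fact p.Prime] {Ω V : (ZMod p)[X]}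
    {J : Finset (ZMod p)} {val : ZMod p → ZMod p} (h : Interpolates Ω V J val) (c : ZMod p)
    {y : ZMod p} (hy : y ∈ J) : (Ω + C c * V).eval y = 0 ↔ val y = c := by
  obtain ⟨h1, h2⟩ := h y hy
  rw [eval_add, eval_mul, eval_C, eq_neg_of_add_eq_zero_left h2, neg_add_eq_sub, ← sub_mul,
    mul_eq_zero, or_iff_left h1, sub_eq_zero, eq_comm]

/-- Remove the values `r, -r` for `r = 1, 2, …`, adding up the numbers of remaining roots. -/
def drain : Cmd :=
  .while 0 (.var 6)
    (0 ::= .var 0 + .var 6 ;;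
      .ite (.var 1) (.var 0) (6 ::= 0 ;; 5 ::= .var 4)
        (8 ::= .var 7 ;; peel ;; 8 ::= .var 2 - .var 7 ;; peel ;; 7 ::= .var 7 + 1))

/-- The `ℓ₁` norm of the values at the points of `J`. -/
def mass {p : ℕ} (J : Finset (ZMod p)) (val : ZMod p → ZMod p) : ℕ :=
  ∑ y ∈ J, (val y).valMinAbs.natAbs

/-- The set of points with values of size at least `r`. -/
def level {p : ℕ} (J : Finset (ZMod p)) (val : ZMod p → ZMod p) (r : ℕ) : Finset (ZMod p) :=
  J.filter fun y => r ≤ (val y).valMinAbs.natAbs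

/-- Layer-cake summation: raising the cut-off by one adds one for every point that is still larger.
This number is the degree that `drain` adds in a round. -/
theorem sum_min_add_card_level {p : ℕ} (J : Finset (ZMod p)) (val : ZMod p → ZMod p) (r : ℕ) :
    ∑ y ∈ J, min (val y).valMinAbs.natAbs r + (level J val (r + 1)).card =
      ∑ y ∈ J, min (val y).valMinAbs.natAbs (r + 1) := by
  rw [level, Finset.card_filter, ← Finset.sum_add_distrib]
  refine Finset.sum_congr rfl fun y _ => ?_
  split_ifs <;> omega

theorem natDegree_C_mul_prod {F : Type*} [Field F] {c : F} (hc : c ≠ 0) (J : Finset F) :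
    (C c * ∏ y ∈ J, (X - C y)).natDegree = J.card := by
  rw [natDegree_C_mul hc, natDegree_prod_of_monic _ _ fun y _ => monic_X_sub_C y]
  simp

/-- The state of `drain`, started in `σ₀`. -/
structure DrainState {p : ℕ} (s k : ℕ) (Ω V : (ZMod p)[X]) (Λ₀ : (ZMod p)[X])
    (σ₀ σ : Env) (Λ : (ZMod p)[X]) :
    Prop where
  ne : Λ ≠ 0
  deg : Λ.natDegree = σ.var 6
  deg_le : σ.var 6 ≤ s
  rep : Rep (σ.var 6 + 1) (σ.mem 12) Λ
  acc_le : σ.var 0 ≤ k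
  j_eq : σ.var 5 = σ₀.var 5
  pos : 0 < σ.var 7
  -- Each round adds at least one to the total, so r cannot outrun it; whenever ±r is removed, this
  -- gives r ≤ k and hence 2r < p.
  r_le : σ.var 7 ≤ σ.var 0 + 1
  -- Conditional on purpose: for arbitrary counters nothing is known about the roots, but the loop
  -- must still stop in time.
  good : ∀ J val, Interpolates Ω V J val → level J val 1 = J →
    (∃ c, c ≠ 0 ∧ Λ₀ = C c * ∏ y ∈ J, (X - C y)) →
    (∃ c, c ≠ 0 ∧ Λ = C c * ∏ y ∈ level J val (σ.var 7), (X - C y)) ∧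
      σ.var 0 = σ₀.var 0 + ∑ y ∈ J, min (val y).valMinAbs.natAbs (σ.var 7 - 1)

/-- Peeling off the values `r` and `-r`. -/
theorem level_succ {p : ℕ} [Fact p.Prime] {Ω V Λ R T T₁ R' T' T₁' : (ZMod p)[X]} {c : ZMod p}
    {J : Finset (ZMod p)} {val : ZMod p → ZMod p} {r d d' n₀ n₁ m₀ m₁ : ℕ} (hr : 2 * r < p)
    (hI : Interpolates Ω V J val) (hc : c ≠ 0)
    (hΛ : Λ = C c * ∏ y ∈ level J val r, (X - C y))
    (h1 : EuclidInv 0 d Λ (Ω + C (r : ZMod p) * V) R 0 T T₁ n₀ n₁)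
    (h2 : EuclidInv 0 d' T₁ (Ω + C (((p - r : ℕ) : ZMod p)) * V) R' 0 T' T₁' m₀ m₁) :
    ∃ c, c ≠ 0 ∧ T₁' = C c * ∏ y ∈ level J val (r + 1), (X - C y) := by
  subst hΛ
  obtain ⟨c', hc', rfl⟩ := h1.peel hc
  obtain ⟨c'', hc'', e⟩ := h2.peel hc'
  refine ⟨c'', hc'', ?_⟩
  rw [e]
  congr 2
  ext y
  have hJ := fun (c : ZMod p) (hy : y ∈ J) => hI.eval_eq_zero_iff c hy
  simp only [level, Finset.mem_filter]
  have := natAbs_valMinAbs_eq_iff hr (val y)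
  constructor
  · rintro ⟨⟨⟨h1, h2⟩, h3⟩, h4⟩
    refine ⟨h1, lt_of_le_of_ne h2 fun h => ?_⟩
    rw [ne_eq, hJ _ h1] at h3 h4
    rcases this.1 h.symm with h | h
    · exact h3 h
    · refine h4 ?_
      rw [h, Nat.cast_sub (by omega)]; simp
  · rintro ⟨h1, h2⟩
    rw [ne_eq, ne_eq, hJ _ h1, hJ _ h1]
    refine ⟨⟨⟨h1, by omega⟩, fun h => ?_⟩, fun h => ?_⟩
    · have := this.2 (Or.inl h); omega
    · rw [Nat.cast_sub (by omega)] at h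
      have := this.2 (Or.inr (by simpa using h)); omega

/-- The variables that `drain` changes. -/
abbrev drainVars : List ℕ := [0, 5, 6, 7, 8, 10, 11, 12, 13, 14, 15, 16, 17, 18, 20]

/-- A round at degree d ≥ 1 runs two peelings of cost at most 2000 (s + 1)(d + 1) ≤ 4000 (s + 1) d
each and adds d to the total, so time is measured by the growth of the total. When the total exceeds
k the degree is set to 0 and the bucket index to B, which stops this loop and the outer one; the
last increment is at most s, whence the bound k + s. -/
theorem wp_drain {W : ℕ} {ω : Coins} {σ : Env} {p s k B : ℕ} [Fact p.Prime] {Ω V : (ZMod p)[X]}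
    (hW : p * p + p < W) (hs : 10 * s + 20 < W) (hk : 2 * k + 2 < p) (hks : k + s < W)
    (v1 : σ.var 1 = k) (v2 : σ.var 2 = p) (v3 : σ.var 3 = s) (v4 : σ.var 4 = B)
    (v7 : σ.var 7 = 1) (h0 : σ.var 0 ≤ k) (h6 : σ.var 6 ≤ s) (ht : InvTables p σ)
    {Λ : (ZMod p)[X]} (hΛ : Λ ≠ 0) (hd : Λ.natDegree = σ.var 6)
    (rΛ : Rep (σ.var 6 + 1) (σ.mem 12) Λ)
    (rΩ : Rep s (σ.mem 13) Ω) (rV : Rep s (σ.mem 14) V) :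
    drain.Wp W ω (fun σ' => Frame drainVars [10, 11, 12] σ σ' ∧
      σ.var 0 ≤ σ'.var 0 ∧ σ'.var 0 ≤ k + s ∧
      (k < σ'.var 0 → σ'.var 5 = B) ∧ (σ'.var 0 ≤ k → σ'.var 5 = σ.var 5) ∧
      (∀ J val, Interpolates Ω V J val → level J val 1 = J →
        (∃ c, c ≠ 0 ∧ Λ = C c * ∏ y ∈ J, (X - C y)) → σ.var 0 + mass J val ≤ k →
        σ'.var 0 = σ.var 0 + mass J val) ∧
      σ'.time ≤ σ.time + 9000 * (s + 1) * (σ'.var 0 - σ.var 0) + 20) σ := by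
  have hp := (Fact.out : p.Prime).one_lt
  refine wp_while (fun σ' => Frame drainVars [10, 11, 12] σ σ' ∧ σ.var 0 ≤ σ'.var 0 ∧
    σ'.var 0 ≤ k + s ∧ σ'.time ≤ σ.time + 9000 * (s + 1) * (σ'.var 0 - σ.var 0) ∧
    ((∃ Λ', DrainState s k Ω V Λ σ σ' Λ') ∨ (σ'.var 6 = 0 ∧ σ'.var 5 = B ∧ k < σ'.var 0 ∧
      ∀ J val, Interpolates Ω V J val → level J val 1 = J →
        (∃ c, c ≠ 0 ∧ Λ = C c * ∏ y ∈ J, (X - C y)) → k < σ.var 0 + mass J val)))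
    (fun σ' => k + 1 - σ'.var 0) ?_ ?_
  · refine ⟨Frame.refl _ _ _, le_rfl, by omega, by simp, Or.inl ⟨Λ, hΛ, hd, h6, rΛ, h0, rfl,
      by omega, by omega, fun J val _ h1 hJ => ⟨by rw [v7, h1]; exact hJ, by simp [v7]⟩⟩⟩
  rintro σ₁ ⟨F1, ha, ha', hT, hS⟩
  have e1 : σ₁.var 1 = k := by rw [F1.var 1 (by simp), v1]
  have e2 : σ₁.var 2 = p := by rw [F1.var 2 (by simp), v2]
  have e3 : σ₁.var 3 = s := by rw [F1.var 3 (by simp), v3]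
  have e4 : σ₁.var 4 = B := by rw [F1.var 4 (by simp), v4]
  refine ⟨by simp; omega, by simp, fun hlt => ?_, fun hle => ?_⟩
  · simp only [Expr.val_var, Expr.val_ofNat] at hlt
    obtain ⟨Λ', hD⟩ | hS := hS
    swap
    · omega
    have hacc := hD.acc_le
    have hdeg := hD.deg_le
    have tm : 9000 * (s + 1) * (σ₁.var 0 + σ₁.var 6 - σ.var 0) =
        9000 * (s + 1) * (σ₁.var 0 - σ.var 0) + 9000 * ((s + 1) * σ₁.var 6) := by
      rw [show σ₁.var 0 + σ₁.var 6 - σ.var 0 = (σ₁.var 0 - σ.var 0) + σ₁.var 6 by omega]; ring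
    have tm' : s + 1 ≤ (s + 1) * σ₁.var 6 := Nat.le_mul_of_pos_right _ hlt
    simp only [wp_seq, wp_assign, wp_ite]
    refine ⟨by simp; omega, by simp, by simp, fun hgt => ?_, fun hle => ?_⟩
    · simp [e1] at hgt
      refine ⟨by simp; omega, by simp, ⟨by simp [F1], by simp; omega, by simp; omega,
        ?_, Or.inr ⟨by simp, by simp [e4], by simpa using hgt, fun J val hI h1 hJ => ?_⟩⟩,
        by simp; omega⟩
      · simp only [Env.tick_time, Env.set_time, Env.tick_var, Env.set_var, if_true, Expr.val_add,
          Expr.val_var, Expr.cost_var, Expr.cost_add, Expr.cost_ofNat, tm, reduceCtorEq, if_false,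
          OfNat.zero_ne_ofNat]
        omega
      -- The total is the initial one plus the sizes cut off at r, a lower bound for the true norm;
      -- exceeding k it refutes the promise.
      · obtain ⟨⟨c, hc, e⟩, e'⟩ := hD.good J val hI h1 hJ
        have hcard := hD.deg
        rw [e, natDegree_C_mul_prod hc] at hcard
        have := sum_min_add_card_level J val (σ₁.var 7 - 1)
        rw [Nat.sub_add_cancel hD.pos] at this
        have h2 : ∑ y ∈ J, min (val y).valMinAbs.natAbs (σ₁.var 7) ≤ mass J val :=
          Finset.sum_le_sum fun y _ => min_le_left _ _
        omega
    · simp [e1] at hle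
      have hr := hD.r_le
      have hpos := hD.pos
      refine ⟨by simp, ?_⟩
      refine (wp_peel (p := p) (s := s) (d := σ₁.var 6) (v := σ₁.var 7) (Λ := Λ') (Ω := Ω) (V := V)
        hp hW (by omega) (by simp [e2]) (by simp [e3]) (by simp) (by simp) (by omega)
        (by simpa using ht.frame F1 (by simp) (by simp))
        hD.ne hD.deg hdeg (by exact hD.rep) (by exact rΩ.congr (by simp [F1.mem]))
        (by exact rV.congr (by simp [F1.mem]))).mono ?_
      rintro σ₂ ⟨F2, ⟨R, T, T₁, n₀, hE, hT1, hTd, h26, hR2⟩, t2⟩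
      have F2'' : Frame drainVars [10, 11, 12] σ σ₂ := by
        refine Frame.trans ?_ (F2.weaken (by simp) (by simp))
        simp [F1]
      have f0 : σ₂.var 0 = σ₁.var 0 + σ₁.var 6 := by
        rw [F2.var 0 (by simp)]; simp
      have f7 : σ₂.var 7 = σ₁.var 7 := by
        rw [F2.var 7 (by simp)]; simp
      have f5 : σ₂.var 5 = σ₁.var 5 := by
        rw [F2.var 5 (by simp)]; simp
      have f2 : σ₂.var 2 = p := by rw [F2''.var 2 (by simp), v2]
      have f3 : σ₂.var 3 = s := by rw [F2''.var 3 (by simp), v3]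
      rw [wp_seq, wp_assign]
      refine ⟨by simp [f2, f7]; omega, ?_⟩
      rw [wp_seq]
      refine (wp_peel (p := p) (s := s) (d := σ₂.var 6) (v := p - σ₁.var 7) (Λ := T₁) (Ω := Ω)
        (V := V) hp hW (by omega) (by simp [f2]) (by simp [f3]) (by simp) (by simp [f2, f7])
        (by omega) (by simpa using ht.frame F2'' (by simp) (by simp)) hT1 h26.symm (by omega)
        (by rw [h26]; exact hR2) (by exact rΩ.congr (by simp [F2''.mem]))
        (by exact rV.congr (by simp [F2''.mem]))).mono ?_
      rintro σ₃ ⟨F3, ⟨R', T', T₁', n₀', hE', hT1', hTd', h36, hR3⟩, t3⟩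
      have F3' : Frame drainVars [10, 11, 12] σ σ₃ := by
        refine Frame.trans ?_ (F3.weaken (by simp) (by simp))
        simp [F2'']
      have g0 : σ₃.var 0 = σ₁.var 0 + σ₁.var 6 := by
        rw [F3.var 0 (by simp)]; simpa using f0
      have g7 : σ₃.var 7 = σ₁.var 7 := by
        rw [F3.var 7 (by simp)]; simpa using f7
      have g5 : σ₃.var 5 = σ₁.var 5 := by
        rw [F3.var 5 (by simp)]; simpa using f5
      rw [wp_assign]
      refine ⟨by simp [g7]; omega, ⟨by simp [F3'], by simp [g0]; omega,
        by simp [g0]; omega, ?_, Or.inl ⟨T₁', hT1', by simp [h36], by simp [h36]; omega,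
        by simpa [h36] using hR3, by simpa [g0] using hle, by simpa [g5] using hD.j_eq, by simp,
        by simp [g0, g7]; omega, fun J val hI h1 hJ => ?_⟩⟩, by simp [g0]; omega⟩
      · have q1 : (s + 1) * (σ₁.var 6 + 1) = (s + 1) * σ₁.var 6 + (s + 1) := by ring
        have q2 : (s + 1) * (σ₂.var 6 + 1) ≤ (s + 1) * (σ₁.var 6 + 1) :=
          Nat.mul_le_mul_left _ (by omega)
        simp at t2 t3
        simp [g0, tm]
        omega
      · obtain ⟨⟨c, hc, e⟩, e'⟩ := hD.good J val hI h1 hJ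
        have hcard := hD.deg
        rw [e, natDegree_C_mul_prod hc] at hcard
        have := sum_min_add_card_level J val (σ₁.var 7 - 1)
        rw [Nat.sub_add_cancel hD.pos] at this
        have key := level_succ (by omega) hI hc e hE hE'
        constructor
        · simpa [g7] using key
        · simp [g0, g7]
          omega
  · simp only [Expr.val_var, Expr.val_ofNat, Nat.le_zero] at hle
    refine ⟨by simp [F1], by simpa using ha, by simpa using ha', ?_⟩
    simp only [Env.tick_var, Env.tick_time, Expr.cost_ofNat, Expr.cost_var]
    rcases hS with ⟨Λ', hD⟩ | ⟨-, hS2, hS3, hS4⟩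
    · refine ⟨fun h => absurd hD.acc_le h.not_ge, fun _ => hD.j_eq, fun J val hI h1 hJ _ => ?_,
        by omega⟩
      obtain ⟨⟨c, hc, e⟩, e'⟩ := hD.good J val hI h1 hJ
      have hcard := hD.deg
      rw [e, natDegree_C_mul_prod hc, hle, Finset.card_eq_zero] at hcard
      rw [e', mass]
      congr 1
      -- Degree zero means that no point of size at least r is left, so the cut-off at r - 1 is
      -- inactive.
      refine Finset.sum_congr rfl fun y hy => min_eq_left ?_
      by_contra hlt
      have : y ∈ level J val (σ₁.var 7) := Finset.mem_filter.2 ⟨hy, by omega⟩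
      simp [hcard] at this
    · exact ⟨fun _ => hS2, fun h => absurd h hS3.not_ge,
        fun J val hI h1 hJ hm => absurd hm (hS4 J val hI h1 hJ).not_ge, by omega⟩

end WordRAM

/-! ### Decoding a bucket -/

namespace WordRAM
open Cmd Polynomial

/-- Compute a locator polynomial (array 12), an evaluator polynomial (array 13), and the derivative
of the locator (array 14) from the power sums in the bucket given by the variable 5. -/
def decode : Cmd :=
  21 ::= 2 * .var 3 ;;
  fill 10 (.var 21) (2 * .var 20) 0 ;;
  fill 10 (.var 21) (2 * .var 20 + 1) (.ld 5 (.var 5 * .var 21 + .var 20)) ;;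
  .store 10 (2 * .var 21) 1 ;;
  11 ::= .var 21 + 1 ;;
  12 ::= .var 21 ;;
  13 ::= .var 3 ;;
  14 ::= .var 21 + 1 ;;
  euclid ;;
  fill 12 (.var 3 + 1) (.var 20) (.ld 11 (2 * .var 20 + (1 - .var 10))) ;;
  fill 13 (.var 3) (.var 20) 0 ;;
  fill 13 (.var 12) (.var 20) (.ld 10 (2 * .var 20 + (1 - .var 10))) ;;
  fill 14 (.var 3) (.var 20) (((.var 20 + 1) * .ld 12 (.var 20 + 1)) % .var 2) ;;
  6 ::= .var 3 ;;
  trim ;;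
  7 ::= 1

/-- The variables that `decode` changes. -/
abbrev decodeVars : List ℕ := [6, 7, 10, 11, 12, 13, 14, 15, 16, 17, 18, 20, 21]

/-- The cells `a, …, a + 2 s - 1` of `X` hold the power sums of an `s`-sparse vector of norm `m`. -/
def BucketMass (p s : ℕ) (X : ℕ → ℕ) (a m : ℕ) : Prop :=
  ∃ (I : Finset (ZMod p)) (v : ZMod p → ZMod p), 0 ∉ I ∧ (∀ x ∈ I, v x ≠ 0) ∧ I.card ≤ s ∧
    (∀ i < 2 * s, (X (a + i) : ZMod p) = ∑ x ∈ I, v x * x ^ (i + 1)) ∧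
    m = ∑ x ∈ I, (v x).valMinAbs.natAbs

/-- Holds without any sparse solution: if T₁ = 0, then X^(2θ) divides R₁, which is too short, so R₁
= 0 and the determinant vanishes. `trim` needs this in order to stop. -/
theorem EuclidInv.cofactor_ne_zero {F : Type*} [Field F] {θ : ℕ} {S R₀ R₁ T₀ T₁ : F[X]}
    {n₀ n₁ : ℕ} (h : EuclidInv θ (2 * θ) (X ^ (2 * θ)) S R₀ R₁ T₀ T₁ n₀ n₁) (hn : n₁ ≤ θ)
    (hR : ∀ i, n₁ ≤ i → R₁.coeff i = 0) : T₁ ≠ 0 := by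
  rintro rfl
  have hd := h.dvd₁
  rw [zero_mul, sub_zero] at hd
  have h0 : R₁ = 0 := by
    ext i
    rcases lt_or_ge i (2 * θ) with hi | hi
    · rw [X_pow_dvd_iff.1 hd i hi, coeff_zero]
    · rw [hR i (by omega), coeff_zero]
  have hX : (X : F[X]) ^ (2 * θ) ≠ 0 := pow_ne_zero _ X_ne_zero
  rcases h.det with h | h
  · exact hX (by rw [← h, h0]; ring)
  · exact hX (neg_eq_zero.1 (by rw [← h, h0]; ring))

/-- The three polynomials are fixed before I and v. Whatever the counters are, the arrays hold
polynomials of the stated lengths; if a sparse solution exists, they are its locator, evaluator and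
locator derivative up to one common scalar. -/
theorem wp_decode {W : ℕ} {ω : Coins} {σ : Env} {p s j : ℕ} [Fact p.Prime]
    (hW : p * p + p < W) (hs : 20 * s + 20 < W) (hs0 : 0 < s) (hsp : s ≤ p)
    (hj : j * (2 * s) + 2 * s < W)
    (v2 : σ.var 2 = p) (v3 : σ.var 3 = s) (v5 : σ.var 5 = j) (ht : InvTables p σ)
    (hX : ∀ i < 2 * s, σ.mem 5 (j * (2 * s) + i) < p) :
    decode.Wp W ω (fun σ' => Frame decodeVars [10, 11, 12, 13, 14] σ σ' ∧
      (∃ Λ Ω V : (ZMod p)[X], Λ ≠ 0 ∧ Λ.natDegree = σ'.var 6 ∧ σ'.var 6 ≤ s ∧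
        Rep (σ'.var 6 + 1) (σ'.mem 12) Λ ∧ Rep s (σ'.mem 13) Ω ∧ Rep s (σ'.mem 14) V ∧
        ∀ (I : Finset (ZMod p)) (v : ZMod p → ZMod p), 0 ∉ I → (∀ x ∈ I, v x ≠ 0) → I.card ≤ s →
          (∀ i < 2 * s, (σ.mem 5 (j * (2 * s) + i) : ZMod p) = ∑ x ∈ I, v x * x ^ (i + 1)) →
          (∃ c, c ≠ 0 ∧ Λ = C c * ∏ y ∈ I.image (·⁻¹), (X - C y)) ∧
          Interpolates Ω V (I.image (·⁻¹)) (fun y => v y⁻¹)) ∧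
      σ'.var 7 = 1 ∧
      σ'.time ≤ σ.time + 5000 * ((s + 1) * (s + 1))) σ := by
  have hp := (Fact.out : p.Prime).one_lt
  rw [decode, wp_seq, wp_assign]
  refine ⟨by simp [v3]; omega, ?_⟩
  rw [wp_seq]
  refine (wp_fill (2 * s) (fun i => 2 * i) (fun i => 0) (by omega)
    (fun i _ j _ h => by omega) (fun i hi σ' hF h20 => ?_) (fun i hi σ' hF h20 => ?_)).mono ?_
  · simp [hF.var, v3]
  · simp [hF.var, h20]; omega
  rintro σ₁ ⟨F1, a1, -, -, t1⟩
  have F1' : Frame [20, 21] [10] σ σ₁ := by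
    refine Frame.trans ?_ (F1.weaken (by simp) (by simp))
    simp [Frame.refl]
  have f21 : σ₁.var 21 = 2 * s := by rw [F1.var 21 (by simp)]; simp [v3]
  rw [wp_seq]
  refine (wp_fill (2 * s) (fun i => 2 * i + 1) (fun i => σ.mem 5 (j * (2 * s) + i)) (by omega)
    (fun i _ j _ h => by omega) (fun i hi σ' hF h20 => ?_) (fun i hi σ' hF h20 => ?_)).mono ?_
  · simp [hF.var, f21]
  · simp [hF.var, hF.mem, F1'.mem, F1'.var, f21, h20, v5]; omega
  rintro σ₂ ⟨F2, a2, b2, -, t2⟩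
  have F2' : Frame [20, 21] [10] σ σ₂ := F1'.trans (F2.weaken (by simp) (by simp))
  have g21 : σ₂.var 21 = 2 * s := by rw [F2.var 21 (by simp)]; exact f21
  simp only [wp_seq, wp_store, wp_assign]
  refine ⟨by simp [g21]; omega, by simp; omega, by simp [g21]; omega, by simp,
    by simp, by simp [g21]; omega, ?_⟩
  obtain ⟨S, hS⟩ := Rep.exists (p := p) (2 * s) (fun i => σ.mem 5 (j * (2 * s) + i)) hX
  have F2x : Frame [11, 12, 13, 14, 20, 21] [10] σ σ₂ := F2'.weaken (by simp) (by simp)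
  have hti := fun σ' (h : Frame [11, 12, 13, 14, 20, 21] [10] σ σ') =>
    ht.frame h (by simp) (by simp)
  refine (wp_euclid (p := p) (θ := s) (N := 2 * s) (K := 2 * s + 1) (n₁ := 2 * s)
    (M := X ^ (2 * s)) (Y := S) hp hW (by omega) (by simp [F2'.var, v2]) (by simp [g21])
    (by simp [F2'.var, v3]) (by simp [g21]) (by simp [g21])
    (by exact hti _ (by simpa using F2x)) ?_ ?_ (by omega) (by omega)
    (by omega)).mono ?_
  · refine ⟨fun i hi => ?_, fun i hi => ?_, fun i hi => ?_⟩
    · by_cases h : i = 2 * s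
      · simp [g21, h, hp]
      · have : σ₂.mem 10 (2 * i) = 0 := by rw [b2 _ (by omega), a1 i (by omega)]
        simp [g21, h, this]; omega
    · by_cases h : i = 2 * s
      · simp [g21, h]
      · have : σ₂.mem 10 (2 * i) = 0 := by rw [b2 _ (by omega), a1 i (by omega)]
        simp [g21, h, this, coeff_X_pow]
    · rw [coeff_X_pow, if_neg (by omega)]
  · refine hS.congr fun i hi => ?_
    have : 2 * i + 1 ≠ 2 * (2 * s) := by omega
    simp [g21, this, a2 i hi]
  rintro σ₃ ⟨F3, ⟨b, m₀, m₁, R₀, R₁, T₀, T₁, hE, hm⟩, t3⟩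
  have F3' : Frame decodeVars [10, 11] σ σ₃ := by
    refine Frame.trans (σ := σ₂) (F2'.weaken (by simp) (by simp)) ?_
    refine Frame.trans ?_ (F3.weaken (by simp) (by simp))
    simp [Frame.refl]
  have hT := hE.inv.cofactor_ne_zero hm hE.rep1.deg
  have hl := hE.inv.large
  have hb := hE.b_le
  have k2 : σ₃.var 2 = p := by simp [F3'.var, v2]
  have k3 : σ₃.var 3 = s := by simp [F3'.var, v3]
  rw [wp_seq]
  refine (wp_fill (s + 1) (fun i => i) (fun i => σ₃.mem 11 (2 * i + (1 - b))) (by omega)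
    (fun i _ j _ h => by omega) (fun i hi σ' hF h20 => ?_) (fun i hi σ' hF h20 => ?_)).mono ?_
  · simp [hF.var, k3]; omega
  · simp [hF.var, hF.mem, h20, hE.var10]; omega
  rintro σ₄ ⟨F4, a4, -, -, t4⟩
  have r4 : Rep (s + 1) (σ₄.mem 12) T₁ := by
    refine ⟨fun i hi => ?_, fun i hi => ?_, fun i hi => hE.inv.deg₁ i (by omega)⟩
    · rw [a4 i hi]; exact hE.cof1.lt i (by omega)
    · rw [a4 i hi]; exact hE.cof1.coeff i (by omega)
  rw [wp_seq]
  refine (wp_fill s (fun i => i) (fun i => 0) (by omega)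
    (fun i _ j _ h => by omega) (fun i hi σ' hF h20 => ?_) (fun i hi σ' hF h20 => ?_)).mono ?_
  · simp [hF.var, F4.var, k3]
  · simp [hF.var, h20]; omega
  rintro σ₅ ⟨F5, a5, -, -, t5⟩
  rw [wp_seq]
  refine (wp_fill m₁ (fun i => i) (fun i => σ₃.mem 10 (2 * i + (1 - b))) (by omega)
    (fun i _ j _ h => by omega) (fun i hi σ' hF h20 => ?_) (fun i hi σ' hF h20 => ?_)).mono ?_
  · simp [hF.var, F5.var, F4.var, hE.var12]
  · simp [hF.var, hF.mem, F5.var, F4.var, F5.mem, F4.mem, h20, hE.var10]; omega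
  rintro σ₆ ⟨F6, a6, b6, -, t6⟩
  have r6 : Rep s (σ₆.mem 13) R₁ := by
    refine ⟨fun i hi => ?_, fun i hi => ?_, fun i hi => hE.rep1.deg i (by omega)⟩
    · by_cases h : i < m₁
      · rw [a6 i h]; exact hE.rep1.lt i h
      · rw [b6 i (fun i' hi' => by omega), a5 i hi]; omega
    · by_cases h : i < m₁
      · rw [a6 i h]; exact hE.rep1.coeff i h
      · rw [b6 i (fun i' hi' => by omega), a5 i hi, hE.rep1.deg i (by omega)]; simp
  have F6' : Frame decodeVars [10, 11, 12, 13] σ σ₆ :=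
    (F3'.weaken (by simp) (by simp)).trans <| (F4.weaken (by simp) (by simp)).trans <|
      (F5.weaken (by simp) (by simp)).trans (F6.weaken (by simp) (by simp))
  have r46 : Rep (s + 1) (σ₆.mem 12) T₁ := by
    rw [F6.mem 12 (by simp), F5.mem 12 (by simp)]; exact r4
  have k62 : σ₆.var 2 = p := by simp [F6'.var, v2]
  have k63 : σ₆.var 3 = s := by simp [F6'.var, v3]
  rw [wp_seq]
  refine (wp_fill s (fun i => i) (fun i => (i + 1) * σ₆.mem 12 (i + 1) % p) (by omega)
    (fun i _ j _ h => by omega) (fun i hi σ' hF h20 => ?_) (fun i hi σ' hF h20 => ?_)).mono ?_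
  · simp [hF.var, k63]
  · have h1 := r46.lt (i + 1) (by omega)
    have : (i + 1) * σ₆.mem 12 (i + 1) ≤ p * p := Nat.mul_le_mul (by omega) h1.le
    simp [hF.var, hF.mem, k62, h20]; omega
  rintro σ₇ ⟨F7, a7, -, -, t7⟩
  have r7 : Rep s (σ₇.mem 14) (derivative T₁) := by
    refine ⟨fun i hi => ?_, fun i hi => ?_, fun i hi => ?_⟩
    · rw [a7 i hi]; exact Nat.mod_lt _ (by omega)
    · rw [a7 i hi, coeff_derivative, r46.coeff _ (by omega)]
      simp [mul_comm]
    · rw [coeff_derivative, r46.deg _ (by omega), zero_mul]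
  have F7' : Frame decodeVars [10, 11, 12, 13, 14] σ σ₇ :=
    (F6'.weaken (by simp) (by simp)).trans (F7.weaken (by simp) (by simp))
  have k73 : σ₇.var 3 = s := by simp [F7'.var, v3]
  rw [wp_seq, wp_assign]
  refine ⟨by simp, ?_⟩
  rw [wp_seq]
  refine (wp_trim (p := p) (n := s) (P := T₁) (by omega) hT
    (by simpa [F7.mem] using r46) (by simp [k73])).mono ?_
  rintro σ₈ ⟨F8, h86, hR8, t8⟩
  rw [wp_assign]
  have hTs : T₁.natDegree ≤ s := by have := r46.natDegree_lt hT; omega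
  refine ⟨by simp; omega, ?_, ⟨T₁, R₁, derivative T₁, hT, by simp [h86], by simp [h86, hTs],
    by simpa [h86] using hR8, ?_, ?_, fun I v h0 hv hI hIX => ?_⟩, by simp, ?_⟩
  · have : Frame decodeVars [10, 11, 12, 13, 14] σ σ₈ := by
      refine Frame.trans ?_ (F8.weaken (by simp) (by simp))
      simpa using F7'
    simpa using this
  · simpa [F8.mem, F7.mem] using r6
  · simpa [F8.mem] using r7
  · obtain ⟨c, hc, e, h⟩ := hE.inv.sparse hm hE.rep1.deg h0 hv hI (fun i => by
      split_ifs with h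
      · rw [hS.coeff i h, hIX i h]
      · exact hS.deg i (by omega))
    refine ⟨⟨c, hc, e⟩, fun y hy => ?_⟩
    obtain ⟨x, hx, rfl⟩ := Finset.mem_image.1 hy
    simpa using h x hx
  · have h1 : (2 * (2 * s + 1 + 2 * s) + 2) * (100 * (2 * s + 1) + 200) ≤
        (8 * (s + 1)) * (300 * (s + 1)) := Nat.mul_le_mul (by omega) (by omega)
    have h2 : (8 * (s + 1)) * (300 * (s + 1)) = 2400 * ((s + 1) * (s + 1)) := by ring
    have h3 : s + 1 ≤ (s + 1) * (s + 1) := Nat.le_mul_of_pos_right _ (by omega)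
    simp at t1 t2 t3 t4 t5 t6 t7 t8 ⊢
    omega

end WordRAM

/-! ### The post-processing program -/

namespace WordRAM
open Cmd Polynomial

/-- The post-processing. -/
def post : Cmd :=
  1 ::= .ld 0 0 ;; 2 ::= .ld 0 3 ;; 3 ::= .ld 0 6 ;; 4 ::= .ld 0 5 ;; 0 ::= 0 ;; 5 ::= 0 ;;
  .while (.var 5) (.var 4) (decode ;; drain ;; 5 ::= .var 5 + 1)

/-- The variables that the main loop of `post` changes. -/
abbrev postVars : List ℕ := [0, 5, 6, 7, 8, 10, 11, 12, 13, 14, 15, 16, 17, 18, 20, 21]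

theorem mass_image_inv {p : ℕ} [Fact p.Prime] (I : Finset (ZMod p)) (v : ZMod p → ZMod p) :
    mass (I.image (·⁻¹)) (fun y => v y⁻¹) = ∑ x ∈ I, (v x).valMinAbs.natAbs := by
  rw [mass, Finset.sum_image fun x _ y _ h => inv_injective h]
  simp

theorem level_image_inv {p : ℕ} [Fact p.Prime] {I : Finset (ZMod p)} {v : ZMod p → ZMod p}
    (hv : ∀ x ∈ I, v x ≠ 0) :
    level (I.image (·⁻¹)) (fun y => v y⁻¹) 1 = I.image (·⁻¹) := by
  refine Finset.filter_true_of_mem fun y hy => ?_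
  obtain ⟨x, hx, rfl⟩ := Finset.mem_image.1 hy
  have := hv x hx
  show 1 ≤ (v x⁻¹⁻¹).valMinAbs.natAbs
  rw [inv_inv, Nat.one_le_iff_ne_zero, ne_eq, Int.natAbs_eq_zero, ZMod.valMinAbs_eq_zero]
  exact this

/-- The two terms of the time are O(s²) for each decoding and O(s(k + s)) for all calls of `drain`
together, since the total telescopes over the buckets. -/
theorem wp_post {W : ℕ} {ω : Coins} {σ : Env} {p s k B : ℕ} [Fact p.Prime]
    (hW : p * p + p < W) (hs : 20 * s + 20 < W) (hs0 : 0 < s) (hsp : s ≤ p) (hk : 2 * k + 2 < p)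
    (hks : k + s < W) (hB : B * (2 * s) + B + 1 < W)
    (m0 : σ.mem 0 0 = k) (m3 : σ.mem 0 3 = p) (m6 : σ.mem 0 6 = s) (m5 : σ.mem 0 5 = B)
    (ht : InvTables p σ) (hX : ∀ j < B, ∀ i < 2 * s, σ.mem 5 (j * (2 * s) + i) < p) :
    post.Wp W ω (fun σ' => σ'.time ≤ σ.time +
        10000 * ((B + 1) * ((s + 1) * (s + 1)) + (s + 1) * (k + s)) + 100 ∧
      ∀ m : ℕ → ℕ, (∀ j < B, BucketMass p s (σ.mem 5) (j * (2 * s)) (m j)) →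
        ∑ j ∈ Finset.range B, m j ≤ k → σ'.var 0 = ∑ j ∈ Finset.range B, m j) σ := by
  simp only [post, wp_seq, wp_assign]
  refine ⟨by simp; omega, by simp; omega, by simp; omega, by simp; omega, by simp; omega,
    by simp; omega, ?_⟩
  generalize hσ₀ : ((((((σ.set 1 _).tick _).set 2 _).tick _).set 3 _).tick _) = τ
  simp only [Expr.val_ld, Expr.val_ofNat, Env.tick_mem, Env.set_mem] at hσ₀ ⊢
  have c1 : τ.var 1 = k := by rw [← hσ₀]; simp [m0]
  have c2 : τ.var 2 = p := by rw [← hσ₀]; simp [m3]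
  have c3 : τ.var 3 = s := by rw [← hσ₀]; simp [m6]
  have cm : τ.mem = σ.mem := by rw [← hσ₀]; rfl
  have ct : τ.time = σ.time + 9 := by rw [← hσ₀]; simp
  simp only [cm, m5]
  generalize hσ₁ : ((((((τ.set 4 _).tick _).set 0 _).tick _).set 5 _).tick _) = ρ
  have d1 : ρ.var 1 = k := by rw [← hσ₁]; simp [c1]
  have d2 : ρ.var 2 = p := by rw [← hσ₁]; simp [c2]
  have d3 : ρ.var 3 = s := by rw [← hσ₁]; simp [c3]
  have d4 : ρ.var 4 = B := by rw [← hσ₁]; simp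
  have d5 : ρ.var 5 = 0 := by rw [← hσ₁]; simp
  have d0 : ρ.var 0 = 0 := by rw [← hσ₁]; simp
  have dm : ρ.mem = σ.mem := by rw [← hσ₁, ← cm]; rfl
  have dt : ρ.time ≤ σ.time + 30 := by rw [← hσ₁]; simp [ct]
  have hti : InvTables p ρ := by intro x hx hxp; rw [dm]; exact ht x hx hxp
  refine wp_while (fun σ' => Frame postVars [10, 11, 12, 13, 14] ρ σ' ∧ σ'.var 0 ≤ k + s ∧
    σ'.time ≤ ρ.time + 9000 * (s + 1) * σ'.var 0 + σ'.var 5 * (5000 * ((s + 1) * (s + 1)) + 100) ∧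
    ((σ'.var 0 ≤ k ∧ σ'.var 5 ≤ B ∧ ∀ m : ℕ → ℕ,
      (∀ j < B, BucketMass p s (σ.mem 5) (j * (2 * s)) (m j)) →
        ∑ j ∈ Finset.range B, m j ≤ k → σ'.var 0 = ∑ j ∈ Finset.range (σ'.var 5), m j) ∨
      -- The state after giving up: `drain` leaves the index B, which the loop body increments. A
      -- regular exit has index B.
      (σ'.var 5 = B + 1 ∧ ∀ m : ℕ → ℕ,
        (∀ j < B, BucketMass p s (σ.mem 5) (j * (2 * s)) (m j)) →
          ¬ ∑ j ∈ Finset.range B, m j ≤ k)))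
    (fun σ' => B + 1 - σ'.var 5) ?_ ?_
  · refine ⟨Frame.refl _ _ _, by omega, by omega, Or.inl ⟨by omega, by omega, fun m _ _ => ?_⟩⟩
    simp [d0, d5]
  rintro σ₁ ⟨F1, h0, hT, hS⟩
  have e4 : σ₁.var 4 = B := by rw [F1.var 4 (by simp), d4]
  refine ⟨by simp, by simp, fun hlt => ?_, fun hle => ?_⟩
  · simp only [Expr.val_var, e4] at hlt
    obtain ⟨hS1, hS2, hS3⟩ | hS := hS
    swap
    · omega
    have hjB : (σ₁.var 5 + 1) * (2 * s) ≤ B * (2 * s) := Nat.mul_le_mul_right _ hlt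
    rw [add_one_mul] at hjB
    have m5' : σ₁.mem 5 = σ.mem 5 := by rw [F1.mem 5 (by simp), dm]
    rw [wp_seq]
    refine (wp_decode (p := p) (s := s) (j := σ₁.var 5) hW hs hs0 hsp (by omega)
      (by simp [F1.var, d2]) (by simp [F1.var, d3]) (by simp)
      (by simpa using hti.frame F1 (by simp) (by simp))
      (fun i hi => by simpa [m5'] using hX _ hlt i hi)).mono ?_
    rintro σ₂ ⟨F2, ⟨Λ, Ω, V, hΛ, hdeg, hle, r12, r13, r14, hgood⟩, h7, t2⟩
    have F2' : Frame postVars [10, 11, 12, 13, 14] ρ σ₂ := by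
      refine F1.trans ?_
      simpa using F2.weaken (vs' := postVars) (by simp) (List.Subset.refl _)
    have f0 : σ₂.var 0 = σ₁.var 0 := by simp [F2.var]
    have f5 : σ₂.var 5 = σ₁.var 5 := by simp [F2.var]
    rw [wp_seq]
    refine (wp_drain (p := p) (s := s) (k := k) (B := B) hW (by omega) hk hks
      (by simp [F2'.var, d1]) (by simp [F2'.var, d2]) (by simp [F2'.var, d3])
      (by simp [F2'.var, d4]) h7 (by omega) hle (hti.frame F2' (by simp) (by simp)) hΛ hdeg r12
      r13 r14).mono ?_
    rintro σ₃ ⟨F3, a1, a2, a3, a4, a5, t3⟩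
    have F3' : Frame postVars [10, 11, 12, 13, 14] ρ σ₃ :=
      F2'.trans (F3.weaken (by simp) (by simp))
    have bucket : ∀ m : ℕ → ℕ, (∀ j < B, BucketMass p s (σ.mem 5) (j * (2 * s)) (m j)) →
        ∑ j ∈ Finset.range B, m j ≤ k →
          σ₃.var 0 = ∑ j ∈ Finset.range (σ₁.var 5 + 1), m j ∧ σ₃.var 0 ≤ k := by
      intro m hm hsum
      obtain ⟨I, v, b1, b2, b3, b4, b5⟩ := hm _ hlt
      obtain ⟨g1, g2⟩ := hgood I v b1 b2 b3 (by simpa [m5'] using b4)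
      have hle : ∑ j ∈ Finset.range (σ₁.var 5 + 1), m j ≤ k :=
        (Finset.sum_le_sum_of_subset (Finset.range_mono hlt)).trans hsum
      have hacc := hS3 m hm hsum
      rw [Finset.sum_range_succ, ← hacc, b5, ← mass_image_inv, ← f0] at hle
      have := a5 _ _ g2 (level_image_inv b2) g1 hle
      rw [this, Finset.sum_range_succ, ← hacc, b5, ← mass_image_inv, f0]
      exact ⟨rfl, by omega⟩
    rw [wp_assign]
    have hj3 : σ₃.var 5 = σ₁.var 5 ∨ σ₃.var 5 = B := by
      rcases le_or_gt (σ₃.var 0) k with h | h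
      · left; rw [a4 h, f5]
      · right; exact a3 h
    have hj3' : σ₁.var 5 ≤ σ₃.var 5 := by omega
    refine ⟨by simp; omega, ⟨by simpa using F3', by simpa using a2, ?_, ?_⟩, by simp; omega⟩
    · have h1 : 9000 * (s + 1) * σ₃.var 0 =
          9000 * (s + 1) * σ₁.var 0 + 9000 * (s + 1) * (σ₃.var 0 - σ₂.var 0) := by
        rw [← mul_add]; congr 1; omega
      have h2 := Nat.mul_le_mul_right (5000 * ((s + 1) * (s + 1)) + 100) hj3'
      clear bucket hgood a5
      generalize (s + 1) * (s + 1) = Q at *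
      generalize 9000 * (s + 1) = K at *
      simp [add_one_mul] at t2 ⊢
      rw [h1]
      omega
    · rcases le_or_gt (σ₃.var 0) k with h | h
      · left
        have h5 := a4 h
        refine ⟨by simpa using h, by simp [h5, f5]; omega, fun m hm hsum => ?_⟩
        simpa [h5, f5] using (bucket m hm hsum).1
      · right
        refine ⟨by simp [a3 h], fun m hm hsum => ?_⟩
        have := (bucket m hm hsum).2
        omega
  · simp only [Expr.val_var, e4] at hle
    refine ⟨?_, fun m hm hsum => ?_⟩
    · have h5 : σ₁.var 5 ≤ B + 1 := by omega
      have h1 := Nat.mul_le_mul_right (5000 * ((s + 1) * (s + 1)) + 100) h5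
      have h2 := Nat.mul_le_mul_left (9000 * (s + 1)) h0
      have h3 : (B + 1) * (5000 * ((s + 1) * (s + 1)) + 100) ≤
          10000 * ((B + 1) * ((s + 1) * (s + 1))) := by
        have : 1 ≤ (s + 1) * (s + 1) := Nat.one_le_iff_ne_zero.2 (by positivity)
        calc _ ≤ (B + 1) * (10000 * ((s + 1) * (s + 1))) := Nat.mul_le_mul_left _ (by omega)
          _ = _ := by ring
      have h4 : 9000 * (s + 1) * (k + s) ≤ 10000 * ((s + 1) * (k + s)) := by
        rw [mul_assoc]; exact Nat.mul_le_mul_right _ (by omega)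
      simp
      omega
    · obtain ⟨-, h2, h3⟩ | ⟨-, h⟩ := hS
      · have : σ₁.var 5 = B := by omega
        simpa [this] using h3 m hm hsum
      · exact absurd hsum (h m hm)

end WordRAM

/-! ### A prime in the lower part of `(n, 2n]` -/

namespace WordRAM

/-- The part of a central binomial coefficient coming from primes up to `2 * n / 3`. -/
theorem centralBinom_prod_small_le (n : ℕ) (hn : 0 < n) :
    ∏ p ∈ Finset.range (2 * n / 3 + 1), p ^ n.centralBinom.factorization p ≤
      (2 * n) ^ Nat.sqrt (2 * n) * 4 ^ (2 * n / 3) := by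
  have n2_pos : 1 ≤ 2 * n := by omega
  let S := {p ∈ Finset.range (2 * n / 3 + 1) | Nat.Prime p}
  let f x := x ^ n.centralBinom.factorization x
  have : ∏ x ∈ S, f x = ∏ x ∈ Finset.range (2 * n / 3 + 1), f x := by
    refine Finset.prod_filter_of_ne fun p _ h => ?_
    contrapose h; dsimp only [f]
    rw [Nat.factorization_eq_zero_of_not_prime n.centralBinom h, pow_zero]
  rw [← this, ← Finset.prod_filter_mul_prod_filter_not S (· ≤ Nat.sqrt (2 * n))]
  apply mul_le_mul'
  · refine (Finset.prod_le_prod' fun p _ => (?_ : f p ≤ 2 * n)).trans ?_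
    · exact Nat.pow_factorization_choose_le (mul_pos two_pos hn)
    have : (Finset.Icc 1 (Nat.sqrt (2 * n))).card = Nat.sqrt (2 * n) := by
      rw [Nat.card_Icc, Nat.add_sub_cancel]
    rw [Finset.prod_const]
    refine pow_right_mono₀ n2_pos ((Finset.card_le_card fun x hx => ?_).trans this.le)
    obtain ⟨h1, h2⟩ := Finset.mem_filter.1 hx
    exact Finset.mem_Icc.mpr ⟨(Finset.mem_filter.1 h1).2.one_lt.le, h2⟩
  · refine le_trans ?_ (primorial_le_four_pow (2 * n / 3))
    refine (Finset.prod_le_prod' fun p hp => (?_ : f p ≤ p)).trans ?_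
    · obtain ⟨h1, h2⟩ := Finset.mem_filter.1 hp
      refine (pow_right_mono₀ (Finset.mem_filter.1 h1).2.one_lt.le ?_).trans (pow_one p).le
      exact Nat.factorization_choose_le_one (Nat.sqrt_lt'.mp <| not_le.1 h2)
    refine Finset.prod_le_prod_of_subset_of_one_le' (Finset.filter_subset _ _) ?_
    exact fun p hp _ => (Finset.mem_filter.1 hp).2.one_lt.le

/-- If all primes in `(n, 2 * n]` are among the last `δ` numbers, then the central binomial
coefficient is small. -/
theorem centralBinom_le_of_no_prime {n δ : ℕ} (hn : 2 < n)
    (no_prime : ∀ p : ℕ, p.Prime → n < p → 2 * n < p + δ) :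
    n.centralBinom ≤ (2 * n) ^ Nat.sqrt (2 * n) * 4 ^ (2 * n / 3) * (2 * n) ^ δ := by
  rw [← n.prod_pow_factorization_centralBinom,
    ← Finset.prod_range_mul_prod_Ico _ (show 2 * n / 3 + 1 ≤ 2 * n + 1 by omega)]
  refine Nat.mul_le_mul (centralBinom_prod_small_le n (by omega)) ?_
  rw [← Finset.prod_filter_mul_prod_filter_not _ (fun p => 2 * n < p + δ)]
  -- Below the last δ numbers nothing contributes: primes in (2n/3, n] do not divide the central
  -- binomial coefficient, and by hypothesis there are none beyond n.
  have h1 : ∏ p ∈ Finset.Ico (2 * n / 3 + 1) (2 * n + 1) with ¬ 2 * n < p + δ,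
      p ^ n.centralBinom.factorization p = 1 := by
    refine Finset.prod_eq_one fun x hx => ?_
    simp only [Finset.mem_filter, Finset.mem_Ico] at hx
    by_cases hp : x.Prime
    · have hxn : x ≤ n := by
        by_contra h
        exact hx.2 (no_prime x hp (by omega))
      rw [Nat.factorization_centralBinom_of_two_mul_self_lt_three_mul hn hxn (by omega), pow_zero]
    · rw [Nat.factorization_eq_zero_of_not_prime _ hp, pow_zero]
  rw [h1, mul_one]
  refine (Finset.prod_le_prod' fun p _ =>
    (Nat.pow_factorization_choose_le (by omega) : p ^ n.centralBinom.factorization p ≤ 2 * n)).trans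
      ?_
  rw [Finset.prod_const]
  refine pow_right_mono₀ (by omega) ?_
  calc _ ≤ (Finset.Ioc (2 * n - δ) (2 * n)).card := Finset.card_le_card fun x hx => by
        simp only [Finset.mem_filter, Finset.mem_Ico, Finset.mem_Ioc] at hx ⊢
        omega
    _ ≤ δ := by rw [Nat.card_Ioc]; omega

/-- A prime in the lower part of `(n, 2 * n]`. -/
theorem exists_prime_lt_and_add_le_two_mul : ∃ N : ℕ, ∀ n δ : ℕ, N ≤ n →
    δ * logb 2 (2 * n) ≤ n / 6 → ∃ p : ℕ, p.Prime ∧ n < p ∧ p + δ ≤ 2 * n := by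
  -- Erdős's argument with slack. Taking logarithms in 4^n < n · centralBinom gives 2n < log n +
  -- √(2n) log(2n) + 4n/3 + δ log(2n). The first two terms are o(n), hence at most n/6 for large n,
  -- and so is the last by assumption; the sum 5n/3 is too small.
  have h1 : (fun x : ℝ => logb 2 x + √(2 * x) * logb 2 (2 * x)) =o[atTop] fun x : ℝ => x := by
    have l1 : (fun x : ℝ => log x) =o[atTop] fun x : ℝ => x ^ (1 / 2 : ℝ) :=
      isLittleO_log_rpow_atTop (by norm_num)
    have l2 : (fun x : ℝ => log x) =o[atTop] fun x : ℝ => x := by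
      simpa using isLittleO_log_rpow_atTop (r := 1) (by norm_num)
    have tt : Tendsto (fun x : ℝ => 2 * x) atTop atTop :=
      tendsto_id.const_mul_atTop (by norm_num)
    have l3 : (fun x : ℝ => √(2 * x) * log (2 * x)) =o[atTop] fun x : ℝ => x := by
      have := ((isBigO_refl (fun x : ℝ => x ^ (1 / 2 : ℝ)) atTop).mul_isLittleO l1).comp_tendsto tt
      have e : (fun x : ℝ => x ^ (1 / 2 : ℝ) * x ^ (1 / 2 : ℝ)) ∘ (fun x : ℝ => 2 * x) =ᶠ[atTop]
          fun x => 2 * x := by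
        filter_upwards [eventually_gt_atTop 0] with x hx
        simp only [Function.comp]
        rw [← rpow_add (by positivity)]
        norm_num
      have := (this.congr' (EventuallyEq.refl _ _) e).trans_isBigO
        (isBigO_const_mul_self 2 (fun x : ℝ => x) atTop)
      refine this.congr_left fun x => ?_
      simp [Function.comp, sqrt_eq_rpow]
    have := ((l2.add l3).const_mul_left (1 / log 2))
    refine this.congr_left fun x => ?_
    simp only [logb]
    ring
  obtain ⟨x₀, hx₀⟩ := eventually_atTop.1 (h1.def (show (0 : ℝ) < 1 / 6 by norm_num))
  refine ⟨⌈x₀⌉₊ + 4, fun n δ hn hδ => ?_⟩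
  by_contra! hno
  have hc := centralBinom_le_of_no_prime (n := n) (δ := δ) (by omega) fun p hp hnp => by
    have := hno p hp hnp; omega
  have h4 := Nat.four_pow_lt_mul_centralBinom n (by omega)
  have h5 : 4 ^ n < n * ((2 * n) ^ Nat.sqrt (2 * n) * 4 ^ (2 * n / 3) * (2 * n) ^ δ) :=
    h4.trans_le (Nat.mul_le_mul_left _ hc)
  have hn0 : (0 : ℝ) < n := by exact_mod_cast (by omega : 0 < n)
  have h6 : (4 : ℝ) ^ n < n * ((2 * n) ^ Nat.sqrt (2 * n) * 4 ^ (2 * n / 3) * (2 * n) ^ δ) := by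
    exact_mod_cast h5
  have h7 := logb_lt_logb (b := 2) (by norm_num) (by positivity) h6
  have l4 : logb 2 4 = 2 := by
    rw [show (4 : ℝ) = 2 ^ (2 : ℝ) by norm_num, logb_rpow (by norm_num) (by norm_num)]
  rw [logb_mul (by positivity) (by positivity), logb_mul (by positivity) (by positivity),
    logb_mul (by positivity) (by positivity), logb_pow, logb_pow, logb_pow, logb_pow, l4] at h7
  have h8 := hx₀ n ((Nat.le_ceil _).trans (by exact_mod_cast (by omega : ⌈x₀⌉₊ ≤ n)))
  rw [norm_of_nonneg hn0.le] at h8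
  have h9 := (le_norm_self _).trans h8
  have hl : 0 ≤ logb 2 (2 * (n : ℝ)) :=
    logb_nonneg (by norm_num) (by exact_mod_cast (by omega : 1 ≤ 2 * n))
  have h10 : (Nat.sqrt (2 * n) : ℝ) * logb 2 (2 * n) ≤ √(2 * n) * logb 2 (2 * n) := by
    refine mul_le_mul_of_nonneg_right ?_ hl
    exact_mod_cast Real.nat_sqrt_le_real_sqrt (a := 2 * n)
  have h11 : ((2 * n / 3 : ℕ) : ℝ) ≤ 2 * n / 3 := by
    refine Nat.cast_div_le.trans ?_
    push_cast
    rfl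
  linarith

end WordRAM

/-! ### Bounds on the parameters -/

namespace WordRAM

/-- `Bp` and `Bm` are close upper and lower bounds on the number of buckets. -/
structure BucketBounds (k Bp Bm : ℕ) : Prop where
  le_upper : TLE.buckets k ≤ Bp
  lower_le : Bm ≤ TLE.buckets k
  upper_le : (Bp : ℝ) ≤ 2 * (k / logb 2 k) + 1
  exists_prime : ∃ p : ℕ, p.Prime ∧ 4 * TLE.sparsity k ^ 2 * Bp + 1 ≤ p ∧
    p ≤ 2 * (4 * TLE.sparsity k ^ 2 * Bm + 1)

theorem sparsity_eq (k : ℕ) : TLE.sparsity k = 5 * TLE.logCeil k + 24 := by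
  simp only [TLE.sparsity, TLE.indep]; ring

theorem primeBound_eq (k : ℕ) :
    TLE.primeBound k = 4 * TLE.sparsity k ^ 2 * TLE.buckets k + 1 := by
  rw [TLE.primeBound, sparsity_eq]

theorem one_le_logb {k : ℕ} (hk : 2 ≤ k) : 1 ≤ logb 2 (k : ℝ) := by
  rw [le_logb_iff_rpow_le (by norm_num) (by positivity), rpow_one]
  exact_mod_cast hk

theorem logCeil_le {k : ℕ} (hk : 2 ≤ k) : (TLE.logCeil k : ℝ) ≤ logb 2 k + 1 :=
  (Nat.ceil_lt_add_one (by linarith [one_le_logb hk])).le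

theorem logCeil_eq_clog (k : ℕ) : TLE.logCeil k = Nat.clog 2 k := by
  rw [TLE.logCeil, ← Real.natCeil_logb_natCast, Nat.cast_ofNat]

theorem sparsity_le {k : ℕ} (hk : 2 ≤ k) : (TLE.sparsity k : ℝ) ≤ 34 * logb 2 k := by
  rw [sparsity_eq]
  push_cast
  linarith [logCeil_le hk, one_le_logb hk]

/-- For the small k with hard-wired bucket numbers: without approximation error Bertrand's postulate
suffices. -/
theorem bucketBounds_buckets {k : ℕ} (hk : 2 ≤ k) :
    BucketBounds k (TLE.buckets k) (TLE.buckets k) where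
  le_upper := le_rfl
  lower_le := le_rfl
  upper_le := by
    have h0 : (0 : ℝ) ≤ k / logb 2 k := by have := one_le_logb hk; positivity
    have := (Nat.ceil_lt_add_one h0).le
    rw [TLE.buckets]
    linarith
  exists_prime := by
    obtain ⟨p, h1, h2, h3⟩ := Nat.exists_prime_lt_and_le_two_mul
      (4 * TLE.sparsity k ^ 2 * TLE.buckets k + 1) (by omega)
    exact ⟨p, h1, by omega, h3⟩

theorem logb_bounds_of_pow {k M : ℕ} (hk : 2 ≤ k) (h1 : 2 ^ M ≤ k ^ 64)
    (h2 : k ^ 64 < 2 ^ (M + 1)) : (M : ℝ) ≤ 64 * logb 2 k ∧ 64 * logb 2 k ≤ M + 1 := by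
  have l2 : ∀ n : ℕ, logb 2 ((2 : ℝ) ^ n) = n := fun n => by
    rw [logb_pow, logb_self_eq_one (by norm_num), mul_one]
  have lk : logb 2 ((k : ℝ) ^ 64) = 64 * logb 2 k := by rw [logb_pow]; norm_num
  have hk0 : (0 : ℝ) < k := by positivity
  constructor
  · rw [← lk, ← l2 M]
    exact logb_le_logb_of_le (by norm_num) (by positivity) (by exact_mod_cast h1)
  · rw [← lk, ← Nat.cast_add_one, ← l2 (M + 1)]
    exact logb_le_logb_of_le (by norm_num) (by positivity) (by exact_mod_cast h2.le)

theorem eventually_mul_logb_sq_le (c : ℝ) : ∀ᶠ k : ℕ in atTop, c * logb 2 k ^ 2 ≤ k := by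
  have h : (fun x : ℝ => c * logb 2 x ^ 2) =o[atTop] fun x : ℝ => x := by
    have := (isLittleO_pow_log_id_atTop (n := 2)).const_mul_left (c / log 2 ^ 2)
    refine this.congr_left fun x => ?_
    simp only [logb]
    ring
  have := tendsto_natCast_atTop_atTop.eventually (h.def (show (0 : ℝ) < 1 by norm_num))
  filter_upwards [this] with k hk
  rw [one_mul, norm_of_nonneg (Nat.cast_nonneg k)] at hk
  exact (le_norm_self _).trans hk

theorem natCast_div_le (n d : ℕ) : ((n / d : ℕ) : ℝ) ≤ n / d := Nat.cast_div_le

theorem div_le_natCast_div_add_one (n d : ℕ) : (n : ℝ) / d ≤ (n / d : ℕ) + 1 := by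
  rw [← Nat.floor_div_eq_div (K := ℝ)]
  exact (Nat.lt_floor_add_one _).le

/-- Here M = ⌊64 log k⌋. Put n = 4s²Bp; the interval falls short of (n, 2n] by about δ = 8s²(Bp -
Bm), and δ log(2n) ≤ n/6 amounts to 12 (Bp - Bm) log(2n) ≤ Bp. Since Bp - Bm ≤ 64k/(M(M + 1)) + 2
and log(2n) ≤ 2 log k ≤ (M + 1)/32, the main term on the left is 24/64 of 64k/M. A multiplier above
24 is thus needed, and 64 = 2^6 costs six squarings. -/
theorem bucketBounds_approx : ∃ K : ℕ, ∀ k M : ℕ, K ≤ k → 2 ≤ k → 2 ^ M ≤ k ^ 64 →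
    k ^ 64 < 2 ^ (M + 1) → BucketBounds k (64 * k / M + 1) (64 * k / (M + 1)) := by
  obtain ⟨N, hN⟩ := exists_prime_lt_and_add_le_two_mul
  have tl : Tendsto (fun k : ℕ => logb 2 (k : ℝ)) atTop atTop :=
    (tendsto_logb_atTop (by norm_num)).comp tendsto_natCast_atTop_atTop
  -- 18496 = 2 · 8 · 34² serves 2n = 8s²Bp ≤ k², by s ≤ 34 log k and Bp ≤ 2k. The second condition
  -- makes n large enough for the prime theorem.
  obtain ⟨K, hK⟩ := eventually_atTop.1
    ((eventually_mul_logb_sq_le 18496).and (tl.eventually_ge_atTop (N : ℝ)))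
  refine ⟨K, fun k M hKk hk h1 h2 => ?_⟩
  obtain ⟨e1, e2⟩ := hK k hKk
  obtain ⟨m1, m2⟩ := logb_bounds_of_pow hk h1 h2
  have hX := one_le_logb hk
  have hs := sparsity_le hk
  have hk0 : (0 : ℝ) < k := by positivity
  have hs1 : 24 ≤ TLE.sparsity k := by rw [sparsity_eq]; omega
  have hM64 : 64 ≤ M := by
    by_contra h
    have : 2 ^ (M + 1) ≤ 2 ^ 64 := Nat.pow_le_pow_right (by norm_num) (by omega)
    have : 2 ^ 64 ≤ k ^ 64 := Nat.pow_le_pow_left hk 64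
    omega
  have hM : (64 : ℝ) ≤ M := by exact_mod_cast hM64
  generalize hXd : logb 2 (k : ℝ) = X at *
  set s := TLE.sparsity k with hsd
  have hs0 : (24 : ℝ) ≤ s := by exact_mod_cast hs1
  have up1 := natCast_div_le (64 * k) M
  have up2 := div_le_natCast_div_add_one (64 * k) M
  have lo1 := natCast_div_le (64 * k) (M + 1)
  have lo2 := div_le_natCast_div_add_one (64 * k) (M + 1)
  push_cast at up1 up2 lo1 lo2
  have q1 : (k : ℝ) / X ≤ 64 * k / M := by
    rw [div_le_div_iff₀ (by positivity) (by positivity)]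
    nlinarith
  have q2 : 64 * (k : ℝ) / (M + 1) ≤ k / X := by
    rw [div_le_div_iff₀ (by positivity) (by positivity)]
    nlinarith
  have q3 : 64 * (k : ℝ) / M ≤ 2 * (k / X) := by
    rw [← mul_div_assoc, div_le_div_iff₀ (by positivity) (by positivity)]
    nlinarith
  have q4 : 64 * (k : ℝ) / M ≤ k := by
    rw [div_le_iff₀ (by positivity)]
    nlinarith
  have hle : TLE.buckets k ≤ 64 * k / M + 1 := by
    rw [TLE.buckets, Nat.ceil_le, hXd]
    push_cast
    linarith
  have hge : 64 * k / (M + 1) ≤ TLE.buckets k := by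
    have : ((64 * k / (M + 1) : ℕ) : ℝ) ≤ TLE.buckets k := by
      rw [TLE.buckets, hXd]
      exact (lo1.trans q2).trans (Nat.le_ceil _)
    exact_mod_cast this
  refine ⟨hle, hge, by push_cast; rw [hXd]; linarith, ?_⟩
  rw [← hsd]
  generalize 64 * k / M = u at *
  generalize 64 * k / (M + 1) = v at *
  have hvu : v ≤ u + 1 := hge.trans hle
  set n := 4 * s ^ 2 * (u + 1) with hn
  have hnr : (n : ℝ) = 4 * s ^ 2 * (u + 1) := by rw [hn]; push_cast; ring
  have hu0 : (0 : ℝ) ≤ u := Nat.cast_nonneg u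
  have hnk : 2 * (n : ℝ) ≤ k ^ 2 := by
    have h3 : (s : ℝ) ^ 2 ≤ (34 * X) ^ 2 := pow_le_pow_left₀ (by positivity) hs 2
    have h4 : (u : ℝ) + 1 ≤ 2 * k := by
      have : (1 : ℝ) ≤ k := by exact_mod_cast (by omega : 1 ≤ k)
      linarith
    calc 2 * (n : ℝ) = 8 * (s ^ 2 * (u + 1)) := by rw [hnr]; ring
      _ ≤ 8 * ((34 * X) ^ 2 * (2 * k)) := by gcongr
      _ = (18496 * X ^ 2) * k := by ring
      _ ≤ k * k := by gcongr
      _ = k ^ 2 := by ring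
  have hnu : (u : ℝ) + 1 ≤ n := by
    rw [hnr]
    refine le_mul_of_one_le_left (by positivity) ?_
    nlinarith
  have hn1 : (1 : ℝ) ≤ 2 * n := by linarith
  have hlog : logb 2 (2 * n) ≤ 2 * X := by
    calc logb 2 (2 * n) ≤ logb 2 ((k : ℝ) ^ 2) :=
          logb_le_logb_of_le (by norm_num) (by linarith) hnk
      _ = 2 * X := by rw [logb_pow, hXd]; norm_num
  have hl0 : 0 ≤ logb 2 (2 * (n : ℝ)) := logb_nonneg (by norm_num) hn1
  obtain ⟨p, p1, p2, p3⟩ := hN n (8 * s ^ 2 * (u + 1 - v)) (by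
    have h5 : (N : ℝ) ≤ n := by
      have : (X : ℝ) ≤ u + 1 := by
        refine le_trans ?_ (q1.trans up2)
        rw [le_div_iff₀ (by positivity), ← sq]
        linarith [sq_nonneg X]
      calc (N : ℝ) ≤ u + 1 := e2.trans this
        _ ≤ n := hnu
    exact_mod_cast h5) (by
    push_cast [hvu]
    have h6 : 12 * ((u : ℝ) + 1 - v) * (2 * X) ≤ u + 1 := by
      have h7 : (u : ℝ) + 1 - v ≤ 64 * k / M - 64 * k / (M + 1) + 2 := by linarith
      have h8 : 64 * (k : ℝ) / M - 64 * k / (M + 1) = 64 * k / (M * (M + 1)) := by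
        field_simp
        ring
      have h9 : 64 * (k : ℝ) / (M * (M + 1)) * (M + 1) = 64 * k / M := by
        field_simp
      have h10 : 2 * ((M : ℝ) + 1) ≤ 64 * k / M := by
        rw [le_div_iff₀ (by positivity)]
        have : 2 * (M + 1 : ℝ) * M ≤ 2 * (65 * X) * (64 * X) := by gcongr; linarith
        have : 2 * (65 * X) * (64 * X) = 8320 * X ^ 2 := by ring
        linarith [sq_nonneg X]
      have h11 : (0 : ℝ) ≤ u + 1 - v := by
        have : (v : ℝ) ≤ u + 1 := by exact_mod_cast hvu
        linarith
      calc 12 * ((u : ℝ) + 1 - v) * (2 * X) ≤ 12 * ((u : ℝ) + 1 - v) * ((M + 1) / 32) := by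
            gcongr; linarith
        _ ≤ 12 * (64 * k / (M * (M + 1)) + 2) * ((M + 1) / 32) := by
            gcongr; linarith
        _ = 3 / 8 * (64 * (k : ℝ) / (M * (M + 1)) * (M + 1)) + 3 / 4 * (M + 1) := by ring
        _ ≤ u + 1 := by rw [h9]; linarith
    have h12 : (0 : ℝ) ≤ u + 1 - v := by
      have : (v : ℝ) ≤ u + 1 := by exact_mod_cast hvu
      linarith
    calc 8 * (s : ℝ) ^ 2 * (u + 1 - v) * logb 2 (2 * n)
        ≤ 8 * (s : ℝ) ^ 2 * (u + 1 - v) * (2 * X) := by gcongr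
      _ = 2 / 3 * s ^ 2 * (12 * ((u : ℝ) + 1 - v) * (2 * X)) := by ring
      _ ≤ 2 / 3 * s ^ 2 * (u + 1) := by gcongr
      _ = n / 6 := by rw [hnr]; ring)
  refine ⟨p, p1, p2, ?_⟩
  have : 8 * s ^ 2 * (u + 1 - v) + 8 * s ^ 2 * v = 2 * n := by
    rw [← mul_add, Nat.sub_add_cancel hvu, hn]; ring
  have : 2 * (4 * s ^ 2 * v + 1) = 8 * s ^ 2 * v + 2 := by ring
  omega

end WordRAM

/-! ### Euler's sieve -/

namespace WordRAM
open Cmd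

/-- The reason why Euler's sieve is linear: a composite is reached only as i · q with q its least
prime factor, and q ≤ minFac i is the test for this. -/
theorem minFac_mul_prime {i q : ℕ} (hi : 2 ≤ i) (hq : q.Prime) (h : q ≤ i.minFac) :
    (i * q).minFac = q ∧ i * q / (i * q).minFac = i ∧ ¬ (i * q).Prime := by
  have h1 : (i * q).minFac = q := by
    refine le_antisymm (Nat.minFac_le_of_dvd hq.two_le (dvd_mul_left q i)) ?_
    have hp : (i * q).minFac.Prime := Nat.minFac_prime (by nlinarith [hq.two_le])
    rcases (hp.dvd_mul).1 (Nat.minFac_dvd (i * q)) with h2 | h2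
    · exact h.trans (Nat.minFac_le_of_dvd hp.two_le h2)
    · exact ((Nat.prime_dvd_prime_iff_eq hp hq).1 h2).ge
  exact ⟨h1, by rw [h1, Nat.mul_div_cancel _ hq.pos],
    Nat.not_prime_mul (by omega) hq.one_lt.ne'⟩

theorem eq_mul_of_div_minFac {n i : ℕ} (hn : n / n.minFac = i) : n = i * n.minFac := by
  rw [← hn, Nat.div_mul_cancel (Nat.minFac_dvd n)]

theorem minFac_le_of_div_minFac {n i : ℕ} (hi : 2 ≤ i) (hn : n / n.minFac = i) :
    n.minFac ≤ i.minFac :=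
  Nat.minFac_le_of_dvd (Nat.minFac_prime (by omega)).two_le
    ((Nat.minFac_dvd i).trans ⟨n.minFac, eq_mul_of_div_minFac hn⟩)

/-- The composite numbers up to `U` whose largest proper factor is less than `i`, or is `i` while
the least prime factor is among the first `j` primes. -/
def sieved (U i j : ℕ) : Finset ℕ :=
  {n ∈ Finset.Icc 2 U | ¬ n.Prime ∧ (n / n.minFac < i ∨
    n / n.minFac = i ∧ Nat.count Nat.Prime n.minFac < j)}

theorem mem_sieved {U i j n : ℕ} : n ∈ sieved U i j ↔ (2 ≤ n ∧ n ≤ U) ∧ ¬ n.Prime ∧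
    (n / n.minFac < i ∨ n / n.minFac = i ∧ Nat.count Nat.Prime n.minFac < j) := by
  simp [sieved]

theorem count_prime_nth (j : ℕ) : Nat.count Nat.Prime (Nat.nth Nat.Prime j) = j :=
  Nat.count_nth_of_infinite Nat.infinite_setOfPred_prime j

/-- Every inner step enters a genuinely new number, so the cardinality of `sieved`, at most U,
counts the inner steps of the whole sieve. -/
theorem sieved_succ {U i j : ℕ} (hi : 2 ≤ i) (h1 : Nat.nth Nat.Prime j ≤ i.minFac)
    (h2 : Nat.nth Nat.Prime j ≤ U / i) :
    i * Nat.nth Nat.Prime j ∉ sieved U i j ∧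
      sieved U i (j + 1) = insert (i * Nat.nth Nat.Prime j) (sieved U i j) := by
  obtain ⟨h3, h4, h5⟩ := minFac_mul_prime hi (Nat.prime_nth_prime j) h1
  have h6 : i * Nat.nth Nat.Prime j ≤ U := by
    rw [mul_comm]; exact (Nat.le_div_iff_mul_le (by omega)).1 h2
  constructor
  · rw [mem_sieved]
    rintro ⟨-, -, h | ⟨-, h⟩⟩
    · omega
    · rw [h3, count_prime_nth] at h
      omega
  · ext n
    rw [Finset.mem_insert, mem_sieved, mem_sieved]
    constructor
    · rintro ⟨h7, h8, h | ⟨h, h'⟩⟩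
      · exact Or.inr ⟨h7, h8, Or.inl h⟩
      · rcases Nat.lt_succ_iff_lt_or_eq.1 h' with h' | h'
        · exact Or.inr ⟨h7, h8, Or.inr ⟨h, h'⟩⟩
        · left
          rw [← h', Nat.nth_count (Nat.minFac_prime (by omega)), ← eq_mul_of_div_minFac h]
    · rintro (rfl | ⟨h7, h8, h⟩)
      · refine ⟨⟨?_, h6⟩, h5, Or.inr ⟨h4, ?_⟩⟩
        · nlinarith [(Nat.prime_nth_prime j).two_le]
        · rw [h3, count_prime_nth]; omega
      · exact ⟨h7, h8, by omega⟩

theorem sieved_next {U i j : ℕ} (hi : 2 ≤ i) (h : ∀ q, q.Prime → q ≤ i.minFac → q ≤ U / i →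
    Nat.count Nat.Prime q < j) : sieved U i j = sieved U (i + 1) 0 := by
  ext n
  rw [mem_sieved, mem_sieved]
  refine and_congr_right fun h1 => and_congr_right fun h2 => ?_
  constructor
  · rintro (h | ⟨h, -⟩) <;> left <;> omega
  · rintro (h3 | ⟨-, h3⟩)
    · rcases Nat.lt_succ_iff_lt_or_eq.1 h3 with h3 | h3
      · exact Or.inl h3
      · refine Or.inr ⟨h3, h _ (Nat.minFac_prime (by omega)) (minFac_le_of_div_minFac hi h3) ?_⟩
        rw [Nat.le_div_iff_mul_le (by omega), mul_comm, ← eq_mul_of_div_minFac h3]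
        exact h1.2
    · omega

theorem card_sieved_le (U i j : ℕ) : (sieved U i j).card ≤ U :=
  (Finset.card_le_card (Finset.filter_subset _ _)).trans (by simp)

/-- Euler's sieve: least prime factors of the numbers up to the variable 9 go to the array 6. -/
def sieve : Cmd :=
  fill 6 (.var 9 + 1) (.var 20) 0 ;; 12 ::= 0 ;; 10 ::= 2 ;;
  .while (.var 10) (.var 9 + 1)
    (.ite (.ld 6 (.var 10)) 1
      (.store 6 (.var 10) (.var 10) ;; .store 7 (.var 12) (.var 10) ;; 12 ::= .var 12 + 1 ;;
        .store 7 (.var 12) (.var 9 + 1)) .skip ;;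
    13 ::= .ld 6 (.var 10) ;; 14 ::= .var 9 / .var 10 ;;
    .ite (.var 14) (.var 13) (13 ::= .var 14) .skip ;;
    11 ::= 0 ;;
    .while (.ld 7 (.var 11)) (.var 13 + 1)
      (.store 6 (.var 10 * .ld 7 (.var 11)) (.ld 7 (.var 11)) ;; 11 ::= .var 11 + 1) ;;
    10 ::= .var 10 + 1)

/-- The variables that `sieve` changes. -/
abbrev sieveVars : List ℕ := [10, 11, 12, 13, 14, 20]

/-- The state of the sieve: primes below `i` and the numbers in `S` have got their least prime
factor. -/
structure SieveState (U i : ℕ) (S : Finset ℕ) (σ : Env) : Prop where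
  count : σ.var 12 = Nat.count Nat.Prime i
  primes : ∀ j < Nat.count Nat.Prime i, σ.mem 7 j = Nat.nth Nat.Prime j
  -- The sentinel exceeds every threshold of the inner loop, which thus stops behind the last known
  -- prime. It is first written when 2 is recognized.
  sentinel : 2 < i → σ.mem 7 (Nat.count Nat.Prime i) = U + 1
  table : ∀ n, 2 ≤ n → n ≤ U →
    σ.mem 6 n = if (n.Prime ∧ n < i) ∨ n ∈ S then n.minFac else 0

theorem wp_sieve_inner {W : ℕ} {ω : Coins} {σ : Env} {U i : ℕ} (hW : U + 3 < W) (hi : 2 ≤ i)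
    (hiU : i ≤ U) (v9 : σ.var 9 = U) (v10 : σ.var 10 = i) (v11 : σ.var 11 = 0)
    (v13 : σ.var 13 = min i.minFac (U / i)) (h : SieveState U (i + 1) (sieved U i 0) σ) :
    (Cmd.while (.ld 7 (.var 11)) (.var 13 + 1)
      (.store 6 (.var 10 * .ld 7 (.var 11)) (.ld 7 (.var 11)) ;; 11 ::= .var 11 + 1)).Wp W ω
      (fun σ' => Frame [11] [6] σ σ' ∧ SieveState U (i + 1) (sieved U (i + 1) 0) σ' ∧
        σ'.time + 40 * (sieved U i 0).card ≤ σ.time + 40 * (sieved U (i + 1) 0).card + 10) σ := by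
  have hx : σ.var 13 ≤ U := by
    rw [v13]; exact (min_le_right _ _).trans (Nat.div_le_self _ _)
  refine wp_while (fun σ' => Frame [11] [6] σ σ' ∧ σ'.var 11 ≤ Nat.count Nat.Prime (i + 1) ∧
    SieveState U (i + 1) (sieved U i (σ'.var 11)) σ' ∧
    σ'.time + 40 * (sieved U i 0).card ≤ σ.time + 40 * (sieved U i (σ'.var 11)).card)
    (fun σ' => Nat.count Nat.Prime (i + 1) - σ'.var 11) ?_ ?_
  · refine ⟨Frame.refl _ _ _, by omega, by rwa [v11], by rw [v11]⟩
  rintro σ' ⟨hF, hj, hS, ht⟩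
  have e9 : σ'.var 9 = U := by simp [hF.var, v9]
  have e10 : σ'.var 10 = i := by simp [hF.var, v10]
  have e13 : σ'.var 13 = min i.minFac (U / i) := by simp [hF.var, v13]
  refine ⟨by simp, by simp [hF.var]; omega, fun hlt => ?_, fun hle => ?_⟩
  · simp only [Expr.val_ld, Expr.val_var, Expr.val_add, Expr.val_ofNat] at hlt
    have hj' : σ'.var 11 < Nat.count Nat.Prime (i + 1) := by
      refine lt_of_le_of_ne hj fun h' => ?_
      rw [h', hS.sentinel (by omega)] at hlt
      simp [hF.var] at hlt
      omega
    have hq := hS.primes _ hj'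
    rw [hq, e13, Nat.lt_succ_iff, le_min_iff] at hlt
    obtain ⟨n1, n2⟩ := sieved_succ hi hlt.1 hlt.2
    have hmul : i * Nat.nth Nat.Prime (σ'.var 11) ≤ U := by
      rw [mul_comm]; exact (Nat.le_div_iff_mul_le (by omega)).1 hlt.2
    have hcard : (sieved U i (σ'.var 11 + 1)).card = (sieved U i (σ'.var 11)).card + 1 := by
      rw [n2, Finset.card_insert_of_notMem n1]
    simp only [wp_seq, wp_store, wp_assign]
    have hjU : σ'.var 11 < i + 1 := hj'.trans_le (Nat.count_le _)
    refine ⟨by simp [e10, hq]; omega, by simp, by simp; omega,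
      ⟨by simpa using hF, by simp; omega, ⟨?_, ?_, ?_, ?_⟩, ?_⟩, by simp; omega⟩
    · simpa using hS.count
    · simpa using hS.primes
    · simpa using hS.sentinel
    · intro n hn1 hn2
      simp only [Env.tick_mem, Env.set_mem, Env.tick_var, Env.set_var, if_true, Env.st_var, Env.st_mem]
      simp only [Expr.val_add, Expr.val_mul, Expr.val_ld, Expr.val_var, Expr.val_ofNat, Env.tick_mem,
        Env.tick_var, e10, hq, n2, Env.st_var, true_and, Finset.mem_insert]
      by_cases hn : n = i * Nat.nth Nat.Prime (σ'.var 11)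
      · rw [if_pos hn, if_pos (Or.inr (Or.inl hn)), hn,
          (minFac_mul_prime hi (Nat.prime_nth_prime _) hlt.1).1]
      · simp only [hn, if_false, false_or]
        exact hS.table n hn1 hn2
    · simp [hcard] at ht ⊢
      omega
  · simp only [Expr.val_ld, Expr.val_var, Expr.val_add, Expr.val_ofNat, e13] at hle
    have hnext : sieved U i (σ'.var 11) = sieved U (i + 1) 0 := by
      refine sieved_next hi fun q hq h1 h2 => ?_
      by_contra! hc
      have hqi : q ≤ i := h1.trans (Nat.minFac_le (by omega))
      have hlt : σ'.var 11 < Nat.count Nat.Prime (i + 1) :=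
        hc.trans_lt (Nat.count_strict_mono hq (by omega))
      rw [hS.primes _ hlt] at hle
      have : Nat.nth Nat.Prime (σ'.var 11) ≤ q :=
        (Nat.nth_monotone Nat.infinite_setOfPred_prime hc).trans_eq (Nat.nth_count hq)
      have := le_min h1 h2
      omega
    rw [hnext] at hS ht
    refine ⟨by simpa using hF, ⟨by simpa using hS.count, by simpa using hS.primes,
      by simpa using hS.sentinel, by simpa using hS.table⟩, by simp; omega⟩

theorem sieved_two (U : ℕ) : sieved U 2 0 = ∅ := by
  refine Finset.eq_empty_of_forall_notMem fun n hn => ?_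
  rw [mem_sieved] at hn
  have := Nat.minFac_le_div (by omega) hn.2.1
  have := (Nat.minFac_prime (n := n) (by omega)).two_le
  omega

theorem SieveState.table_self {U i : ℕ} {σ : Env} (h : SieveState U i (sieved U i 0) σ)
    (hi : 2 ≤ i) (hU : i ≤ U) : σ.mem 6 i = if i.Prime then 0 else i.minFac := by
  rw [h.table i hi hU]
  by_cases hp : i.Prime
  · simp [hp, mem_sieved]
  · rw [if_pos, if_neg hp]
    right
    rw [mem_sieved]
    exact ⟨⟨hi, hU⟩, hp, Or.inl (Nat.div_lt_self (by omega) (Nat.minFac_prime (by omega)).one_lt)⟩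

/-- The part of the loop body of `sieve` that recognizes a prime. -/
theorem wp_sieve_prime {W : ℕ} {ω : Coins} {σ : Env} {U i : ℕ} (hW : U + 3 < W) (hi : 2 ≤ i)
    (hiU : i ≤ U) (v9 : σ.var 9 = U) (v10 : σ.var 10 = i) (h : SieveState U i (sieved U i 0) σ) :
    (Cmd.ite (.ld 6 (.var 10)) 1
      (.store 6 (.var 10) (.var 10) ;; .store 7 (.var 12) (.var 10) ;; 12 ::= .var 12 + 1 ;;
        .store 7 (.var 12) (.var 9 + 1)) .skip).Wp W ω (fun σ' => Frame [12] [6, 7] σ σ' ∧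
          SieveState U (i + 1) (sieved U i 0) σ' ∧ σ'.time ≤ σ.time + 40) σ := by
  have hself := h.table_self hi hiU
  have hcnt : Nat.count Nat.Prime i ≤ i := Nat.count_le _
  have hns : i.Prime → i ∉ sieved U i 0 := fun hp hm => (mem_sieved.1 hm).2.1 hp
  simp only [wp_ite, wp_seq, wp_store, wp_assign, wp_skip]
  refine ⟨by simp, by simp; omega, fun hlt => ?_, fun hle => ?_⟩
  · simp only [Expr.val_ld, Expr.val_var, v10, hself, Expr.val_ofNat] at hlt
    have hp : i.Prime := by
      by_contra hp
      rw [if_neg hp] at hlt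
      have := (Nat.minFac_prime (n := i) (by omega)).two_le
      omega
    have hc : Nat.count Nat.Prime (i + 1) = Nat.count Nat.Prime i + 1 := by
      rw [Nat.count_succ, if_pos hp]
    refine ⟨by simp, by simp, by simp, by simp, by simp [h.count]; omega, by simp,
      by simp [v9]; omega, by simp [Frame.refl], ⟨?_, ?_, ?_, ?_⟩, by simp⟩
    · simp [hc, h.count]
    · intro j hj
      rw [hc] at hj
      have hj1 : j ≠ Nat.count Nat.Prime i + 1 := by omega
      simp [h.count, hj1, v10]
      split_ifs with hj2
      · rw [hj2, Nat.nth_count hp]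
      · exact h.primes j (by omega)
    · intro _
      simp [h.count, hc, v9]
    · intro n hn1 hn2
      simp [v10]
      by_cases hn : n = i
      · simp [hn, hp, hp.minFac_eq]
      · have : n ≤ i ↔ n < i := by omega
        simp only [hn, if_false, this]
        exact h.table n hn1 hn2
  · simp only [Expr.val_ld, Expr.val_var, v10, hself, Expr.val_ofNat] at hle
    have hp : ¬ i.Prime := by
      intro hp
      rw [if_pos hp] at hle
      omega
    have hc : Nat.count Nat.Prime (i + 1) = Nat.count Nat.Prime i := by
      rw [Nat.count_succ, if_neg hp, add_zero]
    refine ⟨by simp [Frame.refl], ⟨by simp [hc, h.count], by simpa [hc] using h.primes, ?_, ?_⟩,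
      by simp⟩
    · intro h2
      have : i ≠ 2 := by rintro rfl; exact hp Nat.prime_two
      simpa [hc] using h.sentinel (by omega)
    · intro n hn1 hn2
      have : (n.Prime ∧ n < i + 1) ↔ n.Prime ∧ n < i := by
        refine and_congr_right fun hn => ?_
        have : n ≠ i := by rintro rfl; exact hp hn
        omega
      simp only [Env.tick_mem, this]
      exact h.table n hn1 hn2

theorem wp_sieve {W : ℕ} {ω : Coins} {σ : Env} {U : ℕ} (hW : U + 3 < W) (hU : 1 ≤ U)
    (v9 : σ.var 9 = U) :
    sieve.Wp W ω (fun σ' => Frame sieveVars [6, 7] σ σ' ∧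
      (∀ n, 2 ≤ n → n ≤ U → σ'.mem 6 n = n.minFac) ∧
      σ'.time ≤ σ.time + 300 * (U + 2)) σ := by
  rw [sieve, wp_seq]
  refine (wp_fill (U + 1) id (fun _ => 0) (by omega) (fun _ _ _ _ h => h)
    (fun i hi σ' hF h20 => by simp [hF.var, v9]; omega)
    (fun i hi σ' hF h20 => by simp [h20]; omega)).mono ?_
  rintro σ₁ ⟨F1, hz, -, -, t1⟩
  simp only [wp_seq, wp_assign]
  refine ⟨by simp; omega, by simp; omega, ?_⟩
  simp at t1
  have F1' : Frame sieveVars [6, 7] σ σ₁ := F1.weaken (by simp) (by simp)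
  have e9 : ∀ {σ'}, Frame sieveVars [6, 7] σ σ' → σ'.var 9 = U := fun hF => by simp [hF.var, v9]
  refine wp_while_count (fun i σ' => Frame sieveVars [6, 7] σ σ' ∧ σ'.var 10 = i ∧
    SieveState U i (sieved U i 0) σ' ∧
    σ'.time ≤ σ.time + 20 * (U + 2) + 20 + 200 * i + 40 * (sieved U i 0).card)
    2 (U + 1) (by omega) ?_ ?_ ?_
  · refine ⟨by simpa using F1', by simp, ⟨?_, ?_, by simp, ?_⟩, by simp; omega⟩
    · simp [Nat.count_succ, Nat.not_prime_zero, Nat.not_prime_one]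
    · simp [Nat.count_succ, Nat.not_prime_zero, Nat.not_prime_one]
    · intro n hn1 hn2
      rw [sieved_two, if_neg]
      · simpa using hz n (by omega)
      · rintro (⟨h, h'⟩ | h)
        · omega
        · simp at h
  · rintro i σ₂ hi2 hiU ⟨F2, e10, hS, t2⟩
    have hiU' : i ≤ U := by omega
    have g9 := e9 F2
    refine ⟨by simp, by simp [g9]; omega, by simp [e10, g9]; omega, ?_⟩
    rw [wp_seq]
    refine (wp_sieve_prime (U := U) (i := i) hW hi2 hiU' (by simpa using g9) (by simpa using e10)
      ⟨by simpa using hS.count, by simpa using hS.primes, by simpa using hS.sentinel,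
        by simpa using hS.table⟩).mono ?_
    rintro σ₃ ⟨F3, hS3, t3⟩
    have F3' : Frame sieveVars [6, 7] σ σ₃ :=
      F2.trans ((Frame.tick_left.1 F3).weaken (by simp) (by simp))
    have f10 : σ₃.var 10 = i := by rw [F3.var 10 (by simp)]; simpa using e10
    have f9 := e9 F3'
    have hlp : σ₃.mem 6 i = i.minFac := by
      rw [hS3.table i hi2 hiU', if_pos]
      by_cases hp : i.Prime
      · exact Or.inl ⟨hp, by omega⟩
      · right
        rw [mem_sieved]
        exact ⟨⟨hi2, hiU'⟩, hp,
          Or.inl (Nat.div_lt_self (by omega) (Nat.minFac_prime (by omega)).one_lt)⟩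
    rw [wp_seq, wp_assign]
    refine ⟨by simp, ?_⟩
    rw [wp_seq, wp_assign]
    refine ⟨by simp [f10], ?_⟩
    rw [wp_seq]
    have hmin : (Cmd.ite (.var 14) (.var 13) (13 ::= .var 14) .skip).Wp W ω (fun σ' =>
        Frame [13, 14] [] σ₃ σ' ∧ σ'.var 13 = min i.minFac (U / i) ∧ σ'.time ≤ σ₃.time + 30)
        ((((σ₃.set 13 ((Expr.ld 6 (.var 10)).val σ₃)).tick ((Expr.ld 6 (.var 10)).cost + 1)).set 14
          ((Expr.var 9 / .var 10).val ((σ₃.set 13 ((Expr.ld 6 (.var 10)).val σ₃)).tick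
            ((Expr.ld 6 (.var 10)).cost + 1)))).tick ((Expr.var 9 / .var 10).cost + 1)) := by
      simp only [wp_ite, wp_assign, wp_skip]
      refine ⟨by simp, by simp, fun h => ⟨by simp, by simp [Frame.refl], ?_, ?_⟩,
        fun h => ⟨by simp [Frame.refl], ?_, ?_⟩⟩
      · simp [f9, f10, hlp] at h ⊢
        omega
      · simp
      · simp [f9, f10, hlp] at h ⊢
        omega
      · simp
    refine hmin.mono ?_
    rintro σ₄ ⟨F4, g13, t4⟩
    have F4' : Frame sieveVars [6, 7] σ σ₄ := F3'.trans (F4.weaken (by simp) (by simp))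
    have g10 : σ₄.var 10 = i := by rw [F4.var 10 (by simp), f10]
    have hS4 : SieveState U (i + 1) (sieved U i 0) σ₄ :=
      ⟨by rw [F4.var 12 (by simp)]; exact hS3.count, by rw [F4.mem 7 (by simp)]; exact hS3.primes,
        by rw [F4.mem 7 (by simp)]; exact hS3.sentinel,
        by rw [F4.mem 6 (by simp)]; exact hS3.table⟩
    rw [wp_seq, wp_assign]
    refine ⟨by simp; omega, ?_⟩
    rw [wp_seq]
    refine (wp_sieve_inner (U := U) (i := i) hW hi2 hiU' (by simpa using e9 F4')
      (by simpa using g10) (by simp) (by simpa using g13)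
      ⟨by simpa using hS4.count, by simpa using hS4.primes, by simpa using hS4.sentinel,
        by simpa using hS4.table⟩).mono ?_
    rintro σ₅ ⟨F5, hS5, t5⟩
    have F5' : Frame sieveVars [6, 7] σ σ₅ := by
      refine Frame.trans ?_ (F5.weaken (by simp) (by simp))
      simpa using F4'
    have h10 : σ₅.var 10 = i := by rw [F5.var 10 (by simp)]; simpa using g10
    rw [wp_assign]
    refine ⟨by simp [h10]; omega, by simpa using F5', by simp [h10],
      ⟨by simpa using hS5.count, by simpa using hS5.primes, by simpa using hS5.sentinel,
        by simpa using hS5.table⟩, ?_⟩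
    simp at t3 t4 t5 ⊢
    omega
  · rintro σ₂ ⟨F2, e10, hS, t2⟩
    have g9 := e9 F2
    refine ⟨by simp, by simp [g9]; omega, by simp [g9, e10], by simpa using F2,
      fun n hn1 hn2 => ?_, ?_⟩
    · simp only [Env.tick_mem]
      rw [hS.table n hn1 hn2, if_pos]
      by_cases hp : n.Prime
      · exact Or.inl ⟨hp, by omega⟩
      · right
        rw [mem_sieved]
        exact ⟨⟨hn1, hn2⟩, hp, Or.inl (by have := Nat.div_le_self n n.minFac; omega)⟩
    · have := card_sieved_le U (U + 1) 0
      simp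
      omega

end WordRAM

/-! ### Orders modulo a prime, and tables of powers -/

namespace WordRAM
open Cmd

/-! ### Orders of elements modulo p and how to enlarge them -/

section Order

variable {p : ℕ} [Fact p.Prime]

theorem orderOf_dvd_sub_one {g : ZMod p} (hg : g ≠ 0) : orderOf g ∣ p - 1 :=
  orderOf_dvd_of_pow_eq_one (ZMod.pow_card_sub_one_eq_one hg)

theorem sub_one_pos_of_fact : 0 < p - 1 := by
  have := (Fact.out : p.Prime).one_lt
  omega

theorem orderOf_pos_of_ne_zero {g : ZMod p} (hg : g ≠ 0) : 0 < orderOf g :=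
  Nat.pos_of_dvd_of_pos (orderOf_dvd_sub_one hg) sub_one_pos_of_fact

theorem orderOf_le_sub_one {g : ZMod p} (hg : g ≠ 0) : orderOf g ≤ p - 1 :=
  Nat.le_of_dvd sub_one_pos_of_fact (orderOf_dvd_sub_one hg)

theorem two_mul_orderOf_le {g : ZMod p} (hg : g ≠ 0) (h : orderOf g < p - 1) :
    2 * orderOf g ≤ p - 1 := by
  obtain ⟨c, hc⟩ := orderOf_dvd_sub_one hg
  have : 2 ≤ c := by
    by_contra! hc2
    interval_cases c <;> omega
  rw [hc, mul_comm]
  exact Nat.mul_le_mul_left _ this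

theorem exists_orderOf_eq_sub_one : ∃ g : ZMod p, g ≠ 0 ∧ orderOf g = p - 1 := by
  obtain ⟨u, hu⟩ := IsCyclic.exists_generator (α := (ZMod p)ˣ)
  refine ⟨u, u.ne_zero, ?_⟩
  rw [orderOf_units, orderOf_eq_card_of_forall_mem_zpowers hu, Nat.card_eq_fintype_card,
    ZMod.card_units]

/-- The group is cyclic, so elements of order dividing ord g are powers of g. Contrapositively, an
element that is no power of g brings a new divisor. -/
theorem exists_pow_eq_of_orderOf_dvd {g y : ZMod p} (hg : g ≠ 0) (h : orderOf y ∣ orderOf g) :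
    ∃ i < orderOf g, g ^ i = y := by
  have : NeZero (orderOf g) := ⟨(orderOf_pos_of_ne_zero hg).ne'⟩
  exact (IsPrimitiveRoot.orderOf g).eq_pow_of_pow_eq_one (orderOf_dvd_iff_pow_eq_one.1 h)

/-- If `d` is the least divisor of `b` which does not divide `a`, then `d` is a power of its least
prime factor `q`, and the multiplicity of `q` in `a` is one less than in `d`. -/
theorem coprime_of_least {a b d : ℕ} (hdb : d ∣ b) (hda : ¬ d ∣ a) (hd0 : d ≠ 0)
    (hmin : ∀ e, 1 ≤ e → e < d → e ∣ b → e ∣ a) :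
    d / d.minFac ∣ a ∧ Nat.Coprime (a / (d / d.minFac)) d := by
  have hd1 : d ≠ 1 := by rintro rfl; exact hda (one_dvd _)
  have hq := Nat.minFac_prime hd1
  set q := d.minFac with hqd
  have hqd' : d = d / q * q := (Nat.div_mul_cancel (Nat.minFac_dvd d)).symm
  set c := d / q with hc
  have hc0 : 1 ≤ c := by
    rcases Nat.eq_zero_or_pos c with h | h
    · rw [h] at hqd'; omega
    · exact h
  have hca : c ∣ a := by
    refine hmin c hc0 ?_ (dvd_trans ⟨q, hqd'⟩ hdb)
    nlinarith [hq.two_le]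
  refine ⟨hca, Nat.coprime_of_dvd fun r hr h1 h2 => ?_⟩
  rw [hqd'] at h2
  rcases eq_or_ne r q with rfl | hrq
  · obtain ⟨e, he⟩ := h1
    refine hda ⟨e, ?_⟩
    calc a = c * (a / c) := (Nat.mul_div_cancel' hca).symm
      _ = c * q * e := by rw [he]; ring
      _ = d * e := by rw [← hqd']
  -- A second prime r in d would split d into coprime proper factors r^f and u. Both divide b and
  -- are smaller than d, so they divide a, and then so does d.
  · obtain ⟨f, u, hu, hdu⟩ := Nat.exists_eq_pow_mul_and_not_dvd (n := d) hd0 r hr.ne_one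
    have hrd : r ∣ d := by rw [hqd']; exact h2
    have hf : f ≠ 0 := by
      rintro rfl
      rw [pow_zero, one_mul] at hdu
      exact hu (hdu ▸ hrd)
    have hu0 : 1 ≤ u := Nat.one_le_iff_ne_zero.2 (by rintro rfl; simp at hu)
    have hru : 1 < r ^ f := Nat.one_lt_pow hf hr.one_lt
    have hqu : q ∣ u := by
      have : q ∣ r ^ f * u := hdu ▸ Nat.minFac_dvd d
      rcases hq.dvd_mul.1 this with h | h
      · exact absurd ((Nat.prime_dvd_prime_iff_eq hq hr).1 (hq.dvd_of_dvd_pow h)).symm hrq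
      · exact h
    have hu1 : 1 < u := hq.one_lt.trans_le (Nat.le_of_dvd hu0 hqu)
    have e1 : u ∣ a := hmin u hu0 (by rw [hdu]; nlinarith) (dvd_trans ⟨r ^ f, by rw [hdu]; ring⟩ hdb)
    have e2 : r ^ f ∣ a := hmin _ hru.le (by rw [hdu]; nlinarith) (dvd_trans ⟨u, hdu⟩ hdb)
    refine hda ?_
    rw [hdu]
    exact (Nat.Coprime.pow_left f ((Nat.Prime.coprime_iff_not_dvd hr).2 hu)).mul_dvd_of_dvd_of_dvd
      e2 e1

/-- The first factor has order ord g / (d/q) and the second has order d, where q is the least prime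
factor of d. These are coprime, so the orders multiply to q · ord g, at least a doubling. -/
theorem orderOf_combine {g y : ZMod p} {d : ℕ} (hy : y ≠ 0) (hdb : d ∣ orderOf y)
    (hda : ¬ d ∣ orderOf g) (hmin : ∀ e, 1 ≤ e → e < d → e ∣ orderOf y → e ∣ orderOf g) :
    orderOf (g ^ (d / d.minFac) * y ^ (orderOf y / d)) = orderOf g * d.minFac := by
  have hy0 := orderOf_pos_of_ne_zero hy
  have hd0 : d ≠ 0 := by rintro rfl; rw [zero_dvd_iff] at hdb; omega
  obtain ⟨h1, h2⟩ := coprime_of_least hdb hda hd0 hmin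
  have hc0 : d / d.minFac ≠ 0 :=
    (Nat.div_pos (Nat.minFac_le (Nat.pos_of_ne_zero hd0)) (Nat.minFac_pos d)).ne'
  have e1 : orderOf (g ^ (d / d.minFac)) = orderOf g / (d / d.minFac) :=
    orderOf_pow_of_dvd hc0 h1
  have e2 : orderOf (y ^ (orderOf y / d)) = d := by
    rw [orderOf_pow_of_dvd (Nat.div_pos (Nat.le_of_dvd hy0 hdb) (Nat.pos_of_ne_zero hd0)).ne'
      (Nat.div_dvd_of_dvd hdb), Nat.div_div_self hdb hy0.ne']
  rw [(Commute.all _ _).orderOf_mul_eq_mul_orderOf_of_coprime (by rw [e1, e2]; exact h2), e1, e2]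
  conv_lhs => rw [← Nat.div_mul_cancel (Nat.minFac_dvd d), ← mul_assoc]
  rw [Nat.div_mul_cancel (Nat.minFac_dvd d), Nat.div_mul_cancel h1]

theorem val_pow_inj {g : ZMod p} {i j : ℕ} (hi : i < orderOf g) (hj : j < orderOf g)
    (h : (g ^ i).val = (g ^ j).val) : i = j :=
  pow_injOn_Iio_orderOf hi hj (ZMod.val_injective p h)

end Order

/-- Powers of the variable 15 and their logarithms go to the arrays 3 and 4; the order of the
variable 15 modulo `p` goes to the variable 14. -/
def walk : Cmd :=
  .store 3 0 1 ;; .store 4 1 0 ;; 13 ::= .var 15 ;; 14 ::= 1 ;;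
  .while 1 (.var 13)
    (.store 3 (.var 14) (.var 13) ;; .store 4 (.var 13) (.var 14) ;;
      13 ::= .var 13 * .var 15 % .var 2 ;; 14 ::= .var 14 + 1)

/-- The arrays 3 and 4 hold powers of `g` and logarithms to base `g`. -/
def PowTables {p : ℕ} (g : ZMod p) (n : ℕ) (σ : Env) : Prop :=
  ∀ i < n, σ.mem 3 i = (g ^ i).val ∧ σ.mem 4 (g ^ i).val = i

theorem wp_walk {W : ℕ} {ω : Coins} {σ : Env} {p : ℕ} [Fact p.Prime] {g : ZMod p} (hg : g ≠ 0)
    (hW : p * p + p < W) (v2 : σ.var 2 = p) (v15 : σ.var 15 = g.val) :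
    walk.Wp W ω (fun σ' => Frame [13, 14] [3, 4] σ σ' ∧ σ'.var 14 = orderOf g ∧
      PowTables g (orderOf g) σ' ∧
      (∀ x, (∀ i < orderOf g, x ≠ (g ^ i).val) → σ'.mem 4 x = σ.mem 4 x) ∧
      σ'.time ≤ σ.time + 40 * orderOf g + 20) σ := by
  have hp := (Fact.out : p.Prime).one_lt
  have ho := orderOf_pos_of_ne_zero hg
  have hle := orderOf_le_sub_one hg
  have : Fact (1 < p) := ⟨hp⟩
  simp only [walk, wp_seq, wp_store, wp_assign]
  have hW0 : 0 < W := by omega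
  have hW1 : 1 < W := by omega
  refine ⟨by simp [hW0], by simp [hW1], by simp [hW1], by simp [hW0], by simp, by simp [hW1], ?_⟩
  refine wp_while_count (fun c σ' => Frame [13, 14] [3, 4] σ σ' ∧ σ'.var 14 = c ∧
    σ'.var 13 = (g ^ c).val ∧ PowTables g c σ' ∧
    (∀ x, (∀ i < c, x ≠ (g ^ i).val) → σ'.mem 4 x = σ.mem 4 x) ∧
    σ'.time ≤ σ.time + 40 * c + 10) 1 (orderOf g) ho ?_ ?_ ?_
  · refine ⟨by simp [Frame.refl], by simp, by simp [v15], fun i hi => ?_, fun x hx => ?_, by simp⟩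
    · obtain rfl : i = 0 := by omega
      simp [ZMod.val_one p]
    · have := hx 0 (by omega)
      rw [pow_zero, ZMod.val_one p] at this
      simp [this]
  · rintro c σ' hc1 hc ⟨hF, e14, e13, hT, hm, ht⟩
    have hx : (g ^ c).val < p := ZMod.val_lt _
    have hx1 : 1 < (g ^ c).val := by
      have h0 : (g ^ c).val ≠ 0 := by
        rw [ne_eq, ZMod.val_eq_zero]
        exact pow_ne_zero _ hg
      have h1 : (g ^ c).val ≠ 1 := by
        intro h
        refine (pow_ne_one_of_lt_orderOf (by omega) hc : g ^ c ≠ 1) (ZMod.val_injective p ?_)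
        rw [h, ZMod.val_one p]
      omega
    have e2 : σ'.var 2 = p := by rw [hF.var 2 (by simp), v2]
    have e15 : σ'.var 15 = g.val := by rw [hF.var 15 (by simp), v15]
    have hmul : (g ^ c).val * g.val ≤ p * p := Nat.mul_le_mul hx.le (ZMod.val_lt g).le
    refine ⟨by simp; omega, by simp, by simp [e13, hx1], ?_⟩
    simp only [wp_seq, wp_store, wp_assign]
    refine ⟨by simp, by simp, by simp, by simp, by simp [e13, e15, e2]; omega, by simp; omega,
      by simp [hF], by simp [e14], ?_, fun i hi => ?_, fun x hx => ?_, by simp; omega⟩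
    · simp [e13, e15, e2, pow_succ, ZMod.val_mul]
    · rcases Nat.lt_succ_iff_lt_or_eq.1 hi with hi | rfl
      · have : (g ^ i).val ≠ (g ^ c).val := fun h => by
          have := val_pow_inj (by omega) hc h
          omega
        simpa [e13, e14, hi.ne, this] using hT i hi
      · simp [e13, e14]
    · have := hx c (by omega)
      simpa [e13, e14, this] using hm x fun i hi => hx i (by omega)
  · rintro σ' ⟨hF, e14, e13, hT, hm, ht⟩
    refine ⟨by simp; omega, by simp, ?_, by simpa using hF, by simpa using e14, hT,
      by simpa using hm, by simp; omega⟩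
    simp [e13, pow_orderOf_eq_one, ZMod.val_one p]

end WordRAM

/-! ### Finding a generator -/

namespace WordRAM
open Cmd

/-- Replace the variable 16, of order the variable 17, by an element whose order is the product of
the variable 17 and a prime.  The variable 15 has order the variable 19, with powers in the
array 3. -/
def combine : Cmd :=
  21 ::= 2 ;;
  .while 0 (.var 19 % .var 21 + 1 / (.var 17 % .var 21 + 1)) (21 ::= .var 21 + 1) ;;
  22 ::= .ld 6 (.var 21) ;; 23 ::= .ld 3 (.var 19 / .var 21) ;; 15 ::= .var 16 ;; walk ;;
  15 ::= .var 23 * .ld 3 (.var 21 / .var 22 % .var 17) % .var 2 ;; walk ;; 16 ::= .var 15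

/-- Find a generator modulo the prime in the variable 2, and tabulate its powers. -/
def generator : Cmd :=
  fill 4 (.var 2) (.var 20) (.var 2) ;; 16 ::= 1 ;; 15 ::= 1 ;; walk ;; 17 ::= .var 14 ;; 18 ::= 1 ;;
  .while (.var 17) (.var 2 - 1)
    (.while (.ld 4 (.var 18)) (.var 2) (18 ::= .var 18 + 1) ;;
      15 ::= .var 18 ;; walk ;; 19 ::= .var 14 ;;
      .ite (.var 19) (2 * .var 17) combine (16 ::= .var 15) ;;
      17 ::= .var 14)

/-- All entries of the array 4 which differ from `p` belong to elements with the property `Q`. -/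
def Marked (p : ℕ) (Q : ZMod p → Prop) (σ : Env) : Prop :=
  ∀ x, 1 ≤ x → x < p → σ.mem 4 x < p → Q x

variable {p : ℕ} [Fact p.Prime]

/-- What `walk` does to the tables. -/
structure Walked (g : ZMod p) (σ σ' : Env) : Prop where
  frame : Frame [13, 14] [3, 4] σ σ'
  order : σ'.var 14 = orderOf g
  tables : PowTables g (orderOf g) σ'
  others : ∀ x, (∀ i < orderOf g, x ≠ (g ^ i).val) → σ'.mem 4 x = σ.mem 4 x
  time : σ'.time ≤ σ.time + 40 * orderOf g + 20

theorem wp_walk' {W : ℕ} {ω : Coins} {σ : Env} {g : ZMod p} (hg : g ≠ 0)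
    (hW : p * p + p < W) (v2 : σ.var 2 = p) (v15 : σ.var 15 = g.val) :
    walk.Wp W ω (Walked g σ) σ :=
  (wp_walk hg hW v2 v15).mono fun _ h => ⟨h.1, h.2.1, h.2.2.1, h.2.2.2.1, h.2.2.2.2⟩

theorem Walked.marked {g : ZMod p} {Q : ZMod p → Prop} {σ σ' : Env} (h : Walked g σ σ')
    (hQ : ∀ i, Q (g ^ i)) (hm : Marked p Q σ) : Marked p Q σ' := by
  intro x h1 h2 h3
  by_cases hx : ∀ i < orderOf g, x ≠ (g ^ i).val
  · rw [h.others x hx] at h3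
    exact hm x h1 h2 h3
  · push Not at hx
    obtain ⟨i, -, rfl⟩ := hx
    rw [ZMod.natCast_zmod_val]
    exact hQ i

theorem Walked.lt_of_lt {g : ZMod p} (hg : g ≠ 0) {σ σ' : Env} (h : Walked g σ σ') {x : ℕ}
    (hx : σ.mem 4 x < p) : σ'.mem 4 x < p := by
  by_cases hx' : ∀ i < orderOf g, x ≠ (g ^ i).val
  · rwa [h.others x hx']
  · push Not at hx'
    obtain ⟨i, hi, rfl⟩ := hx'
    rw [(h.tables i hi).2]
    have := orderOf_le_sub_one hg
    omega

/-- The order of `x` is not maximal, unless `fin`. -/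
def SmallOrder (p : ℕ) (fin : Prop) (x : ZMod p) : Prop := orderOf x < p - 1 ∨ fin

theorem smallOrder_pow {g : ZMod p} (hg : g ≠ 0) {fin : Prop} (h : SmallOrder p fin g) (i : ℕ) :
    SmallOrder p fin (g ^ i) :=
  h.imp_left ((Nat.le_of_dvd (orderOf_pos_of_ne_zero hg) (orderOf_pow_dvd i)).trans_lt ·)

/-- Array 3 holds the powers of y at the start, so the needed power of y is saved before the powers
of g are tabulated again. The search for d takes at most ord y < 2 ord g ≤ ord g' steps, so the cost
is linear in the new order. -/
theorem wp_combine {W : ℕ} {ω : Coins} {σ : Env} {g y : ZMod p} (hg : g ≠ 0) (hy : y ≠ 0)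
    (hW : p * p + p < W) (v2 : σ.var 2 = p) (v16 : σ.var 16 = g.val)
    (v17 : σ.var 17 = orderOf g) (v19 : σ.var 19 = orderOf y) (ht : PowTables y (orderOf y) σ)
    (hdvd : ¬ orderOf y ∣ orderOf g) (hlt : orderOf y < 2 * orderOf g)
    (hlp : ∀ n, 2 ≤ n → n ≤ p → σ.mem 6 n = n.minFac) :
    combine.Wp W ω (fun σ' => Frame [13, 14, 15, 16, 21, 22, 23] [3, 4] σ σ' ∧
      ∃ g' : ZMod p, g' ≠ 0 ∧ 2 * orderOf g ≤ orderOf g' ∧ σ'.var 16 = g'.val ∧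
        σ'.var 14 = orderOf g' ∧ PowTables g' (orderOf g') σ' ∧
        (∀ Q : ZMod p → Prop, (∀ i, Q (g ^ i)) → (∀ i, Q (g' ^ i)) → Marked p Q σ → Marked p Q σ') ∧
        (∀ x, σ.mem 4 x < p → σ'.mem 4 x < p) ∧
        σ'.time ≤ σ.time + 200 * orderOf g' + 200) σ := by
  have hp := (Fact.out : p.Prime).one_lt
  have hg0 := orderOf_pos_of_ne_zero hg
  have hy0 := orderOf_pos_of_ne_zero hy
  have hyp := orderOf_le_sub_one hy
  have hex : ∃ d, 1 ≤ d ∧ d ∣ orderOf y ∧ ¬ d ∣ orderOf g := ⟨_, hy0, dvd_rfl, hdvd⟩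
  classical
  obtain ⟨d, ⟨d1, d2, d3⟩, dmin⟩ : ∃ d, (1 ≤ d ∧ d ∣ orderOf y ∧ ¬ d ∣ orderOf g) ∧
      ∀ e < d, ¬ (1 ≤ e ∧ e ∣ orderOf y ∧ ¬ e ∣ orderOf g) :=
    ⟨Nat.find hex, Nat.find_spec hex, fun e he => Nat.find_min hex he⟩
  have hd2 : 2 ≤ d := by
    rcases Nat.lt_or_ge d 2 with h | h
    · obtain rfl : d = 1 := by omega
      exact absurd (one_dvd _) d3
    · exact h
  have hdy : d ≤ orderOf y := Nat.le_of_dvd hy0 d2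
  have hcomb := orderOf_combine hy d2 d3 fun e e1 e2 e3 => by
    by_contra h
    exact dmin e e2 ⟨e1, e3, h⟩
  set g' := g ^ (d / d.minFac) * y ^ (orderOf y / d) with hg'
  have hg'0 : g' ≠ 0 := mul_ne_zero (pow_ne_zero _ hg) (pow_ne_zero _ hy)
  have hq := (Nat.minFac_prime (n := d) (by omega)).two_le
  have h2 : 2 * orderOf g ≤ orderOf g' := by
    rw [hcomb, mul_comm]; exact Nat.mul_le_mul_left _ hq
  -- 1/(r + 1) is 1 for r = 0 and 0 otherwise, so the sum vanishes exactly if e divides ord y but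
  -- not ord g: two tests in one comparison.
  have guard : ∀ e, 2 ≤ e → (0 < orderOf y % e + 1 / (orderOf g % e + 1) ↔
      ¬ (e ∣ orderOf y ∧ ¬ e ∣ orderOf g)) := by
    intro e he
    rw [Nat.dvd_iff_mod_eq_zero, Nat.dvd_iff_mod_eq_zero]
    rcases Nat.eq_zero_or_pos (orderOf g % e) with h | h
    · simp [h]
    · rw [Nat.div_eq_of_lt (by omega)]
      omega
  rw [combine, wp_seq, wp_assign]
  refine ⟨by simp; omega, ?_⟩
  rw [wp_seq]
  refine wp_while_count (fun e σ' => Frame [21] [] σ σ' ∧ σ'.var 21 = e ∧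
    σ'.time ≤ σ.time + 20 * e) 2 d hd2 ⟨by simp [Frame.refl], by simp, by simp⟩ ?_ ?_
  · rintro e σ' he1 he2 ⟨hF, e21, t⟩
    have e19 : σ'.var 19 = orderOf y := by rw [hF.var 19 (by simp), v19]
    have e17 : σ'.var 17 = orderOf g := by rw [hF.var 17 (by simp), v17]
    have := Nat.mod_lt (orderOf g) (show 0 < e by omega)
    have := Nat.mod_lt (orderOf y) (show 0 < e by omega)
    have h1 : 1 / (orderOf g % e + 1) ≤ 1 := Nat.div_le_self _ _
    have hpp : p ≤ p * p := Nat.le_mul_of_pos_left _ (by omega)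
    refine ⟨by simp; omega, ?_, ?_, ?_⟩
    · simp [e19, e17, e21]
      omega
    · simp only [Expr.val_add, Expr.val_mod, Expr.val_div, Expr.val_var, Expr.val_ofNat, e19, e17, e21]
      rw [guard e he1]
      exact fun h => dmin e he2 ⟨by omega, h⟩
    · rw [wp_assign]
      exact ⟨by simp; omega, by simpa using hF, by simp [e21], by simp; omega⟩
  rintro σ₁ ⟨F1, e21, t1⟩
  have e19 : σ₁.var 19 = orderOf y := by rw [F1.var 19 (by simp), v19]
  have e17 : σ₁.var 17 = orderOf g := by rw [F1.var 17 (by simp), v17]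
  have e16 : σ₁.var 16 = g.val := by rw [F1.var 16 (by simp), v16]
  have e2 : σ₁.var 2 = p := by rw [F1.var 2 (by simp), v2]
  have e6 : σ₁.mem 6 = σ.mem 6 := F1.mem 6 (by simp)
  have e3 : σ₁.mem 3 = σ.mem 3 := F1.mem 3 (by simp)
  have e4 : σ₁.mem 4 = σ.mem 4 := F1.mem 4 (by simp)
  refine ⟨by simp; omega, ?_, ?_, ?_⟩
  · have := Nat.mod_lt (orderOf g) (show 0 < d by omega)
    have := Nat.mod_lt (orderOf y) (show 0 < d by omega)
    have h1 : 1 / (orderOf g % d + 1) ≤ 1 := Nat.div_le_self _ _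
    have hpp : p ≤ p * p := Nat.le_mul_of_pos_left _ (by omega)
    simp [e19, e17, e21]
    omega
  · simp only [Expr.val_add, Expr.val_mod, Expr.val_div, Expr.val_var, Expr.val_ofNat, e19, e17, e21]
    rw [← not_lt, guard d hd2]
    tauto
  simp only [wp_seq, wp_assign]
  refine ⟨by simp, by simp, by simp, ?_⟩
  refine (wp_walk' hg hW (by simp [e2]) (by simp [e16])).mono ?_
  rintro σ₂ hw2
  have f22 : σ₂.var 22 = d.minFac := by
    rw [hw2.frame.var 22 (by simp)]
    simp [e21, e6, hlp d hd2 (by omega)]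
  have f23 : σ₂.var 23 = (y ^ (orderOf y / d)).val := by
    rw [hw2.frame.var 23 (by simp)]
    simp [e21, e19, e3, (ht _ (Nat.div_lt_self hy0 hd2)).1]
  have f21 : σ₂.var 21 = d := by rw [hw2.frame.var 21 (by simp)]; simp [e21]
  have f17 : σ₂.var 17 = orderOf g := by rw [hw2.frame.var 17 (by simp)]; simp [e17]
  have f2 : σ₂.var 2 = p := by rw [hw2.frame.var 2 (by simp)]; simp [e2]
  have f3 : σ₂.mem 3 (d / d.minFac % orderOf g) = (g ^ (d / d.minFac)).val := by
    rw [(hw2.tables _ (Nat.mod_lt _ hg0)).1, pow_mod_orderOf]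
  have hmul : (y ^ (orderOf y / d)).val * (g ^ (d / d.minFac)).val ≤ p * p :=
    Nat.mul_le_mul (ZMod.val_lt _).le (ZMod.val_lt _).le
  have hval : (y ^ (orderOf y / d)).val * (g ^ (d / d.minFac)).val % p = g'.val := by
    rw [← ZMod.val_mul, mul_comm]
  simp only [wp_seq, wp_assign]
  refine ⟨by simp [f22, f23, f21, f17, f3]; omega, ?_⟩
  refine (wp_walk' hg'0 hW (by simp [f2]) (by simp [f22, f23, f21, f17, f3, f2, hval])).mono ?_
  rintro σ₃ hw3
  have F3 : Frame [13, 14, 15, 16, 21, 22, 23] [3, 4] σ σ₃ := by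
    have F1' : Frame [13, 14, 15, 16, 21, 22, 23] [3, 4] σ σ₁ :=
      F1.weaken (by simp) (by simp)
    have F2' : Frame [13, 14, 15, 16, 21, 22, 23] [3, 4] σ σ₂ := by
      refine Frame.trans ?_ (hw2.frame.weaken (by simp) (by simp))
      simpa using F1'
    refine Frame.trans ?_ (hw3.frame.weaken (by simp) (by simp))
    simpa using F2'
  have hm1 : ∀ {Q}, Marked p Q σ → Marked p Q σ₁ := fun h x h1 h2 h3 => h x h1 h2 (by rwa [← e4])
  have t2 := hw2.time
  have t3 := hw3.time
  have hdle : d ≤ 2 * orderOf g := by omega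
  have h15 : σ₃.var 15 = g'.val := by
    rw [hw3.frame.var 15 (by simp)]
    simp [f22, f23, f21, f17, f3, f2, hval]
  rw [wp_assign]
  refine ⟨by simp, by simpa using F3, g', hg'0, h2, by simp [h15], by simpa using hw3.order,
    hw3.tables, fun Q q1 q2 hm => ?_, fun x hx => ?_, ?_⟩
  · exact hw3.marked q2 (hw2.marked q1 (hm1 hm))
  · have : σ₁.mem 4 x < p := by rwa [e4]
    exact hw3.lt_of_lt hg'0 (hw2.lt_of_lt hg this)
  · simp at t1 t2 t3 ⊢
    omega

/-- The variables that `generator` changes. -/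
abbrev generatorVars : List ℕ := [13, 14, 15, 16, 17, 18, 19, 20, 21, 22, 23]

/-- The invariant of the main loop of `generator`. -/
structure GeneratorState (p : ℕ) (σ : Env) (g : ZMod p) : Prop where
  ne_zero : g ≠ 0
  v16 : σ.var 16 = g.val
  v17 : σ.var 17 = orderOf g
  tables : PowTables g (orderOf g) σ
  y_pos : 1 ≤ σ.var 18
  y_lt : σ.var 18 < p
  -- Marks are never removed, though their logarithms may become stale, so the scan only moves
  -- forward and costs O(p) in all.
  below : ∀ z, 1 ≤ z → z < σ.var 18 → σ.mem 4 z < p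
  -- Until g is a generator no generator is marked, so the scan for an unmarked element cannot leave
  -- the table.
  marked : Marked p (SmallOrder p (orderOf g = p - 1)) σ

/-- Move the variable 18 to the next number that is not marked. -/
theorem wp_next {W : ℕ} {ω : Coins} {σ : Env} {g : ZMod p} (hW : p + 1 < W)
    (v2 : σ.var 2 = p) (h : GeneratorState p σ g) (ho : orderOf g ≠ p - 1) :
    (Cmd.while (.ld 4 (.var 18)) (.var 2) (18 ::= .var 18 + 1)).Wp W ω
      (fun σ' => Frame [18] [] σ σ' ∧ GeneratorState p σ' g ∧ p ≤ σ'.mem 4 (σ'.var 18) ∧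
        σ'.time + 20 * σ.var 18 ≤ σ.time + 20 * σ'.var 18 + 20) σ := by
  obtain ⟨x, hx0, hx⟩ := exists_orderOf_eq_sub_one (p := p)
  refine wp_while (fun σ' => Frame [18] [] σ σ' ∧ GeneratorState p σ' g ∧
    σ'.time + 20 * σ.var 18 ≤ σ.time + 20 * σ'.var 18) (fun σ' => p - σ'.var 18)
    ⟨Frame.refl _ _ _, h, le_rfl⟩ ?_
  rintro σ' ⟨hF, hS, ht⟩
  have e2 : σ'.var 2 = p := by rw [hF.var 2 (by simp), v2]
  have hlt := hS.y_lt
  refine ⟨by simp, by simp, fun h1 => ?_, fun h1 => ?_⟩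
  · simp only [Expr.val_ld, Expr.val_var, e2] at h1
    have hmk : ∀ z, 1 ≤ z → z < σ'.var 18 + 1 → σ'.mem 4 z < p := fun z z1 z2 => by
      rcases Nat.lt_succ_iff_lt_or_eq.1 z2 with z2 | rfl
      · exact hS.below z z1 z2
      · exact h1
    have hlt' : σ'.var 18 + 1 < p := by
      by_contra hc
      have hxp := ZMod.val_lt x
      have hx1 : 1 ≤ x.val := Nat.one_le_iff_ne_zero.2 (by rwa [ne_eq, ZMod.val_eq_zero])
      have := hS.marked x.val hx1 hxp (hmk _ hx1 (by omega))
      rw [ZMod.natCast_zmod_val] at this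
      rcases this with h | h
      · omega
      · exact ho h
    rw [wp_assign]
    refine ⟨by simp; omega, ⟨by simpa using hF, ⟨hS.ne_zero, by simpa using hS.v16,
      by simpa using hS.v17, hS.tables, by simp, by simpa using hlt', by simpa using hmk,
      hS.marked⟩, by simp; omega⟩, by simp; omega⟩
  · simp only [Expr.val_ld, Expr.val_var, e2] at h1
    exact ⟨by simpa using hF, ⟨hS.ne_zero, hS.v16, hS.v17, hS.tables, hS.y_pos, hS.y_lt, hS.below,
      hS.marked⟩, by simpa using h1, by simp; omega⟩

theorem wp_generator {W : ℕ} {ω : Coins} {σ : Env} (hW : p * p + p < W) (v2 : σ.var 2 = p)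
    (hlp : ∀ n, 2 ≤ n → n ≤ p → σ.mem 6 n = n.minFac) :
    generator.Wp W ω (fun σ' => Frame generatorVars [3, 4] σ σ' ∧
      (∃ g : ZMod p, g ≠ 0 ∧ orderOf g = p - 1 ∧ σ'.var 16 = g.val ∧ PowTables g (p - 1) σ') ∧
      σ'.time ≤ σ.time + 3000 * p) σ := by
  have hp := (Fact.out : p.Prime).one_lt
  have : Fact (1 < p) := ⟨hp⟩
  have hpp : 2 * p ≤ p * p := Nat.mul_le_mul_right _ hp
  have hpW : p + 1 < W := by omega
  rw [generator, wp_seq]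
  refine (wp_fill p id (fun _ => p) (by omega) (fun _ _ _ _ h => h)
    (fun i hi σ' hF h20 => by simp [hF.var, v2])
    (fun i hi σ' hF h20 => by simp [hF.var, v2, h20])).mono ?_
  rintro σ₁ ⟨F1, hz, -, -, t1⟩
  simp only [wp_seq, wp_assign]
  refine ⟨by simp; omega, by simp; omega, ?_⟩
  refine (wp_walk' (g := (1 : ZMod p)) one_ne_zero hW (by simp [F1.var, v2])
    (by simp [ZMod.val_one p])).mono ?_
  rintro σ₂ hw2
  simp only [wp_seq, wp_assign]
  refine ⟨by simp, by simp; omega, ?_⟩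
  have F2 : Frame generatorVars [3, 4] σ σ₂ := by
    refine Frame.trans ?_ (hw2.frame.weaken (by simp) (by simp))
    simpa using F1.weaken (vs' := generatorVars) (as' := [3, 4]) (by simp) (by simp)
  have t2 := hw2.time
  simp at t1 t2
  have small : ∀ {g : ZMod p}, g ≠ 0 → ∀ i, SmallOrder p (orderOf g = p - 1) (g ^ i) := by
    intro g hg
    refine smallOrder_pow hg ?_
    rcases (orderOf_le_sub_one hg).lt_or_eq with h | h
    · exact Or.inl h
    · exact Or.inr h
  -- A round costs O(new order), and since the order at least doubles, 1000 times its increase pays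
  -- for that; moves of the pointer pay for the scan.
  refine wp_while (fun σ' => Frame generatorVars [3, 4] σ σ' ∧ ∃ g : ZMod p,
    GeneratorState p σ' g ∧ σ'.time ≤ σ.time + 20 * p + 200 + 1000 * orderOf g + 20 * σ'.var 18)
    (fun σ' => p - σ'.var 17) ⟨by simpa using F2, 1, ⟨one_ne_zero, ?_, ?_, hw2.tables, by simp,
      by simpa using hp, ?_, hw2.marked (small one_ne_zero) ?_⟩, ?_⟩ ?_
  · rw [Env.tick_var, Env.set_var, if_neg (by norm_num), Env.tick_var, Env.set_var,
      if_neg (by norm_num), hw2.frame.var 16 (by simp)]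
    simp [ZMod.val_one p]
  · simp [hw2.order]
  · intro z h1 h2
    simp at h2
    omega
  · intro x hx1 hx2 hx3
    have := hz x hx2
    simp at this hx3
    omega
  · simp
    omega
  rintro σ' ⟨hF, g, hS, ht⟩
  have e2 : ∀ {σ'}, Frame generatorVars [3, 4] σ σ' → σ'.var 2 = p := fun h => by simp [h.var, v2]
  have hle := orderOf_le_sub_one hS.ne_zero
  have hgp := orderOf_pos_of_ne_zero hS.ne_zero
  refine ⟨by simp, by simp [e2 hF]; omega, fun hlt => ?_, fun hge => ?_⟩
  swap
  · simp only [Expr.val_var, Expr.val_sub, Expr.val_ofNat, e2 hF, hS.v17] at hge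
    have h1 : orderOf g = p - 1 := by omega
    refine ⟨by simpa using hF, ⟨g, hS.ne_zero, h1, by simpa using hS.v16, h1 ▸ hS.tables⟩, ?_⟩
    have := hS.y_lt
    simp
    omega
  simp only [Expr.val_var, Expr.val_sub, Expr.val_ofNat, e2 hF, hS.v17] at hlt
  rw [wp_seq]
  refine (wp_next (p := p) (g := g)
    (σ := σ'.tick ((Expr.var 17).cost + (Expr.var 2 - 1).cost + 1)) hpW (by simpa using e2 hF) ⟨hS.ne_zero, by simpa using hS.v16,
    by simpa using hS.v17, hS.tables, by simpa using hS.y_pos, by simpa using hS.y_lt,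
    by simpa using hS.below, hS.marked⟩ (by omega)).mono ?_
  rintro σ₃ ⟨F3, hS3, hun, t3⟩
  have F3' : Frame generatorVars [3, 4] σ σ₃ :=
    Frame.trans (by simpa using hF) (F3.weaken (by simp) (by simp))
  obtain ⟨y, hyv⟩ : ∃ y : ZMod p, y.val = σ₃.var 18 :=
    ⟨(σ₃.var 18 : ZMod p), ZMod.val_cast_of_lt hS3.y_lt⟩
  have hy : y ≠ 0 := by
    rintro rfl
    have := hS3.y_pos
    rw [ZMod.val_zero] at hyv
    omega
  have hdvd : ¬ orderOf y ∣ orderOf g := fun h => by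
    obtain ⟨i, hi, rfl⟩ := exists_pow_eq_of_orderOf_dvd hS3.ne_zero h
    rw [← hyv, (hS3.tables i hi).2] at hun
    omega
  have hyp := orderOf_le_sub_one hy
  rw [wp_seq, wp_assign]
  refine ⟨by simp, ?_⟩
  rw [wp_seq]
  refine (wp_walk' hy hW (by simpa using e2 F3') (by simpa using hyv.symm)).mono ?_
  rintro σ₄ hw4
  have F4 : Frame generatorVars [3, 4] σ σ₄ := by
    refine Frame.trans ?_ (hw4.frame.weaken (by simp) (by simp))
    simpa using F3'
  have f17 : σ₄.var 17 = orderOf g := by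
    rw [hw4.frame.var 17 (by simp)]; simpa using hS3.v17
  have f16 : σ₄.var 16 = g.val := by
    rw [hw4.frame.var 16 (by simp)]; simpa using hS3.v16
  have f15 : σ₄.var 15 = y.val := by
    rw [hw4.frame.var 15 (by simp)]; simpa using hyv.symm
  have f18 : σ₄.var 18 = σ₃.var 18 := by
    rw [hw4.frame.var 18 (by simp)]; simp
  have t4 := hw4.time
  rw [wp_seq, wp_assign]
  refine ⟨by simp, ?_⟩
  have below4 : ∀ z, 1 ≤ z → z < σ₃.var 18 → σ₄.mem 4 z < p := fun z h1 h2 =>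
    hw4.lt_of_lt hy (by simpa using hS3.below z h1 h2)
  rw [wp_seq, wp_ite]
  refine ⟨by simp, by simp [f17]; omega, fun hlt' => ?_, fun hge' => ?_⟩
  · simp [f17, hw4.order] at hlt'
    refine (wp_combine hS.ne_zero hy hW (by simpa using e2 F4) (by simpa using f16)
      (by simpa using f17) (by simp [hw4.order]) (by exact hw4.tables) hdvd hlt'
      (fun n h1 h2 => ?_)).mono ?_
    · simp only [Env.tick_mem, Env.set_mem]
      rw [F4.mem 6 (by simp)]
      exact hlp n h1 h2
    rintro σ₅ ⟨F5, g', hg', h2, v16, v14, tab, mk, blw, t5⟩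
    have F5' : Frame generatorVars [3, 4] σ σ₅ := by
      refine Frame.trans ?_ (F5.weaken (by simp) (by simp))
      simpa using F4
    have g18 : σ₅.var 18 = σ₃.var 18 := by rw [F5.var 18 (by simp)]; simpa using f18
    rw [wp_assign]
    refine ⟨by simp, ⟨by simpa using F5', g', ⟨hg', by simpa using v16, by simpa using v14, tab,
      ?_, ?_, ?_, ?_⟩, ?_⟩, ?_⟩
    · simpa [g18] using hS3.y_pos
    · simpa [g18] using hS3.y_lt
    · intro z h1 h2
      simp [g18] at h2
      exact blw z (by simpa using below4 z h1 h2)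
    -- The order of a non-generator is at most (p - 1)/2, so ord y < 2 ord g ≤ p - 1: marking the
    -- powers of y marks no generator.
    · have ylt : orderOf y < p - 1 := by
        have := two_mul_orderOf_le hS.ne_zero (by omega)
        omega
      refine mk _ (smallOrder_pow hS.ne_zero (Or.inl (by omega))) (small hg') ?_
      refine hw4.marked (smallOrder_pow hy (Or.inl ylt)) ?_
      exact fun x h1 h2 h3 => Or.inl (((hS3.marked x h1 h2 h3).resolve_right (by omega)))
    · simp [g18] at t3 t4 t5 ⊢
      omega
    · simp [v14, hS.v17]
      have := orderOf_le_sub_one hg'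
      omega
  · simp [f17, hw4.order] at hge'
    rw [wp_assign]
    refine ⟨by simp, ?_⟩
    rw [wp_assign]
    refine ⟨by simp, ⟨by simpa using F4, y, ⟨hy, by simpa using f15, by simpa using hw4.order,
      hw4.tables, ?_, ?_, ?_, ?_⟩, ?_⟩, ?_⟩
    · simpa [f18] using hS3.y_pos
    · simpa [f18] using hS3.y_lt
    · simpa [f18] using below4
    · refine hw4.marked (small hy) ?_
      exact fun x h1 h2 h3 => Or.inl (((hS3.marked x h1 h2 h3).resolve_right (by omega)))
    · simp [f18] at t3 t4 ⊢
      omega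
    · simp [hw4.order, hS.v17]
      omega

end WordRAM

/-! ### Logarithms, random draws and the number of buckets -/

namespace WordRAM
open Cmd

/-- The variable 6 becomes the rounded-up binary logarithm of the variable 1. -/
def logUp : Cmd :=
  6 ::= 0 ;; 25 ::= 1 ;; .while (.var 25) (.var 1) (25 ::= .var 25 * 2 ;; 6 ::= .var 6 + 1)

theorem wp_logUp {W : ℕ} {ω : Coins} {σ : Env} {k : ℕ} (hk : 2 ≤ k) (hW : 2 * k + 2 < W)
    (v1 : σ.var 1 = k) :
    logUp.Wp W ω (fun σ' => Frame [6, 25] [] σ σ' ∧ σ'.var 6 = Nat.clog 2 k ∧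
      σ'.draws = σ.draws ∧ σ'.time ≤ σ.time + 20 * Nat.clog 2 k + 20) σ := by
  simp only [logUp, wp_seq, wp_assign]
  refine ⟨by simp; omega, by simp; omega, ?_⟩
  refine wp_while_count (fun i σ' => Frame [6, 25] [] σ σ' ∧ σ'.var 6 = i ∧ σ'.var 25 = 2 ^ i ∧
    σ'.draws = σ.draws ∧ σ'.time ≤ σ.time + 20 * i + 10) 0 (Nat.clog 2 k) (Nat.zero_le _) ?_ ?_ ?_
  · simp [Frame.refl]
  · rintro i σ' - hi ⟨hF, e6, e25, hd, ht⟩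
    have e1 : σ'.var 1 = k := by rw [hF.var 1 (by simp), v1]
    have hlt : 2 ^ i < k := (Nat.lt_clog_iff_pow_lt (by norm_num)).1 hi
    have : i < 2 ^ i := Nat.lt_two_pow_self
    refine ⟨by simp, by simp, by simp [e1, e25, hlt], ?_⟩
    simp only [wp_seq, wp_assign]
    exact ⟨by simp [e25]; omega, by simp [e6]; omega, by simp [hF], by simp [e6],
      by simp [e25, pow_succ], by simp [hd], by simp; omega⟩
  · rintro σ' ⟨hF, e6, e25, hd, ht⟩
    have e1 : σ'.var 1 = k := by rw [hF.var 1 (by simp), v1]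
    refine ⟨by simp, by simp, ?_, by simpa using hF, by simpa using e6, by simpa using hd,
      by simp; omega⟩
    simp only [Expr.val_var, e1, e25]
    exact Nat.le_pow_clog (by norm_num) k

/-- Fill the array `A` with random draws. -/
def drawTo (A : ℕ) (cnt bd : Expr) : Cmd :=
  20 ::= 0 ;;
  .while (.var 20) cnt (.rand 22 bd ;; .store A (.var 20) (.var 22) ;; 20 ::= .var 20 + 1)

theorem wp_drawTo {W : ℕ} {ω : Coins} {A : ℕ} {cnt bd : Expr} {σ : Env} (n b : ℕ) (hW : n + 1 < W)
    (hc : ∀ σ', Frame [20, 22] [A] σ σ' → cnt.Safe W σ' ∧ cnt.val σ' = n)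
    (hb : ∀ σ', Frame [20, 22] [A] σ σ' → bd.Safe W σ' ∧ bd.val σ' = b) :
    (drawTo A cnt bd).Wp W ω (fun σ' => Frame [20, 22] [A] σ σ' ∧
      (∀ i < n, σ'.mem A i = ω (σ.draws + i) b) ∧ σ'.draws = σ.draws + n ∧
      σ'.time ≤ σ.time + (n + 1) * (cnt.cost + bd.cost + 20)) σ := by
  simp only [drawTo, wp_seq, wp_assign]
  refine ⟨by simp; omega, wp_while_count (fun m σ' => Frame [20, 22] [A] σ σ' ∧ σ'.var 20 = m ∧
    (∀ i < m, σ'.mem A i = ω (σ.draws + i) b) ∧ σ'.draws = σ.draws + m ∧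
      σ'.time ≤ σ.time + 2 + m * (cnt.cost + bd.cost + 20)) 0 n (Nat.zero_le _) ?_ ?_ ?_⟩
  · simp [Frame.refl]
  · rintro i σ' - hi ⟨hF, h20, h1, hd, ht⟩
    obtain ⟨b1, b2⟩ := hc σ' hF
    obtain ⟨c1, c2⟩ := hb (σ'.tick ((Expr.var 20).cost + cnt.cost + 1)) (by simpa using hF)
    simp only [Expr.cost_var] at c1 c2
    refine ⟨by simp, b1, by simp [h20, b2, hi], ?_⟩
    simp only [wp_seq, wp_store, wp_assign, wp_rand]
    refine ⟨c1, by simp, by simp, by simp [h20]; omega, by simp [hF], by simp [h20],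
      fun j hj => ?_, by simp [hd]; omega, ?_⟩
    · rcases Nat.lt_succ_iff_lt_or_eq.1 hj with hj | rfl
      · simp [h20, hj.ne, h1 j hj]
      · simp [h20, hd]
        rw [c2]
    · simp [add_mul] at ht ⊢
      omega
  · rintro σ' ⟨hF, h20, h1, hd, ht⟩
    obtain ⟨b1, b2⟩ := hc σ' hF
    refine ⟨by simp, b1, by simp [h20, b2], by simpa using hF, by simpa using h1,
      by simpa using hd, ?_⟩
    simp [add_mul] at ht ⊢
    omega

/-- The variables 4 and 5 become close upper and lower approximations to the number of buckets. -/
def approxBuckets : Cmd :=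
  27 ::= .var 1 * .var 1 ;; 27 ::= .var 27 * .var 27 ;; 27 ::= .var 27 * .var 27 ;;
  27 ::= .var 27 * .var 27 ;; 27 ::= .var 27 * .var 27 ;; 27 ::= .var 27 * .var 27 ;;
  24 ::= 0 ;; 25 ::= 1 ;;
  .while (.var 25 * 2) (.var 27 + 1) (25 ::= .var 25 * 2 ;; 24 ::= .var 24 + 1) ;;
  4 ::= 64 * .var 1 / .var 24 + 1 ;; 5 ::= 64 * .var 1 / (.var 24 + 1)

/-- The variables that `approxBuckets` changes. -/
abbrev approxVars : List ℕ := [4, 5, 24, 25, 27]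

/-- Integer arithmetic reaches ⌊64 log k⌋ as the binary logarithm of k^64, which fits in a word
because the word size may be polynomial in k with any fixed exponent. -/
theorem wp_approxBuckets {W : ℕ} {ω : Coins} {σ : Env} {k : ℕ} (hk : 2 ≤ k)
    (hW : 2 * k ^ 64 + 2 < W) (v1 : σ.var 1 = k) :
    approxBuckets.Wp W ω (fun σ' => Frame approxVars [] σ σ' ∧
      (∃ M, 2 ^ M ≤ k ^ 64 ∧ k ^ 64 < 2 ^ (M + 1) ∧ σ'.var 4 = 64 * k / M + 1 ∧
        σ'.var 5 = 64 * k / (M + 1)) ∧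
      σ'.time ≤ σ.time + 20 * Nat.log 2 (k ^ 64) + 100) σ := by
  have pw : ∀ {i j}, i ≤ j → k ^ i ≤ k ^ j := fun h => Nat.pow_le_pow_right (by omega) h
  have p2 := pw (show 2 ≤ 64 by norm_num)
  have p4 := pw (show 4 ≤ 64 by norm_num)
  have p8 := pw (show 8 ≤ 64 by norm_num)
  have p16 := pw (show 16 ≤ 64 by norm_num)
  have p32 := pw (show 32 ≤ 64 by norm_num)
  have q : ∀ i, k ^ i * k ^ i = k ^ (2 * i) := fun i => by rw [← pow_add, two_mul]
  have q2 : k * k = k ^ 2 := (sq k).symm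
  have q4 := q 2
  have q8 := q 4
  have q16 := q 8
  have q32 := q 16
  have q64 := q 32
  norm_num at q4 q8 q16 q32 q64
  have h64 : 64 * k ≤ k ^ 64 := by
    calc 64 * k ≤ 2 ^ 63 * k := Nat.mul_le_mul_right _ (by norm_num)
      _ ≤ k ^ 63 * k := Nat.mul_le_mul_right _ (Nat.pow_le_pow_left hk 63)
      _ = k ^ 64 := (pow_succ k 63).symm
  have hlogself : Nat.log 2 (k ^ 64) ≤ k ^ 64 := Nat.log_le_self _ _
  simp only [approxBuckets, wp_seq, wp_assign]
  refine ⟨by simp [v1, q2]; omega, by simp [v1, q2, q4]; omega, by simp [v1, q2, q4, q8]; omega,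
    by simp [v1, q2, q4, q8, q16]; omega, by simp [v1, q2, q4, q8, q16, q32]; omega,
    by simp [v1, q2, q4, q8, q16, q32, q64]; omega, by simp; omega, by simp; omega, ?_⟩
  refine wp_while_count (fun i σ' => Frame approxVars [] σ σ' ∧ σ'.var 24 = i ∧
    σ'.var 25 = 2 ^ i ∧ σ'.var 27 = k ^ 64 ∧ σ'.time ≤ σ.time + 20 * i + 60) 0
    (Nat.log 2 (k ^ 64)) (Nat.zero_le _) ?_ ?_ ?_
  · simp [Frame.refl, v1, q2, q4, q8, q16, q32, q64]
  · rintro i σ' - hi ⟨hF, e24, e25, e27, ht⟩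
    have hlt : 2 ^ (i + 1) ≤ k ^ 64 := Nat.pow_le_of_le_log (by positivity) hi
    rw [pow_succ] at hlt
    refine ⟨by simp [e25]; omega, by simp [e27]; omega, by simp [e25, e27]; omega, ?_⟩
    simp only [wp_seq, wp_assign]
    exact ⟨by simp [e25]; omega, by simp [e24]; omega, by simp [hF], by simp [e24],
      by simp [e25, pow_succ], by simp [e27], by simp; omega⟩
  · rintro σ' ⟨hF, e24, e25, e27, ht⟩
    have e1 : σ'.var 1 = k := by rw [hF.var 1 (by simp), v1]
    have h1 : 2 ^ Nat.log 2 (k ^ 64) ≤ k ^ 64 := Nat.pow_log_le_self 2 (by positivity)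
    have h2 : k ^ 64 < 2 ^ (Nat.log 2 (k ^ 64) + 1) := Nat.lt_pow_succ_log_self (by norm_num) _
    have h3 : 2 ^ Nat.log 2 (k ^ 64) * 2 = 2 ^ (Nat.log 2 (k ^ 64) + 1) := (pow_succ _ _).symm
    have d1 := Nat.div_le_self (64 * k) (Nat.log 2 (k ^ 64))
    refine ⟨by simp [e25]; omega, by simp [e27]; omega, by simp [e25, e27]; omega, ?_⟩
    simp only [wp_seq, wp_assign]
    refine ⟨by simp [e1, e24]; omega, by simp [e1, e24]; omega, by simp [hF],
      ⟨_, h1, h2, by simp [e1, e24], by simp [e1, e24]⟩, by simp; omega⟩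

/-- The exact number of buckets, for values of the variable 1 below `n`. -/
noncomputable def bucketTable : ℕ → Cmd
  | 0 => .skip
  | n + 1 => bucketTable n ;;
    -- The guard says n ≤ k, so larger entries overwrite smaller ones and the entry for n = k
    -- prevails.
    .ite (.lit n) (.var 1 + 1) (4 ::= .lit (TLE.buckets n) ;; 5 ::= .lit (TLE.buckets n)) .skip

theorem wp_bucketTable {W : ℕ} {ω : Coins} {σ : Env} (n : ℕ) (hW : σ.var 1 + 1 < W)
    (hn : ∀ i < n, i < W ∧ TLE.buckets i < W) :
    (bucketTable n).Wp W ω (fun σ' => Frame [4, 5] [] σ σ' ∧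
      (σ.var 1 < n → σ'.var 4 = TLE.buckets (σ.var 1) ∧ σ'.var 5 = TLE.buckets (σ.var 1)) ∧
      σ'.time ≤ σ.time + 20 * n) σ := by
  induction n with
  | zero => simp [bucketTable, Frame.refl]
  | succ n ih =>
    rw [bucketTable, wp_seq]
    refine (ih fun i hi => hn i (by omega)).mono ?_
    rintro σ' ⟨hF, hv, ht⟩
    have e1 : σ'.var 1 = σ.var 1 := hF.var 1 (by simp)
    obtain ⟨n1, n2⟩ := hn n (by omega)
    simp only [wp_ite, wp_seq, wp_assign, wp_skip]
    refine ⟨by simpa using n1, by simp [e1]; omega, fun hlt => ⟨by simpa using n2,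
      by simpa using n2, by simp [hF], fun h => ?_, by simp; omega⟩, fun hle =>
        ⟨by simpa using hF, fun h => ?_, by simp; omega⟩⟩
    · simp [e1] at hlt
      obtain h' : σ.var 1 = n := by omega
      simp [h']
    · simp [e1] at hle
      simpa using hv (by omega)

end WordRAM

/-! ### The pre-processing program -/

namespace WordRAM
open Cmd

theorem le_logCeil_mul_buckets {k : ℕ} (hk : 2 ≤ k) : k ≤ TLE.logCeil k * TLE.buckets k := by
  have hX := one_le_logb hk
  have h1 : logb 2 (k : ℝ) ≤ TLE.logCeil k := Nat.le_ceil _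
  have h2 : (k : ℝ) / logb 2 k ≤ TLE.buckets k := Nat.le_ceil _
  have h3 : (k : ℝ) ≤ TLE.logCeil k * TLE.buckets k := by
    calc (k : ℝ) = logb 2 k * (k / logb 2 k) := by field_simp
      _ ≤ _ := mul_le_mul h1 h2 (by positivity) (Nat.cast_nonneg _)
  exact_mod_cast h3

theorem buckets_pos {k : ℕ} (hk : 2 ≤ k) : 0 < TLE.buckets k := by
  have := le_logCeil_mul_buckets hk
  rcases Nat.eq_zero_or_pos (TLE.buckets k) with h | h
  · rw [h] at this; omega
  · exact h

/-- Supplies 2k + 2 < p, so that a residue of size r ≤ k is recognized by being r or -r. -/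
theorem mul_le_primeBound {k : ℕ} (hk : 2 ≤ k) : 480 * k < TLE.primeBound k := by
  have h := le_logCeil_mul_buckets hk
  rw [primeBound_eq, Nat.lt_succ_iff]
  have h1 : 24 ≤ TLE.sparsity k := by rw [sparsity_eq]; omega
  have h2 : 5 * TLE.logCeil k ≤ TLE.sparsity k := by rw [sparsity_eq]; omega
  calc 480 * k ≤ 480 * (TLE.logCeil k * TLE.buckets k) := Nat.mul_le_mul_left _ h
    _ = 4 * (24 * (5 * TLE.logCeil k)) * TLE.buckets k := by ring
    _ ≤ 4 * (TLE.sparsity k * TLE.sparsity k) * TLE.buckets k := by gcongr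
    _ = _ := by ring

theorem sparsity_mul_lt_primeBound {k : ℕ} (hk : 2 ≤ k) : 96 * TLE.sparsity k < TLE.primeBound k := by
  rw [primeBound_eq, Nat.lt_succ_iff]
  have h1 : 24 ≤ TLE.sparsity k := by rw [sparsity_eq]; omega
  have h2 := buckets_pos hk
  calc 96 * TLE.sparsity k = 4 * (24 * TLE.sparsity k) * 1 := by ring
    _ ≤ 4 * (TLE.sparsity k * TLE.sparsity k) * TLE.buckets k := by gcongr; omega
    _ = _ := by ring

theorem BucketBounds.bounds {k Bp Bm : ℕ} (h : BucketBounds k Bp Bm) :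
    4 * TLE.sparsity k ^ 2 * Bp + 1 ≤ 2 * (4 * TLE.sparsity k ^ 2 * Bm + 1) ∧
    2 * (4 * TLE.sparsity k ^ 2 * Bm + 1) ≤ 2 * TLE.primeBound k ∧
    TLE.primeBound k ≤ 4 * TLE.sparsity k ^ 2 * Bp + 1 := by
  obtain ⟨p, -, h1, h2⟩ := h.exists_prime
  refine ⟨h1.trans h2, ?_, ?_⟩
  · rw [primeBound_eq]
    have := Nat.mul_le_mul_left (4 * TLE.sparsity k ^ 2) h.lower_le
    omega
  · rw [primeBound_eq]
    have := Nat.mul_le_mul_left (4 * TLE.sparsity k ^ 2) h.le_upper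
    omega

/-- Compute the parameters and draw the hash functions. -/
noncomputable def parameters (K : ℕ) : Cmd :=
  1 ::= .ld 0 0 ;; logUp ;; 7 ::= 2 * .var 6 + 12 ;; drawTo 1 (.var 7) (.ld 0 1 - 1) ;;
  drawTo 2 2 (.ld 0 2 - 1) ;; 3 ::= 5 * .var 6 + 24 ;; approxBuckets ;;
  .ite (.var 1) (.lit K) (bucketTable K) .skip

/-- The variables that `parameters` changes. -/
abbrev parameterVars : List ℕ := [1, 3, 4, 5, 6, 7, 20, 22, 24, 25, 27]

theorem wp_parameters {W : ℕ} {ω : Coins} {σ : Env} {k K l₁ l₂ : ℕ} (hk : 2 ≤ k)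
    (hW : 2 * k ^ 64 + 2 < W) (hs : 20 * TLE.sparsity k + 20 < W) (hKW : K < W)
    (hKB : ∀ i < K, TLE.buckets i < W)
    (hK : ∀ M, K ≤ k → 2 ^ M ≤ k ^ 64 → k ^ 64 < 2 ^ (M + 1) →
      BucketBounds k (64 * k / M + 1) (64 * k / (M + 1)))
    (m0 : σ.mem 0 0 = k) (m1 : σ.mem 0 1 = l₁) (m2 : σ.mem 0 2 = l₂) (h1 : 0 < l₁) (h2 : 0 < l₂)
    (hd : σ.draws = 0) :
    (parameters K).Wp W ω (fun σ' => Frame parameterVars [1, 2] σ σ' ∧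
      σ'.var 1 = k ∧ σ'.var 3 = TLE.sparsity k ∧ BucketBounds k (σ'.var 4) (σ'.var 5) ∧
      (∀ i < TLE.indep k, σ'.mem 1 i = ω i (l₁ - 1)) ∧
      (∀ i < 2, σ'.mem 2 i = ω (TLE.indep k + i) (l₂ - 1)) ∧
      σ'.time ≤ σ.time + 500 * TLE.sparsity k + 500 + 20 * K) σ := by
  have hs' := sparsity_eq k
  have ht' : TLE.indep k = 2 * TLE.logCeil k + 12 := rfl
  have hkk : k ≤ k ^ 64 := Nat.le_self_pow (by norm_num) k
  have hlog : Nat.log 2 (k ^ 64) ≤ 64 * TLE.logCeil k := by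
    rw [logCeil_eq_clog]
    calc Nat.log 2 (k ^ 64) ≤ Nat.log 2 ((2 ^ Nat.clog 2 k) ^ 64) :=
          Nat.log_mono_right (Nat.pow_le_pow_left (Nat.le_pow_clog (by norm_num) k) 64)
      _ = 64 * Nat.clog 2 k := by rw [← pow_mul, Nat.log_pow (by norm_num), mul_comm]
  have hW1 : 1 < W := by omega
  rw [parameters, wp_seq, wp_assign]
  refine ⟨by simp; omega, ?_⟩
  rw [wp_seq]
  refine (wp_logUp hk (by omega) (by simp [m0])).mono ?_
  rintro σ₁ ⟨F1, e6, d1, t1⟩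
  rw [← logCeil_eq_clog] at e6 t1
  have F1' : Frame parameterVars [1, 2] σ σ₁ := by
    refine Frame.trans ?_ (F1.weaken (by simp) (by simp))
    simp [Frame.refl]
  have e1 : σ₁.var 1 = k := by rw [F1.var 1 (by simp)]; simp [m0]
  rw [wp_seq, wp_assign]
  refine ⟨by simp [e6]; omega, ?_⟩
  rw [wp_seq]
  refine (wp_drawTo (TLE.indep k) (l₁ - 1) (by omega)
    (fun σ' hF => ⟨by simp, by simp [hF.var, e6, ht']⟩)
    (fun σ' hF => ⟨by simp [hF.mem, F1'.mem, m1, hW1]; omega, by simp [hF.mem, F1'.mem, m1]⟩)).mono ?_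
  rintro σ₂ ⟨F2, h2m, d2, t2⟩
  have F2' : Frame parameterVars [1, 2] σ σ₂ := by
    refine Frame.trans ?_ (F2.weaken (by simp) (by simp))
    simpa using F1'
  rw [wp_seq]
  refine (wp_drawTo 2 (l₂ - 1) (by omega) (fun σ' hF => ⟨by simp; omega, by simp⟩)
    (fun σ' hF => ⟨by simp [hF.mem, F2'.mem, m2, hW1]; omega, by simp [hF.mem, F2'.mem, m2]⟩)).mono ?_
  rintro σ₃ ⟨F3, h3m, d3, t3⟩
  have F3' : Frame parameterVars [1, 2] σ σ₃ := F2'.trans (F3.weaken (by simp) (by simp))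
  have g6 : σ₃.var 6 = TLE.logCeil k := by
    rw [F3.var 6 (by simp), F2.var 6 (by simp)]; simpa using e6
  have g1 : σ₃.var 1 = k := by rw [F3.var 1 (by simp), F2.var 1 (by simp)]; simpa using e1
  rw [wp_seq, wp_assign]
  refine ⟨by simp [g6]; omega, ?_⟩
  rw [wp_seq]
  refine (wp_approxBuckets hk hW (by simpa using g1)).mono ?_
  rintro σ₄ ⟨F4, ⟨M, hM1, hM2, f4, f5⟩, t4⟩
  have F4' : Frame parameterVars [1, 2] σ σ₄ := by
    refine Frame.trans ?_ (F4.weaken (by simp) (by simp))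
    simpa using F3'
  have f1 : σ₄.var 1 = k := by rw [F4.var 1 (by simp)]; simpa using g1
  have f3 : σ₄.var 3 = TLE.sparsity k := by rw [F4.var 3 (by simp)]; simp [g6, hs']
  have hh1 : ∀ i < TLE.indep k, σ₄.mem 1 i = ω i (l₁ - 1) := fun i hi => by
    rw [F4.mem 1 (by simp)]
    simp only [Env.tick_mem, Env.set_mem]
    rw [F3.mem 1 (by simp), h2m i hi]
    simp [d1, hd]
  have hh2 : ∀ i < 2, σ₄.mem 2 i = ω (TLE.indep k + i) (l₂ - 1) := fun i hi => by
    rw [F4.mem 2 (by simp)]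
    simp only [Env.tick_mem, Env.set_mem]
    rw [h3m i hi]
    simp [d2, d1, hd]
  have htime : σ₄.time ≤ σ.time + 500 * TLE.sparsity k + 480 := by
    simp [add_mul] at t1 t2 t3 t4
    omega
  simp only [wp_ite, wp_skip]
  refine ⟨by simp, by simpa using hKW, fun hlt => ?_, fun hle => ?_⟩
  · simp only [Expr.val_var, Expr.val_lit, f1] at hlt
    refine (wp_bucketTable K (by simp [f1]; omega) (fun i hi => ⟨by omega, hKB i hi⟩)).mono ?_
    rintro σ₅ ⟨F5, hv, t5⟩
    obtain ⟨v4, v5⟩ := hv (by simpa [f1] using hlt)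
    simp only [Env.tick_var, f1] at v4 v5
    refine ⟨Frame.trans (by simpa using F4') (F5.weaken (by simp) (by simp)),
      by rw [F5.var 1 (by simp)]; simpa using f1, by rw [F5.var 3 (by simp)]; simpa using f3, ?_,
      by rw [F5.mem 1 (by simp)]; simpa using hh1, by rw [F5.mem 2 (by simp)]; simpa using hh2, ?_⟩
    · rw [v4, v5]
      exact bucketBounds_buckets hk
    · simp at t5
      omega
  · simp only [Expr.val_var, Expr.val_lit, f1] at hle
    refine ⟨by simpa using F4', by simpa using f1, by simpa using f3, ?_, by simpa using hh1,
      by simpa using hh2, by simp; omega⟩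
    simp only [Env.tick_var, f4, f5]
    exact hK M hle hM1 hM2

/-- Find the prime, with a table of least prime factors. -/
def findPrime : Cmd :=
  8 ::= 4 * .var 3 * .var 3 * .var 4 + 1 ;; 9 ::= 2 * (4 * .var 3 * .var 3 * .var 5 + 1) ;; sieve ;;
  2 ::= .var 8 ;; .while (.ld 6 (.var 2)) (.var 2) (2 ::= .var 2 + 1)

/-- The variables that `findPrime` changes. -/
abbrev findPrimeVars : List ℕ := [2, 8, 9, 10, 11, 12, 13, 14, 20]

/-- The scan starts at 4s²Bp + 1 ≥ C and stays within the sieve limit 2(4s²Bm + 1) ≤ 2C, so both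
bounds on p hold although B is not known exactly. The prime promised by `BucketBounds` stops the
scan. -/
theorem wp_findPrime {W : ℕ} {ω : Coins} {σ : Env} {k : ℕ} (hk : 2 ≤ k)
    (hW : 2 * TLE.primeBound k + 10 < W) (v3 : σ.var 3 = TLE.sparsity k)
    (hB : BucketBounds k (σ.var 4) (σ.var 5)) :
    findPrime.Wp W ω (fun σ' => Frame findPrimeVars [6, 7] σ σ' ∧ (σ'.var 2).Prime ∧
      TLE.primeBound k ≤ σ'.var 2 ∧ σ'.var 2 ≤ 2 * TLE.primeBound k ∧
      (∀ n, 2 ≤ n → n ≤ σ'.var 2 → σ'.mem 6 n = n.minFac) ∧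
      σ'.time ≤ σ.time + 700 * TLE.primeBound k + 700) σ := by
  obtain ⟨b1, b2, b3⟩ := hB.bounds
  obtain ⟨p, hp, p1, p2⟩ := hB.exists_prime
  have hPB := mul_le_primeBound hk
  have c1 : 4 * TLE.sparsity k * TLE.sparsity k * σ.var 4 = 4 * TLE.sparsity k ^ 2 * σ.var 4 := by
    ring
  have c2 : 4 * TLE.sparsity k * TLE.sparsity k * σ.var 5 = 4 * TLE.sparsity k ^ 2 * σ.var 5 := by
    ring
  have hsp := sparsity_mul_lt_primeBound hk
  have c3 : 4 * TLE.sparsity k * TLE.sparsity k ≤ TLE.primeBound k := by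
    rw [primeBound_eq]
    calc 4 * TLE.sparsity k * TLE.sparsity k = 4 * TLE.sparsity k ^ 2 * 1 := by ring
      _ ≤ 4 * TLE.sparsity k ^ 2 * TLE.buckets k := Nat.mul_le_mul_left _ (buckets_pos hk)
      _ ≤ _ := Nat.le_succ _
  simp only [findPrime, wp_seq, wp_assign]
  refine ⟨by simp [v3, c1]; omega, by simp [v3, c2]; omega, ?_⟩
  refine (wp_sieve (U := 2 * (4 * TLE.sparsity k ^ 2 * σ.var 5 + 1)) (by omega) (by omega)
    (by simp [v3, c2])).mono ?_
  rintro σ₁ ⟨F1, hlp, t1⟩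
  have e8 : σ₁.var 8 = 4 * TLE.sparsity k ^ 2 * σ.var 4 + 1 := by
    rw [F1.var 8 (by simp)]; simp [v3, c1]
  have F1' : Frame findPrimeVars [6, 7] σ σ₁ := by
    refine Frame.trans ?_ (F1.weaken (by simp) (by simp))
    simp [Frame.refl]
  simp only [wp_seq, wp_assign]
  refine ⟨by simp, ?_⟩
  refine wp_while (fun σ' => Frame findPrimeVars [6, 7] σ σ' ∧ σ'.mem 6 = σ₁.mem 6 ∧
    4 * TLE.sparsity k ^ 2 * σ.var 4 + 1 ≤ σ'.var 2 ∧ σ'.var 2 ≤ p ∧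
    σ'.time ≤ σ₁.time + 10 + 20 * σ'.var 2) (fun σ' => p - σ'.var 2) ?_ ?_
  · exact ⟨by simpa using F1', by simp, by simp [e8], by simp [e8, p1], by simp; omega⟩
  rintro σ' ⟨hF, hm, h1, h2, ht⟩
  have hmf : σ'.mem 6 (σ'.var 2) = (σ'.var 2).minFac := by rw [hm]; exact hlp _ (by omega) (by omega)
  refine ⟨by simp, by simp, fun hlt => ?_, fun hle => ?_⟩
  · simp only [Expr.val_ld, Expr.val_var, hmf] at hlt
    have hne : σ'.var 2 ≠ p := by
      intro h
      rw [h, hp.minFac_eq] at hlt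
      omega
    rw [wp_assign]
    exact ⟨by simp; omega, ⟨by simpa using hF, by simpa using hm, by simp; omega, by simp; omega,
      by simp; omega⟩, by simp; omega⟩
  · simp only [Expr.val_ld, Expr.val_var, hmf] at hle
    refine ⟨by simpa using hF, ?_, by simp; omega, by simp; omega, ?_, ?_⟩
    · rw [Env.tick_var, Nat.prime_def_minFac]
      exact ⟨by omega, le_antisymm (Nat.minFac_le (by omega)) hle⟩
    · intro n n1 n2
      simp only [Env.tick_mem, Env.tick_var, hm] at n2 ⊢
      exact hlp n n1 (by omega)
    · simp at t1 ⊢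
      omega

/-- The pre-processing. -/
noncomputable def pre (K : ℕ) : Cmd :=
  parameters K ;; findPrime ;; generator ;; .store 0 3 (.var 2) ;; .store 0 4 (.var 16) ;;
  -- Cells 5 and 6 lie outside the prescribed parameters; they hand Bp and s to the post-processing.
  -- All Bp ≥ B rows of counters are cleared.
  .store 0 5 (.var 4) ;; .store 0 6 (.var 3) ;; fill 5 (.var 4 * (2 * .var 3)) (.var 20) 0

/-- What the pre-processing leaves in the memory. -/
structure PreResult (ω : Coins) (k l₁ l₂ p : ℕ) (g : ZMod p) (Bp Bm : ℕ) (σ : Env) : Prop where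
  prime : p.Prime
  lower : TLE.primeBound k ≤ p
  upper : p ≤ 2 * TLE.primeBound k
  bounds : BucketBounds k Bp Bm
  ne_zero : g ≠ 0
  order : orderOf g = p - 1
  par_k : σ.mem 0 0 = k
  par_l₁ : σ.mem 0 1 = l₁
  par_l₂ : σ.mem 0 2 = l₂
  par_p : σ.mem 0 3 = p
  par_g : σ.mem 0 4 = g.val
  par_B : σ.mem 0 5 = Bp
  par_s : σ.mem 0 6 = TLE.sparsity k
  tables : PowTables g (p - 1) σ
  hash₁ : ∀ i < TLE.indep k, σ.mem 1 i = ω i (l₁ - 1)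
  hash₂ : ∀ i < 2, σ.mem 2 i = ω (TLE.indep k + i) (l₂ - 1)
  counters : ∀ i < Bp * (2 * TLE.sparsity k), σ.mem 5 i = 0

theorem wp_pre {W : ℕ} {ω : Coins} {σ : Env} {k K l₁ l₂ : ℕ} (hk : 2 ≤ k)
    (hW : 2 * k ^ 64 + 2 < W) (hPW : 10 * TLE.primeBound k ^ 2 < W) (hKW : K < W)
    (hKB : ∀ i < K, TLE.buckets i < W)
    (hK : ∀ M, K ≤ k → 2 ^ M ≤ k ^ 64 → k ^ 64 < 2 ^ (M + 1) →
      BucketBounds k (64 * k / M + 1) (64 * k / (M + 1)))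
    (m0 : σ.mem 0 0 = k) (m1 : σ.mem 0 1 = l₁) (m2 : σ.mem 0 2 = l₂) (h1 : 0 < l₁) (h2 : 0 < l₂)
    (hd : σ.draws = 0) :
    (pre K).Wp W ω (fun σ' => (∃ p g Bp Bm, PreResult ω k l₁ l₂ p g Bp Bm σ') ∧
      σ'.time ≤ σ.time + 20000 * TLE.primeBound k + 20 * K) σ := by
  have hPB := mul_le_primeBound hk
  have hsp := sparsity_mul_lt_primeBound hk
  have hPP : 960 * TLE.primeBound k ≤ TLE.primeBound k ^ 2 := by
    rw [sq]; exact Nat.mul_le_mul_right _ (by omega)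
  rw [pre, wp_seq]
  refine (wp_parameters hk hW (by omega) hKW hKB hK m0 m1 m2 h1 h2 hd).mono ?_
  rintro σ₁ ⟨F1, a1, a3, hB, hh1, hh2, t1⟩
  obtain ⟨b1, b2, b3⟩ := hB.bounds
  rw [wp_seq]
  refine (wp_findPrime hk (by omega) a3 hB).mono ?_
  rintro σ₂ ⟨F2, hp, p1, p2, hlp, t2⟩
  have : Fact (σ₂.var 2).Prime := ⟨hp⟩
  generalize hpd : σ₂.var 2 = p at *
  have hpp : p * p + p < W := by
    have : p * p ≤ (2 * TLE.primeBound k) * (2 * TLE.primeBound k) := Nat.mul_le_mul p2 p2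
    have : (2 * TLE.primeBound k) * (2 * TLE.primeBound k) = 4 * TLE.primeBound k ^ 2 := by ring
    omega
  rw [wp_seq]
  refine (wp_generator (p := p) hpp hpd hlp).mono ?_
  rintro σ₃ ⟨F3, ⟨g, hg, ho, e16, htab⟩, t3⟩
  have e2 : σ₃.var 2 = p := by rw [F3.var 2 (by simp), hpd]
  have e3 : σ₃.var 3 = TLE.sparsity k := by rw [F3.var 3 (by simp), F2.var 3 (by simp), a3]
  have e4 : σ₃.var 4 = σ₁.var 4 := by rw [F3.var 4 (by simp), F2.var 4 (by simp)]
  have cnt : σ₁.var 4 * (2 * TLE.sparsity k) ≤ 2 * TLE.primeBound k := by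
    have : 2 * TLE.sparsity k ≤ 4 * TLE.sparsity k ^ 2 := by
      rw [sparsity_eq]; nlinarith
    have := Nat.mul_le_mul_left (σ₁.var 4) this
    have : σ₁.var 4 * (4 * TLE.sparsity k ^ 2) = 4 * TLE.sparsity k ^ 2 * σ₁.var 4 := mul_comm _ _
    omega
  have o0 : σ₃.mem 0 = σ.mem 0 := by
    rw [F3.mem 0 (by simp), F2.mem 0 (by simp), F1.mem 0 (by simp)]
  have o1 : σ₃.mem 1 = σ₁.mem 1 := by rw [F3.mem 1 (by simp), F2.mem 1 (by simp)]
  have o2 : σ₃.mem 2 = σ₁.mem 2 := by rw [F3.mem 2 (by simp), F2.mem 2 (by simp)]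
  simp only [wp_seq, wp_store]
  refine ⟨by simp; omega, by simp, by simp; omega, by simp, by simp; omega, by simp,
    by simp; omega, by simp, ?_⟩
  refine (wp_fill (σ₁.var 4 * (2 * TLE.sparsity k)) id (fun _ => 0) (by omega)
    (fun _ _ _ _ h => h) (fun i hi σ' hF h20 => by simp [hF.var, e3, e4]; omega)
    (fun i hi σ' hF h20 => by simp [hF.var, h20]; omega)).mono ?_
  rintro σ₄ ⟨F4, hz, -, -, t4⟩
  have M0 : ∀ i, σ₄.mem 0 i = if i = 6 then TLE.sparsity k else if i = 5 then σ₁.var 4 else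
      if i = 4 then g.val else if i = 3 then p else σ.mem 0 i := fun i => by
    rw [F4.mem 0 (by simp)]
    simp [e2, e3, e4, e16, o0]
  refine ⟨⟨p, g, σ₁.var 4, σ₁.var 5, hp, p1, p2, hB, hg, ho, by simp [M0, m0], by simp [M0, m1],
    by simp [M0, m2], by simp [M0], by simp [M0], by simp [M0], by simp [M0], ?_, ?_, ?_,
    fun i hi => hz i hi⟩, ?_⟩
  · intro i hi
    rw [F4.mem 3 (by simp), F4.mem 4 (by simp)]
    simpa using htab i hi
  · rw [F4.mem 1 (by simp)]
    simpa [o1] using hh1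
  · rw [F4.mem 2 (by simp)]
    simpa [o2] using hh2
  · simp [add_mul] at t1 t2 t3 t4
    omega

end WordRAM

/-! ### The main theorem -/

namespace WordRAM
open Cmd

theorem buckets_le (k : ℕ) : TLE.buckets k ≤ k := by
  rcases Nat.lt_or_ge k 2 with h | h
  · interval_cases k <;> simp [TLE.buckets]
  · rw [TLE.buckets, Nat.ceil_le]
    exact div_le_self (Nat.cast_nonneg k) (one_le_logb h)

theorem primeBound_le_pow {k : ℕ} (hk : 2 ≤ k) : TLE.primeBound k ≤ k ^ 14 := by
  have h1 : TLE.sparsity k ≤ 17 * k := by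
    have : TLE.logCeil k ≤ k := by
      rw [logCeil_eq_clog]
      exact Nat.clog_le_of_le_pow Nat.lt_two_pow_self.le
    rw [sparsity_eq]
    omega
  rw [primeBound_eq]
  calc 4 * TLE.sparsity k ^ 2 * TLE.buckets k + 1 ≤ 4 * (17 * k) ^ 2 * k + 1 := by
        gcongr
        exact buckets_le k
    _ = 1156 * k ^ 3 + 1 := by ring
    _ ≤ 1157 * k ^ 3 := by have := Nat.one_le_pow 3 k (by omega); omega
    _ ≤ 2 ^ 11 * k ^ 3 := Nat.mul_le_mul_right _ (by norm_num)
    _ ≤ k ^ 11 * k ^ 3 := Nat.mul_le_mul_right _ (Nat.pow_le_pow_left hk 11)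
    _ = k ^ 14 := by ring

/-- Of the exponent K + 70, the excess 70 - 64 = 6 makes room for 2k^64 + 2, and K < 2^K ≤ k^K lets
the constants of the bucket table fit in a word. -/
theorem word_bounds {k K w : ℕ} (hk : 2 ≤ k) (h : k ^ (K + 70) ≤ 2 ^ w) :
    2 * k ^ 64 + 2 < 2 ^ w ∧ 10 * TLE.primeBound k ^ 2 < 2 ^ w ∧ K < 2 ^ w := by
  have h70 : k ^ 70 ≤ 2 ^ w := (Nat.pow_le_pow_right (by omega) (by omega)).trans h
  have h64 := Nat.one_le_pow 64 k (by omega)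
  refine ⟨?_, ?_, ?_⟩
  · have : 2 ^ 6 * k ^ 64 ≤ k ^ 70 := by
      calc 2 ^ 6 * k ^ 64 ≤ k ^ 6 * k ^ 64 := Nat.mul_le_mul_right _ (Nat.pow_le_pow_left hk 6)
        _ = k ^ 70 := by ring
    omega
  · have h2 : 1 ≤ TLE.primeBound k := by have := mul_le_primeBound hk; omega
    calc 10 * TLE.primeBound k ^ 2 < 2 ^ 4 * TLE.primeBound k ^ 2 := by
          have := Nat.one_le_pow 2 _ h2
          omega
      _ ≤ k ^ 4 * (k ^ 14) ^ 2 := Nat.mul_le_mul (Nat.pow_le_pow_left hk 4)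
          (Nat.pow_le_pow_left (primeBound_le_pow hk) 2)
      _ = k ^ 32 := by ring
      _ ≤ k ^ 70 := Nat.pow_le_pow_right (by omega) (by norm_num)
      _ ≤ 2 ^ w := h70
  · calc K < 2 ^ K := Nat.lt_two_pow_self
      _ ≤ k ^ K := Nat.pow_le_pow_left hk K
      _ ≤ k ^ (K + 70) := Nat.pow_le_pow_right (by omega) (by omega)
      _ ≤ 2 ^ w := h

section Real

theorem logb_le_self {k : ℕ} (hk : 2 ≤ k) : logb 2 (k : ℝ) ≤ k := by
  rw [logb_le_iff_le_rpow (by norm_num) (by positivity), rpow_natCast]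
  exact_mod_cast Nat.lt_two_pow_self.le

theorem isBigO_primeBound (K : ℕ) :
    (fun k : ℕ => ((20000 * TLE.primeBound k + 20 * K : ℕ) : ℝ)) =O[atTop]
      fun k : ℕ => (k : ℝ) * logb 2 k := by
  refine IsBigO.of_bound (20000 * 10000 + 20 * K) ?_
  filter_upwards [eventually_ge_atTop 2] with k hk
  have hX := one_le_logb hk
  have hk1 : (1 : ℝ) ≤ k := by exact_mod_cast (by omega : 1 ≤ k)
  have hXk := logb_le_self hk
  have hs := sparsity_le hk
  have hB : (TLE.buckets k : ℝ) ≤ k / logb 2 k + 1 := by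
    rw [TLE.buckets]
    exact (Nat.ceil_lt_add_one (by positivity)).le
  rw [norm_of_nonneg (Nat.cast_nonneg _), norm_of_nonneg (by positivity), primeBound_eq]
  generalize logb 2 (k : ℝ) = X at *
  have h1 : (1 : ℝ) ≤ k * X := one_le_mul_of_one_le_of_one_le hk1 hX
  have h2 : X * X ≤ k * X := mul_le_mul_of_nonneg_right hXk (by linarith)
  have h3 : 4 * (TLE.sparsity k : ℝ) ^ 2 * TLE.buckets k ≤ 9248 * (k * X) := by
    calc 4 * (TLE.sparsity k : ℝ) ^ 2 * TLE.buckets k ≤ 4 * (34 * X) ^ 2 * (k / X + 1) := by gcongr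
      _ = 4624 * (k * X + X * X) := by field_simp; ring
      _ ≤ 9248 * (k * X) := by linarith
  have h4 : (20 * K : ℝ) ≤ 20 * K * (k * X) := le_mul_of_one_le_right (by positivity) h1
  push_cast
  linarith

/-- A bound on the running time of `post`. -/
noncomputable def postTime (k : ℕ) : ℕ :=
  -- The bound must depend on k alone, so the estimate `upper_le` stands in for Bp.
  10000 * ((⌊2 * ((k : ℝ) / logb 2 k) + 1⌋₊ + 1) *
    ((TLE.sparsity k + 1) * (TLE.sparsity k + 1)) +
      (TLE.sparsity k + 1) * (k + TLE.sparsity k)) + 100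

theorem isBigO_postTime : (fun k : ℕ => (postTime k : ℝ)) =O[atTop] fun k : ℕ =>
    (k : ℝ) * logb 2 k * logb 2 (logb 2 k) * logb 2 (logb 2 (logb 2 k)) := by
  refine IsBigO.of_bound 100000000 ?_
  have t0 : Tendsto (logb 2) atTop atTop := tendsto_logb_atTop (by norm_num)
  have t1 : Tendsto (fun k : ℕ => logb 2 (k : ℝ)) atTop atTop :=
    t0.comp tendsto_natCast_atTop_atTop
  have t2 := t0.comp t1
  have t3 := t0.comp t2
  filter_upwards [eventually_ge_atTop 2, t2.eventually_ge_atTop 1, t3.eventually_ge_atTop 1]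
    with k hk e2 e3
  simp only [Function.comp] at e2 e3
  have hX := one_le_logb hk
  have hk1 : (1 : ℝ) ≤ k := by exact_mod_cast (by omega : 1 ≤ k)
  have hXk := logb_le_self hk
  have hs := sparsity_le hk
  rw [norm_of_nonneg (Nat.cast_nonneg _), norm_of_nonneg (by positivity)]
  have hfl : ((⌊2 * ((k : ℝ) / logb 2 k) + 1⌋₊ : ℕ) : ℝ) ≤ 2 * (k / logb 2 k) + 1 :=
    Nat.floor_le (by positivity)
  rw [postTime]
  generalize ⌊2 * ((k : ℝ) / logb 2 k) + 1⌋₊ = b at *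
  generalize logb 2 (logb 2 (logb 2 (k : ℝ))) = Z at *
  generalize logb 2 (logb 2 (k : ℝ)) = Y at *
  generalize logb 2 (k : ℝ) = X at *
  have h1 : (1 : ℝ) ≤ k * X := one_le_mul_of_one_le_of_one_le hk1 hX
  have h2 : X * X ≤ k * X := mul_le_mul_of_nonneg_right hXk (by linarith)
  have hs1 : (TLE.sparsity k : ℝ) + 1 ≤ 35 * X := by linarith
  have h3 : ((b : ℝ) + 1) * ((TLE.sparsity k + 1) * (TLE.sparsity k + 1)) ≤ 4900 * (k * X) := by
    calc ((b : ℝ) + 1) * ((TLE.sparsity k + 1) * (TLE.sparsity k + 1))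
        ≤ (2 * (k / X) + 1 + 1) * ((35 * X) * (35 * X)) := by gcongr
      _ = 2450 * (k * X + X * X) := by field_simp; ring
      _ ≤ 4900 * (k * X) := by linarith
  have h4 : ((TLE.sparsity k : ℝ) + 1) * (k + TLE.sparsity k) ≤ 1225 * (k * X) := by
    calc ((TLE.sparsity k : ℝ) + 1) * (k + TLE.sparsity k) ≤ 35 * X * (k + 34 * k) := by
          gcongr; linarith
      _ = 1225 * (k * X) := by ring
  -- The time is O(k log k); the iterated logarithms are eventually at least 1 and only weaken the
  -- bound.
  have h5 : (k : ℝ) * X ≤ k * X * Y * Z := by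
    rw [mul_assoc (k * X)]
    exact le_mul_of_one_le_right (by positivity) (one_le_mul_of_one_le_of_one_le e2 e3)
  push_cast
  linarith

end Real

theorem PreResult.preDone {ω : Coins} {k l₁ l₂ p : ℕ} {g : ZMod p} {Bp Bm : ℕ} {σ : Env} {c : State}
    (h : PreResult ω k l₁ l₂ p g Bp Bm σ) (hc : c.mem = σ.mem) :
    TLE.PreDone ω k l₁ l₂ p g.val c := by
  have : Fact p.Prime := ⟨h.prime⟩
  have hpow : ∀ i, (g ^ i).val = g.val ^ i % p := fun i => by
    rw [← ZMod.val_natCast, Nat.cast_pow, ZMod.natCast_zmod_val]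
  have hlog : ∀ y : ZMod p, y ≠ 0 → ∃ i < p - 1, g ^ i = y := fun y hy => by
    have := exists_pow_eq_of_orderOf_dvd h.ne_zero (h.order ▸ orderOf_dvd_sub_one hy)
    rwa [h.order] at this
  refine ⟨?_, ?_, ?_, ?_, ?_, h.prime, h.lower, h.upper, ZMod.val_lt g, ?_, ?_, ?_, ?_, ?_, ?_⟩
  · rw [hc]; exact h.par_k
  · rw [hc]; exact h.par_l₁
  · rw [hc]; exact h.par_l₂
  · rw [hc]; exact h.par_p
  · rw [hc]; exact h.par_g
  · refine ⟨Units.mk0 g h.ne_zero, by simp, fun x => ?_⟩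
    obtain ⟨i, -, hi⟩ := hlog x x.ne_zero
    refine ⟨i, Units.ext ?_⟩
    simpa using hi
  · intro i hi
    rw [hc, ← hpow]
    exact (h.tables i hi).1
  · intro x hx
    rw [Finset.mem_Icc] at hx
    have hxp : x < p := by omega
    have hx0 : (x : ZMod p) ≠ 0 := by
      intro h0
      have := ZMod.val_cast_of_lt hxp
      rw [h0, ZMod.val_zero] at this
      omega
    obtain ⟨i, hi, hix⟩ := hlog x hx0
    have hval : (g ^ i).val = x := by rw [hix, ZMod.val_cast_of_lt hxp]
    have := (h.tables i hi).2
    rw [hval] at this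
    rw [hc, this]
    exact ⟨hi, by rw [← hpow, hval]⟩
  · rw [hc]; exact h.hash₁
  · rw [hc]; exact h.hash₂
  · intro j hj z hz
    rw [Finset.mem_Icc] at hz
    rw [hc, TLE.counterIdx]
    refine h.counters _ ?_
    have := Nat.mul_le_mul_right (2 * TLE.sparsity k) (hj.trans_le h.bounds.le_upper)
    rw [Nat.succ_mul] at this
    omega

theorem PreResult.invTables {ω : Coins} {k l₁ l₂ p : ℕ} {g : ZMod p} {Bp Bm : ℕ} {σ τ : Env}
    (h : PreResult ω k l₁ l₂ p g Bp Bm σ) (h3 : τ.mem 3 = σ.mem 3) (h4 : τ.mem 4 = σ.mem 4) :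
    InvTables p τ := by
  have : Fact p.Prime := ⟨h.prime⟩
  intro x hx hxp
  have hx0 : (x : ZMod p) ≠ 0 := by
    intro h0
    have := ZMod.val_cast_of_lt hxp
    rw [h0, ZMod.val_zero] at this
    omega
  obtain ⟨i, hi, hix⟩ := exists_pow_eq_of_orderOf_dvd h.ne_zero
    (h.order ▸ orderOf_dvd_sub_one hx0)
  rw [h.order] at hi
  have hval : (g ^ i).val = x := by rw [hix, ZMod.val_cast_of_lt hxp]
  have ht := (h.tables i hi).2
  rw [hval] at ht
  have hlt : (p - 1 - i) % (p - 1) < p - 1 := Nat.mod_lt _ (by omega)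
  rw [h3, h4, ht, (h.tables _ hlt).1]
  refine ⟨by omega, ZMod.val_lt _, ?_⟩
  rw [ZMod.natCast_zmod_val, ← hix, ← h.order, pow_mod_orderOf, ← pow_add, h.order,
    Nat.sub_add_cancel hi.le]
  exact ZMod.pow_card_sub_one_eq_one h.ne_zero

theorem bucketMass_of_sparse {p s a : ℕ} [Fact p.Prime] {X : ℕ → ℕ} {F : ℕ → ZMod p}
    (hcard : ((Finset.Icc 1 (p - 1)).filter fun x => F x ≠ 0).card ≤ s)
    (hF : ∀ z ∈ Finset.Icc 1 (2 * s), ∑ x ∈ Finset.Icc 1 (p - 1), F x * (x : ZMod p) ^ z =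
      (X (a + (z - 1)) : ZMod p)) :
    BucketMass p s X a (∑ x ∈ Finset.Icc 1 (p - 1), (F x).valMinAbs.natAbs) := by
  classical
  set S := (Finset.Icc 1 (p - 1)).filter fun x => F x ≠ 0 with hS
  have hval : ∀ x ∈ S, (x : ZMod p).val = x := fun x hx => by
    rw [hS, Finset.mem_filter, Finset.mem_Icc] at hx
    have := (Fact.out : p.Prime).one_lt
    exact ZMod.val_cast_of_lt (by omega)
  have hinj : Set.InjOn (fun x : ℕ => (x : ZMod p)) S := fun x hx y hy h => by
    rw [← hval x hx, ← hval y hy]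
    exact congrArg ZMod.val h
  have hsum : ∀ {M : Type} [AddCommMonoid M] (G : ℕ → ZMod p → M), (∀ x, F x = 0 → G x (F x) = 0) →
      ∑ z ∈ S.image (fun x : ℕ => (x : ZMod p)), G z.val (F z.val) =
        ∑ x ∈ Finset.Icc 1 (p - 1), G x (F x) := fun G hG => by
    rw [Finset.sum_image hinj, Finset.sum_congr rfl fun x hx => by rw [hval x hx]]
    exact Finset.sum_filter_of_ne fun x _ h h' => h (hG x h')
  refine ⟨S.image (fun x : ℕ => (x : ZMod p)), fun z => F z.val, ?_, ?_,
    Finset.card_image_le.trans hcard, fun i hi => ?_, ?_⟩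
  · rw [Finset.mem_image]
    rintro ⟨x, hx, h0⟩
    have := hval x hx
    rw [h0, ZMod.val_zero] at this
    rw [hS, Finset.mem_filter, Finset.mem_Icc] at hx
    omega
  · intro z hz
    obtain ⟨x, hx, rfl⟩ := Finset.mem_image.1 hz
    show F (x : ZMod p).val ≠ 0
    rw [hval x hx]
    exact (Finset.mem_filter.1 hx).2
  · have := hF (i + 1) (Finset.mem_Icc.2 ⟨by omega, by omega⟩)
    rw [Nat.add_sub_cancel] at this
    rw [← this, ← hsum (fun x y => y * (x : ZMod p) ^ (i + 1)) (by simp +contextual)]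
    simp only [ZMod.natCast_zmod_val]
  · rw [← hsum (fun _ y => y.valMinAbs.natAbs) (by simp +contextual)]

theorem bucketMass_zero {p s a : ℕ} [Fact p.Prime] {X : ℕ → ℕ} (hX : ∀ i < 2 * s, X (a + i) = 0) :
    BucketMass p s X a 0 :=
  ⟨∅, fun _ => 0, by simp, by simp, by simp, fun i hi => by simp [hX i hi], by simp⟩

end WordRAM

open WordRAM in
theorem mainTheorem4 :
    ∃ (pre post : Program) (a : ℕ) (Tpre Tpost : ℕ → ℕ),
      ((fun k : ℕ => (Tpre k : ℝ)) =O[atTop] fun k : ℕ => (k : ℝ) * logb 2 k) ∧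
      ((fun k : ℕ => (Tpost k : ℝ)) =O[atTop] fun k : ℕ =>
        (k : ℝ) * logb 2 k * logb 2 (logb 2 k) * logb 2 (logb 2 (logb 2 k))) ∧
      ∀ k w l₁ l₂ : ℕ, 2 ≤ k → k ^ a ≤ 2 ^ w →
        l₁.Prime → l₂.Prime → l₁ < 2 ^ w → l₂ < 2 ^ w →
        ∀ (ω : Coins) (c₀ : State), TLE.PreStart w k l₁ l₂ c₀ →
          ∃ (p g : ℕ) (c₁ : State),
            HaltsWithin w ω pre (Tpre k) c₀ c₁ ∧ TLE.PreDone ω k l₁ l₂ p g c₁ ∧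
            ∀ c₂ : State, TLE.PostStart w k p c₁ c₂ →
              ∃ c₃ : State, HaltsWithin w ω post (Tpost k) c₂ c₃ ∧
                ∀ f : ℕ → ℕ → ZMod p, TLE.SparseSolution k p c₂ f →
                  TLE.output k p f ≤ k → c₃.reg 0 = TLE.output k p f := by
  obtain ⟨K, hK⟩ := bucketBounds_approx
  refine ⟨(WordRAM.pre K).program, WordRAM.post.program, K + 70,
    fun k => 20000 * TLE.primeBound k + 20 * K, postTime, isBigO_primeBound K, isBigO_postTime, ?_⟩
  intro k w l₁ l₂ hk hkw hl₁ hl₂ _ _ ω c₀ h₀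
  obtain ⟨w1, w2, w3⟩ := word_bounds hk hkw
  obtain ⟨σ₁, x1, ⟨p, g, Bp, Bm, hR⟩, t1⟩ := wp_pre (W := 2 ^ w) (ω := ω)
    (σ := WordRAM.State.env c₀) hk w1 w2 w3
    (fun i hi => (buckets_le i).trans_lt (hi.trans w3)) (fun M h1 h2 h3 => hK k M h1 hk h2 h3)
    h₀.k h₀.l₁ h₀.l₂ hl₁.pos hl₂.pos h₀.draws
  obtain ⟨c₁, r1, s1⟩ := x1.haltsWithin h₀.fits h₀.pc
    (T := 20000 * TLE.primeBound k + 20 * K) (by simpa [WordRAM.State.env] using t1)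
  refine ⟨p, g.val, c₁, r1, hR.preDone s1.mem, fun c₂ h₂ => ?_⟩
  have : Fact p.Prime := ⟨hR.prime⟩
  have hPB := mul_le_primeBound hk
  have hsp := sparsity_mul_lt_primeBound hk
  have hlow := hR.lower
  have hup := hR.upper
  have hs24 : 24 ≤ TLE.sparsity k := by rw [sparsity_eq]; omega
  obtain ⟨b1, b2, b3⟩ := hR.bounds.bounds
  set s := TLE.sparsity k with hs
  have hmem : ∀ A, A ≠ 5 → c₂.mem A = σ₁.mem A := fun A hA => by
    rw [← s1.mem]
    funext i
    exact h₂.others A i fun h => hA h.1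
  -- The program runs over Bp rows although only B are in use. The surplus rows were cleared and the
  -- stream leaves them alone, so they decode to the zero vector and add nothing.
  have hhigh : ∀ i, TLE.buckets k * (2 * s) ≤ i → i < Bp * (2 * s) → c₂.mem 5 i = 0 :=
    fun i h1 h2 => by
      rw [h₂.others 5 i fun h => absurd h.2 (not_lt.2 h1), s1.mem]
      exact hR.counters i h2
  have hrow : ∀ j n, j < n → (j + 1) * (2 * s) ≤ n * (2 * s) := fun j n h =>
    Nat.mul_le_mul_right _ h
  have hPP : 960 * TLE.primeBound k ≤ TLE.primeBound k ^ 2 := by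
    rw [sq]; exact Nat.mul_le_mul_right _ (by omega)
  have hpp : p * p ≤ 4 * TLE.primeBound k ^ 2 := by
    calc p * p ≤ (2 * TLE.primeBound k) * (2 * TLE.primeBound k) := Nat.mul_le_mul hup hup
      _ = _ := by ring
  have hBs : Bp * (2 * s) + Bp ≤ 2 * TLE.primeBound k := by
    have : 2 * s + 1 ≤ 4 * s ^ 2 := by nlinarith
    have := Nat.mul_le_mul_left Bp this
    have e : Bp * (4 * s ^ 2) = 4 * s ^ 2 * Bp := mul_comm _ _
    rw [mul_add, mul_one] at this
    omega
  have g1 : p * p + p < 2 ^ w := by omega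
  have g2 : 20 * s + 20 < 2 ^ w := by omega
  have g3 : k + s < 2 ^ w := by omega
  have g4 : Bp * (2 * s) + Bp + 1 < 2 ^ w := by omega
  obtain ⟨σ₃, x3, t3, ho⟩ := wp_post (W := 2 ^ w) (ω := ω) (σ := WordRAM.State.env c₂) (p := p)
    (s := s) (k := k) (B := Bp) g1 g2 (by omega) (by omega) (by omega) g3 g4
    ((congrFun (hmem 0 (by norm_num)) 0).trans hR.par_k)
    ((congrFun (hmem 0 (by norm_num)) 3).trans hR.par_p)
    ((congrFun (hmem 0 (by norm_num)) 6).trans hR.par_s)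
    ((congrFun (hmem 0 (by norm_num)) 5).trans hR.par_B)
    (hR.invTables (hmem 3 (by norm_num)) (hmem 4 (by norm_num))) (fun j hj i hi => by
      have h1 := hrow j Bp hj
      rw [add_one_mul] at h1
      show c₂.mem 5 (j * (2 * s) + i) < p
      rcases Nat.lt_or_ge j (TLE.buckets k) with h | h
      · exact h₂.counters j h (i + 1) (Finset.mem_Icc.2 ⟨by omega, by omega⟩)
      · rw [hhigh _ (by have := Nat.mul_le_mul_right (2 * s) h; omega) (by omega)]
        exact hR.prime.pos)
  obtain ⟨c₃, r3, s3⟩ := x3.haltsWithin h₂.fits h₂.pc (T := postTime k) (by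
    refine t3.trans ?_
    have : Bp ≤ ⌊2 * ((k : ℝ) / logb 2 k) + 1⌋₊ := Nat.le_floor hR.bounds.upper_le
    simp only [WordRAM.State.env, zero_add, postTime, ← hs]
    gcongr)
  refine ⟨c₃, r3, fun f hf hout => ?_⟩
  rw [show c₃.reg 0 = σ₃.var 0 from s3.reg 0]
  set m : ℕ → ℕ := fun j => if j < TLE.buckets k then
    ∑ x ∈ Finset.Icc 1 (p - 1), (f j x).valMinAbs.natAbs else 0 with hm
  have hsum : ∑ j ∈ Finset.range Bp, m j = TLE.output k p f := by
    rw [TLE.output, ← Finset.sum_subset (Finset.range_mono hR.bounds.le_upper)]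
    · exact Finset.sum_congr rfl fun j hj => if_pos (Finset.mem_range.1 hj)
    · intro j _ hj
      exact if_neg (by simpa using hj)
  rw [ho m ?_ (by omega), hsum]
  intro j hj
  show BucketMass p s (c₂.mem 5) _ _
  by_cases h : j < TLE.buckets k
  · simp only [hm, h, if_true]
    exact bucketMass_of_sparse (hf j h).1 (hf j h).2
  · simp only [hm, h, if_false]
    refine bucketMass_zero fun i hi => hhigh _ ?_ ?_
    · have := Nat.mul_le_mul_right (2 * s) (not_lt.1 h)
      omega
    · have h1 := hrow j Bp hj
      rw [add_one_mul] at h1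
      omega
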